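/- Let $J_1,\dots,J_n\subseteq\mathbb R$ be nonempty open intervals, $U=J_1\times\cdots\times J_n$, and let $g=\sum_{i=1}^n g_i(x)\,dx_i^2$ be a smooth pseudo-Riemannian metric on $U$ (each $g_i$ is $C^\infty$ and nowhere zero, of arbitrary sign). Call $g$ \emph{orthogonally separable} if near every point of $U$ the geodesic Hamilton–Jacobi equation $\tfrac12\sum_i g_i^{-1}(\partial_iW)^2=E$ has a complete integral $W(x,c)=\sum_i W_i(x_i,c)$, with $c$ in a nonempty open subset of $\mathbb R^n$ and $\det(\partial^2W/\partial x_i\partial c_j)\ne0$. Say that $g$ has \emph{diagonal curvature} if its Riemann tensor satisfies $R_{ijik}=0$ whenever $j\neq k$. For a set $S$ of coordinates, a tensor $g=\sum_{i\in S}g_i\,dx_i^2$ is of \emph{concircular-tensor form} if there are $M\subseteq S$ and a partition $P$ of $S\setminus M$ into nonempty sets such that $$g=\sum_{a\in M}\Phi_a\prod_{b\in M,\,b\ne a}(\sigma_a-\sigma_b)\,dx_a^2+\sum_{I\in P}\Big(\prod_{a\in M}(e_I-\sigma_a)\Big)g^I ,$$ where $\Phi_a,\sigma_a$ are smooth functions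 of $x_a$ only, $\sigma_a$ is nonconstant, the $e_I$ are constants, and each $g^I=\sum_{i\in I}g^I_i\,dx_i^2$ has coefficients depending only on $x_I=(x_i)_{i\in I}$. It is \emph{irreducible} if $M=S$, a \emph{product} if $M=\emptyset$ and $|P|\ge2$, and a \emph{warped product} if $M\neq\emptyset\ne P$. It is \emph{exceptional} if for some $a\in S$ and some nonempty partition $P$ of $S\setminus\{a\}$, $$g=\Phi\,dx_a^2+\sum_{I\in P}\sigma^I g^I ,$$ where $\Phi,\sigma^I$ are smooth functions of $x_a$ only, each $\sigma^I$ is nonconstant, and the $g^I$ are as before. Call $g$ \emph{classified} if it is irreducible, or if it can be written as a product, a warped product or an exceptional metric all of whose blocks $g^I$ are again classified (recursively). (1) If $g$ is orthogonally separable with diagonal curvature, then $g$ is classified. Moreover, whenever such a $g$ is written as a product, a warped product or an exceptional metric, each block $g^I$ pulls back to an orthogonally separable metric with diagonal curvature on the coordinate submanifolds on which only $x_I$ varies. (2) Conversely, if $g$ is classified, then with $H_i^2=|g_i|$ it satisfies the Levi-Civita equations $$\partial_i\partial_j\log H_i^2+\partial_j\log H_i^2\;\partial_i\log H_j^2=0\quad(i\ne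 j),$$ $$\partial_j\partial_k\log H_i^2-\partial_j\log H_i^2\,\partial_k\log H_i^2+\partial_j\log H_i^2\,\partial_k\log H_j^2+\partial_k\log H_i^2\,\partial_j\log H_k^2=0\quad(i,j,k\text{ distinct}),$$ and $g$ is orthogonally separable with diagonal curvature. -/

import Mathlib

open scoped ContDiff

noncomputable section

namespace OrthSep

universe u

variable {ι : Type u}

/-! ### Coordinate boxes and partial derivatives -/

/-- A nonempty open interval of the real line (possibly unbounded). -/
def IsOpenInterval (s : Set ℝ) : Prop :=
  IsOpen s ∧ s.OrdConnected ∧ s.Nonempty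

/-- The coordinate box `{x | x i ∈ J i for all i}`. -/
def box (J : ι → Set ℝ) : Set (ι → ℝ) :=
  Set.univ.pi J

/-- `f` takes two different values on `s`. -/
def NonconstOn (f : ℝ → ℝ) (s : Set ℝ) : Prop :=
  ∃ t ∈ s, ∃ t' ∈ s, f t ≠ f t'

/-- The partial derivative `∂f/∂xᵢ` at `x`. -/
def pd [Fintype ι] [DecidableEq ι] (i : ι) (f : (ι → ℝ) → ℝ) (x : ι → ℝ) : ℝ :=
  fderiv ℝ f x (Pi.single i 1)

/-! ### Levi-Civita connection and curvature of a metric in coordinates -/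

section Curvature

variable [Fintype ι] [DecidableEq ι]

/-- Christoffel symbols `Γᵏᵢⱼ` of the metric `g`. -/
def christoffel (g : (ι → ℝ) → Matrix ι ι ℝ) (k i j : ι) (x : ι → ℝ) : ℝ :=
  (1 / 2) * ∑ l, (g x)⁻¹ k l *
    (pd i (fun y => g y j l) x + pd j (fun y => g y i l) x - pd l (fun y => g y i j) x)

/-- The components `Rˡₖᵢⱼ = dxˡ(R(∂ᵢ, ∂ⱼ) ∂ₖ)` of the curvature tensor. -/
def riemannUp (g : (ι → ℝ) → Matrix ι ι ℝ) (l k i j : ι) (x : ι → ℝ) : ℝ :=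
  pd i (christoffel g l j k) x - pd j (christoffel g l i k) x
    + ∑ m, (christoffel g l i m x * christoffel g m j k x
      - christoffel g l j m x * christoffel g m i k x)

/-- The components `Rₗₖᵢⱼ = ⟨R(∂ᵢ, ∂ⱼ) ∂ₖ, ∂ₗ⟩` of the Riemann curvature tensor. -/
def riemann (g : (ι → ℝ) → Matrix ι ι ℝ) (l k i j : ι) (x : ι → ℝ) : ℝ :=
  ∑ m, g x l m * riemannUp g m k i j x

/-- Diagonal curvature: `Rᵢⱼᵢₖ = 0` on `U` whenever `j ≠ k`. -/
def HasDiagonalCurvature (U : Set (ι → ℝ)) (g : (ι → ℝ) → Matrix ι ι ℝ) : Prop :=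
  ∀ x ∈ U, ∀ i j k : ι, j ≠ k → riemann g i j i k x = 0

end Curvature

/-! ### Separability of the Hamilton-Jacobi equation -/

section HamiltonJacobi

variable [Fintype ι] [DecidableEq ι]

/-- The geodesic Hamiltonian `½ ∑ gⁱʲ(x) pᵢ pⱼ`. -/
def hamiltonian (g : (ι → ℝ) → Matrix ι ι ℝ) (x p : ι → ℝ) : ℝ :=
  (1 / 2) * ∑ i, ∑ j, (g x)⁻¹ i j * p i * p j

/-- The coordinates are separable for `g` on `U`: near every point of `U` the geodesic
Hamilton-Jacobi equation `H(x, ∂W/∂x) = E` has a complete integral of the form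
`W(x, c) = ∑ᵢ Wᵢ(xᵢ, c)`, where the parameter `c` ranges over a nonempty open subset `C` of `ℝⁿ`;
completeness is the condition `det (∂²W/∂xᵢ∂cⱼ) ≠ 0`. -/
def IsSeparable (U : Set (ι → ℝ)) (g : (ι → ℝ) → Matrix ι ι ℝ) : Prop :=
  ∀ x₀ ∈ U, ∃ (K : ι → Set ℝ) (C : Set (ι → ℝ)) (W : ι → ℝ → (ι → ℝ) → ℝ)
    (E : (ι → ℝ) → ℝ),
    (∀ i, IsOpenInterval (K i)) ∧ x₀ ∈ box K ∧ box K ⊆ U ∧ IsOpen C ∧ C.Nonempty ∧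
    (∀ i, ContDiffOn ℝ ∞ (fun q : ℝ × (ι → ℝ) => W i q.1 q.2) (K i ×ˢ C)) ∧
    ∀ x ∈ box K, ∀ c ∈ C,
      hamiltonian g x (fun i => deriv (fun t => W i t c) (x i)) = E c ∧
      (Matrix.of fun i j : ι =>
        pd j (fun c' => deriv (fun t => W i t c') (x i)) c).det ≠ 0

end HamiltonJacobi

/-! ### Orthogonal metrics

In orthogonal coordinates the metric is `g = ∑ᵢ gᵢ(x) dxᵢ²`, and it is given by the functions
`g i`, which are smooth and nowhere zero, of either sign. -/

/-- The matrix field of `∑ᵢ gᵢ dxᵢ²`. -/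
def diagMetric [DecidableEq ι] (g : ι → (ι → ℝ) → ℝ) (x : ι → ℝ) : Matrix ι ι ℝ :=
  Matrix.diagonal fun i => g i x

/-- `∑ᵢ gᵢ dxᵢ²` is a smooth pseudo-Riemannian metric on `U`. -/
def IsOrthMetric [Fintype ι] (U : Set (ι → ℝ)) (g : ι → (ι → ℝ) → ℝ) : Prop :=
  ∀ i, ContDiffOn ℝ ∞ (g i) U ∧ ∀ x ∈ U, g i x ≠ 0

/-- `∑ᵢ gᵢ dxᵢ²` is an orthogonally separable metric with diagonal curvature on `U`. -/
def IsOrthSepDiag [Fintype ι] [DecidableEq ι] (U : Set (ι → ℝ)) (g : ι → (ι → ℝ) → ℝ) : Prop :=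
  IsOrthMetric U g ∧ IsSeparable U (diagMetric g) ∧ HasDiagonalCurvature U (diagMetric g)

/-- The Levi-Civita equations for `Hᵢ² = |gᵢ|`. -/
def LeviCivitaEquations [Fintype ι] [DecidableEq ι]
    (U : Set (ι → ℝ)) (g : ι → (ι → ℝ) → ℝ) : Prop :=
  let L : ι → (ι → ℝ) → ℝ := fun i x => Real.log |g i x|
  ∀ x ∈ U,
    (∀ i j, i ≠ j → pd i (pd j (L i)) x + pd j (L i) x * pd i (L j) x = 0) ∧
    (∀ i j k, i ≠ j → i ≠ k → j ≠ k →
      pd j (pd k (L i)) x - pd j (L i) x * pd k (L i) x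
        + pd j (L i) x * pd k (L j) x + pd k (L i) x * pd j (L k) x = 0)

/-! ### The types of metrics

Let `S` be a set of coordinates. A tensor `∑_{i ∈ S} gᵢ dxᵢ²` is given by the functions `g i`
with `i ∈ S` (the other `g i` are ignored). -/

/-- `∑_{i ∈ I} hᵢ dxᵢ²` is, on the box, a tensor in the coordinates `x_I` only. -/
def DependsOnlyOn (J : ι → Set ℝ) (I : Finset ι) (h : ι → (ι → ℝ) → ℝ) : Prop :=
  ∀ i ∈ I, ∀ x ∈ box J, ∀ y ∈ box J, (∀ j ∈ I, x j = y j) → h i x = h i y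

/-- The pullback of `∑_{i ∈ I} hᵢ dxᵢ²` to the coordinate submanifold through `x₀` along which
only the coordinates `x_I` vary. -/
def pullback [DecidableEq ι] (I : Finset ι) (x₀ : ι → ℝ) (h : ι → (ι → ℝ) → ℝ) :
    I → (I → ℝ) → ℝ :=
  fun i y => h i fun j => if hj : j ∈ I then y ⟨j, hj⟩ else x₀ j

/-- The tensor `∑_{i ∈ I} hᵢ dxᵢ²` pulls back to an orthogonally separable metric with diagonal
curvature on the submanifolds with coordinates `x_I`. -/
def BlockIsOrthSepDiag [DecidableEq ι] (J : ι → Set ℝ) (I : Finset ι)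
    (h : ι → (ι → ℝ) → ℝ) : Prop :=
  ∀ x₀ ∈ box J, IsOrthSepDiag (box fun i : I => J i) (pullback I x₀ h)

variable [DecidableEq ι]

/-- The concircular-tensor form
`g = ∑_{a ∈ M} Φₐ ∏_{b ∈ M, b ≠ a} (σₐ - σ_b) dxₐ² + ∑_{I ∈ P} (∏_{a ∈ M} (e_I - σₐ)) g^I`,
where `M ⊆ S`, `P` is a partition of `S \ M`, `Φₐ` and `σₐ` are functions of `xₐ` with `σₐ`
nonconstant, the `e_I` are constants and each `g^I = ∑_{i ∈ I} (h I)ᵢ dxᵢ²` is a tensor in the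
coordinates `x_I`. -/
def IsConcircularForm (J : ι → Set ℝ) (S M : Finset ι) (P : Finpartition (S \ M))
    (h : Finset ι → ι → (ι → ℝ) → ℝ) (g : ι → (ι → ℝ) → ℝ) : Prop :=
  M ⊆ S ∧ ∃ (Φ σ : ι → ℝ → ℝ) (e : Finset ι → ℝ),
    (∀ a ∈ M, ContDiffOn ℝ ∞ (Φ a) (J a) ∧ ContDiffOn ℝ ∞ (σ a) (J a) ∧
      NonconstOn (σ a) (J a)) ∧
    (∀ I ∈ P.parts, DependsOnlyOn J I (h I)) ∧
    (∀ x ∈ box J, ∀ a ∈ M,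
      g a x = Φ a (x a) * ∏ b ∈ M.erase a, (σ a (x a) - σ b (x b))) ∧
    (∀ x ∈ box J, ∀ I ∈ P.parts, ∀ i ∈ I,
      g i x = (∏ a ∈ M, (e I - σ a (x a))) * h I i x)

/-- Irreducible metrics: the concircular-tensor form with `M = S` (and so `P` empty). -/
def IsIrreducible (J : ι → Set ℝ) (S : Finset ι) (g : ι → (ι → ℝ) → ℝ) : Prop :=
  ∃ P h, IsConcircularForm J S S P h g

/-- Product metrics: the concircular-tensor form with `M` empty, and at least two blocks. -/
def IsProduct (J : ι → Set ℝ) (S : Finset ι) (P : Finpartition (S \ ∅))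
    (h : Finset ι → ι → (ι → ℝ) → ℝ) (g : ι → (ι → ℝ) → ℝ) : Prop :=
  1 < P.parts.card ∧ IsConcircularForm J S ∅ P h g

/-- Warped product metrics: the concircular-tensor form with `M` and `P` nonempty. -/
def IsWarpedProduct (J : ι → Set ℝ) (S M : Finset ι) (P : Finpartition (S \ M))
    (h : Finset ι → ι → (ι → ℝ) → ℝ) (g : ι → (ι → ℝ) → ℝ) : Prop :=
  M.Nonempty ∧ P.parts.Nonempty ∧ IsConcircularForm J S M P h g

/-- Exceptional metrics `g = Φ dxₐ² + ∑_{I ∈ P} σ^I g^I`, where `P` is a nonempty partition of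
`S \ {a}`, `Φ` and `σ^I` are functions of `xₐ` with each `σ^I` nonconstant, and each `g^I` is a
tensor in the coordinates `x_I`. -/
def IsExceptional (J : ι → Set ℝ) (S : Finset ι) (a : ι) (P : Finpartition (S \ {a}))
    (h : Finset ι → ι → (ι → ℝ) → ℝ) (g : ι → (ι → ℝ) → ℝ) : Prop :=
  a ∈ S ∧ P.parts.Nonempty ∧ ∃ (Φ : ℝ → ℝ) (σ : Finset ι → ℝ → ℝ),
    ContDiffOn ℝ ∞ Φ (J a) ∧
    (∀ I ∈ P.parts, ContDiffOn ℝ ∞ (σ I) (J a) ∧ NonconstOn (σ I) (J a) ∧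
      DependsOnlyOn J I (h I)) ∧
    (∀ x ∈ box J, g a x = Φ (x a)) ∧
    (∀ x ∈ box J, ∀ I ∈ P.parts, ∀ i ∈ I, g i x = σ I (x a) * h I i x)

/-- In every way of writing `g` as a product, warped product or exceptional metric, all the blocks
`g^I` are orthogonally separable metrics with diagonal curvature. -/
def BlocksAreOrthSepDiag (J : ι → Set ℝ) (S : Finset ι) (g : ι → (ι → ℝ) → ℝ) : Prop :=
  (∀ P h, IsProduct J S P h g → ∀ I ∈ P.parts, BlockIsOrthSepDiag J I (h I)) ∧
  (∀ M P h, IsWarpedProduct J S M P h g → ∀ I ∈ P.parts, BlockIsOrthSepDiag J I (h I)) ∧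
  (∀ a P h, IsExceptional J S a P h g → ∀ I ∈ P.parts, BlockIsOrthSepDiag J I (h I))

/-- `g` is recursively of one of the four types: it is of one of the types, the blocks `g^I` that
occur are again of one of the types, and so on until only irreducible blocks are left. -/
inductive IsClassified (J : ι → Set ℝ) : Finset ι → (ι → (ι → ℝ) → ℝ) → Prop
  | irreducible {S : Finset ι} {g : ι → (ι → ℝ) → ℝ}
      (hg : IsIrreducible J S g) : IsClassified J S g
  | product {S : Finset ι} {g : ι → (ι → ℝ) → ℝ} (P : Finpartition (S \ ∅))
      (h : Finset ι → ι → (ι → ℝ) → ℝ) (hg : IsProduct J S P h g)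
      (hP : ∀ I ∈ P.parts, IsClassified J I (h I)) : IsClassified J S g
  | warped {S : Finset ι} {g : ι → (ι → ℝ) → ℝ} (M : Finset ι) (P : Finpartition (S \ M))
      (h : Finset ι → ι → (ι → ℝ) → ℝ) (hg : IsWarpedProduct J S M P h g)
      (hP : ∀ I ∈ P.parts, IsClassified J I (h I)) : IsClassified J S g
  | exceptional {S : Finset ι} {g : ι → (ι → ℝ) → ℝ} (a : ι) (P : Finpartition (S \ {a}))
      (h : Finset ι → ι → (ι → ℝ) → ℝ) (hg : IsExceptional J S a P h g)
      (hP : ∀ I ∈ P.parts, IsClassified J I (h I)) : IsClassified J S g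

end OrthSep

end

/-!
Differentiating the separated Hamilton-Jacobi equation in the parameters `c` produces a linear
system with constant right-hand side for the `1 / gᵢ` whose `i`-th coefficient row depends on `xᵢ`
only (a Stäckel system), and mixed second derivatives of this system give the Levi-Civita
equations. Given these, diagonal curvature says that `∂ⱼ log |gᵢ|` depends on `xᵢ` and `xⱼ` only.
The resulting differential system on the `∂ⱼ log |gᵢ|` passes to the blocks of `g`, so the
classification is an induction on the number of coordinates.

Write `i → j` if `gᵢ` depends on `xⱼ`. The system makes this relation transitive and makes any two
targets of a coordinate comparable, so some coordinate `o` is terminal: whatever `o` points to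
points back. If a coordinate neither is `o` nor points to `o`, then `g` is a product. If all the
others point to `o` and `o` points nowhere, then the functions `∂ₒ log |gᵢ|` of `xₒ` determine an
exceptional form. If `o` points to some `j`, then `gₒ dxₒ² + gⱼ dxⱼ²` is a Liouville metric with
conformal factor `σₒ(xₒ) - σⱼ(xⱼ)`, and this `σₒ` extends to solutions `σᵢ(xᵢ)` of
`∂ₖ log |gᵢ| (σᵢ - σₖ) = -σₖ'`, the eigenvalues of a concircular tensor: the nonconstant ones
form `M`, and the constant ones are grouped into blocks by their value.

Conversely, Stäckel functions of the blocks and polynomials in the `σₐ` assemble to Stäckel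
functions of a classified metric; a complete integral is `∑ᵢ ∫ √(∑ⱼ cⱼ uⱼᵢ) dxᵢ`. Diagonal
curvature holds because each `gᵢ` is a product of functions of two variables, one of which is `xᵢ`.
-/

open Set Filter Topology Function

namespace OrthSep

section Basics

variable {ι : Type*} {J : ι → Set ℝ} {x y : ι → ℝ}

lemma mem_box : x ∈ box J ↔ ∀ i, x i ∈ J i := mem_univ_pi

lemma isOpen_box [Finite ι] (hJ : ∀ i, IsOpenInterval (J i)) : IsOpen (box J) :=
  isOpen_set_pi finite_univ fun i _ => (hJ i).1

lemma box_nonempty (hJ : ∀ i, IsOpenInterval (J i)) : (box J).Nonempty :=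
  univ_pi_nonempty_iff.2 fun i => (hJ i).2.2

lemma convex_box (hJ : ∀ i, IsOpenInterval (J i)) : Convex ℝ (box J) :=
  convex_pi fun i _ => (hJ i).2.1.convex

lemma update_mem_box [DecidableEq ι] (hx : x ∈ box J) {i : ι} {t : ℝ} (ht : t ∈ J i) :
    update x i t ∈ box J :=
  update_mem_pi_iff_of_mem hx |>.2 fun _ => ht

/-- On the box, the function `f` depends on the coordinates in `T` only. -/
def DependsOnCoords (J : ι → Set ℝ) (T : Finset ι) (f : (ι → ℝ) → ℝ) : Prop :=
  ∀ x ∈ box J, ∀ y ∈ box J, (∀ j ∈ T, x j = y j) → f x = f y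

lemma dependsOnCoords_prod_comp_eval {M : Finset ι} (f : ι → ℝ → ℝ) :
    DependsOnCoords J M fun x => ∏ a ∈ M, f a (x a) :=
  fun _ _ _ _ h => Finset.prod_congr rfl fun a ha => by rw [h a ha]

lemma contDiffOn_comp_eval [Fintype ι] {n : ℕ∞ω} {φ : ℝ → ℝ} {i : ι}
    (hφ : ContDiffOn ℝ n φ (J i)) : ContDiffOn ℝ n (fun x : ι → ℝ => φ (x i)) (box J) :=
  hφ.comp (contDiff_apply ℝ ℝ i).contDiffOn fun _ hx => mem_box.1 hx i

lemma differentiableAt_comp_eval [Finite ι] {φ : ℝ → ℝ} {i : ι}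
    (hφ : DifferentiableAt ℝ φ (x i)) : DifferentiableAt ℝ (fun y : ι → ℝ => φ (y i)) x := by
  have := Fintype.ofFinite ι
  exact hφ.comp x (differentiableAt_apply i x)

lemma contDiffOn_comp_update [Fintype ι] [DecidableEq ι] {n : ℕ∞ω} {f : (ι → ℝ) → ℝ}
    (hf : ContDiffOn ℝ n f (box J)) (hx : x ∈ box J) (i : ι) :
    ContDiffOn ℝ n (fun t => f (update x i t)) (J i) :=
  hf.comp (contDiff_update n x i).contDiffOn fun _ ht => update_mem_box hx ht

lemma differentiableAt_of_contDiffOn {E F : Type*} [NormedAddCommGroup E] [NormedSpace ℝ E]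
    [NormedAddCommGroup F] [NormedSpace ℝ F] {U : Set E} (hU : IsOpen U) {f : E → F}
    (hf : ContDiffOn ℝ ∞ f U) {x : E} (hx : x ∈ U) : DifferentiableAt ℝ f x :=
  (hf.contDiffAt (hU.mem_nhds hx)).differentiableAt (by simp)

variable [Fintype ι] [DecidableEq ι] {f h : (ι → ℝ) → ℝ}

lemma fderiv_apply_eq_sum_pd (f : (ι → ℝ) → ℝ) (x v : ι → ℝ) :
    fderiv ℝ f x v = ∑ j, pd j f x * v j := by
  conv_lhs => rw [pi_eq_sum_univ' v, map_sum]
  refine Finset.sum_congr rfl fun j _ => ?_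
  rw [map_smul, smul_eq_mul, mul_comm, pd]

lemma hasDerivAt_comp_update (i : ι) (hf : DifferentiableAt ℝ f x) :
    HasDerivAt (fun t => f (update x i t)) (pd i f x) (x i) := by
  have hf' : HasFDerivAt f (fderiv ℝ f x) (update x i (x i)) := by
    simpa using hf.hasFDerivAt
  exact hf'.comp_hasDerivAt (x i) (hasDerivAt_update x i (x i))

lemma hasDerivAt_comp_update' (i : ι) {t : ℝ} (hf : DifferentiableAt ℝ f (update x i t)) :
    HasDerivAt (fun t => f (update x i t)) (pd i f (update x i t)) t := by
  simpa using hasDerivAt_comp_update i hf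

lemma pd_congr_of_eqOn {U : Set (ι → ℝ)} (hU : IsOpen U) (hx : x ∈ U) (hfh : EqOn f h U)
    (i : ι) : pd i f x = pd i h x := by
  rw [pd, pd, (eventuallyEq_of_mem (hU.mem_nhds hx) hfh).fderiv_eq]

lemma pd_const (i : ι) (c : ℝ) : pd i (fun _ => c) x = 0 := by
  simp [pd]

lemma pd_neg (i : ι) : pd i (fun y => -f y) x = -pd i f x := by
  simp [pd, fderiv_fun_neg]

lemma pd_sub (i : ι) (hf : DifferentiableAt ℝ f x) (hh : DifferentiableAt ℝ h x) :
    pd i (fun y => f y - h y) x = pd i f x - pd i h x := by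
  simp [pd, fderiv_fun_sub hf hh]

lemma pd_mul (i : ι) (hf : DifferentiableAt ℝ f x) (hh : DifferentiableAt ℝ h x) :
    pd i (fun y => f y * h y) x = pd i f x * h x + f x * pd i h x := by
  simp only [pd, fderiv_fun_mul hf hh, add_apply, smul_apply, smul_eq_mul]
  ring

lemma pd_const_mul (i : ι) (c : ℝ) (hf : DifferentiableAt ℝ f x) :
    pd i (fun y => c * f y) x = c * pd i f x := by
  simp [pd, fderiv_const_mul hf]

lemma pd_inv (i : ι) (hf : DifferentiableAt ℝ f x) (h0 : f x ≠ 0) :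
    pd i (fun y => (f y)⁻¹) x = -pd i f x / f x ^ 2 := by
  have hinv := (hasDerivAt_comp_update i hf).fun_inv (by simpa using h0)
  simpa using (hasDerivAt_comp_update i (hf.fun_inv h0)).unique hinv

lemma pd_div (i : ι) (hf : DifferentiableAt ℝ f x) (hh : DifferentiableAt ℝ h x) (h0 : h x ≠ 0) :
    pd i (fun y => f y / h y) x = (pd i f x * h x - f x * pd i h x) / h x ^ 2 := by
  simp only [div_eq_mul_inv]
  rw [pd_mul i hf (hh.fun_inv h0), pd_inv i hh h0]
  field_simp
  ring

lemma pd_sum {κ : Type*} (s : Finset κ) {F : κ → (ι → ℝ) → ℝ} (i : ι)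
    (hF : ∀ k ∈ s, DifferentiableAt ℝ (F k) x) :
    pd i (fun y => ∑ k ∈ s, F k y) x = ∑ k ∈ s, pd i (F k) x := by
  simp [pd, fderiv_fun_sum hF]

lemma pd_prod {κ : Type*} [DecidableEq κ] (s : Finset κ) {F : κ → (ι → ℝ) → ℝ} (i : ι)
    (hF : ∀ b ∈ s, DifferentiableAt ℝ (F b) x) :
    pd i (fun y => ∏ b ∈ s, F b y) x = ∑ b ∈ s, (∏ c ∈ s.erase b, F c x) * pd i (F b) x := by
  unfold pd
  rw [(HasFDerivAt.finsetProd fun b hb => (hF b hb).hasFDerivAt).fderiv]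
  simp

lemma pd_comp_eval_self (i : ι) {φ : ℝ → ℝ} (hφ : DifferentiableAt ℝ φ (x i)) :
    pd i (fun y => φ (y i)) x = deriv φ (x i) := by
  have h := hasDerivAt_comp_update i (differentiableAt_comp_eval hφ)
  simp only [update_self] at h
  exact h.deriv.symm

lemma pd_comp_eval_of_ne {i k : ι} (hik : k ≠ i) {φ : ℝ → ℝ} (hφ : DifferentiableAt ℝ φ (x i)) :
    pd k (fun y => φ (y i)) x = 0 := by
  have h := hasDerivAt_comp_update k (differentiableAt_comp_eval hφ)
  simp only [update_of_ne hik.symm] at h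
  exact h.unique (hasDerivAt_const _ _)

lemma contDiffOn_pd {U : Set (ι → ℝ)} (hU : IsOpen U) (hf : ContDiffOn ℝ ∞ f U) (i : ι) :
    ContDiffOn ℝ ∞ (pd i f) U :=
  (((contDiffOn_infty_iff_fderiv_of_isOpen hU).1 hf).2).clm_apply contDiffOn_const

lemma pd_comm {U : Set (ι → ℝ)} (hU : IsOpen U) (hf : ContDiffOn ℝ ∞ f U) (hx : x ∈ U)
    (i j : ι) : pd i (pd j f) x = pd j (pd i f) x := by
  have hsymm : IsSymmSndFDerivAt ℝ f x :=
    (hf.contDiffAt (hU.mem_nhds hx)).isSymmSndFDerivAt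
      (by simpa using (WithTop.coe_le_coe.2 (le_top : (2 : ℕ∞) ≤ ⊤)))
  have hd : DifferentiableAt ℝ (fderiv ℝ f) x :=
    differentiableAt_of_contDiffOn hU ((contDiffOn_infty_iff_fderiv_of_isOpen hU).1 hf).2 hx
  have pd_pd (k l : ι) :
      pd k (pd l f) x = fderiv ℝ (fderiv ℝ f) x (Pi.single k 1) (Pi.single l 1) := by
    change fderiv ℝ (fun y => fderiv ℝ f y (Pi.single l 1)) x (Pi.single k 1) = _
    simp [fderiv_clm_apply hd (differentiableAt_const _)]
  rw [pd_pd, pd_pd]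
  exact hsymm _ _

lemma dependsOnCoords_of_pd_eq_zero (hJ : ∀ i, IsOpenInterval (J i))
    (hf : DifferentiableOn ℝ f (box J)) {T : Finset ι}
    (h0 : ∀ j ∉ T, ∀ z ∈ box J, pd j f z = 0) : DependsOnCoords J T f := by
  intro x hx y hy hxy
  obtain ⟨z, hz, hmvt⟩ := domain_mvt
    (fun z hz => (hf.differentiableAt ((isOpen_box hJ).mem_nhds hz)).hasFDerivAt.hasFDerivWithinAt)
    (convex_box hJ) hy hx
  rw [← sub_eq_zero, hmvt, fderiv_apply_eq_sum_pd]
  refine Finset.sum_eq_zero fun j _ => ?_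
  by_cases hj : j ∈ T
  · simp [hxy j hj]
  · rw [h0 j hj z ((convex_box hJ).segment_subset hy hx hz), zero_mul]

lemma DependsOnCoords.pd_eq_zero (hJ : ∀ i, IsOpenInterval (J i))
    (hf : DifferentiableAt ℝ f x) {T : Finset ι} (hT : DependsOnCoords J T f) {i : ι}
    (hi : i ∉ T) (hx : x ∈ box J) : pd i f x = 0 := by
  refine (hasDerivAt_comp_update i hf).unique
    ((hasDerivAt_const _ (f x)).congr_of_eventuallyEq ?_)
  filter_upwards [(hJ i).1.mem_nhds (mem_box.1 hx i)] with t ht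
  exact hT _ (update_mem_box hx ht) _ hx fun j hj =>
    update_of_ne (ne_of_mem_of_not_mem hj hi) _ _

lemma update_eq_of_pd_eq_zero (hJ : ∀ i, IsOpenInterval (J i))
    (hf : DifferentiableOn ℝ f (box J)) {j : ι} (h0 : ∀ z ∈ box J, pd j f z = 0)
    (hx : x ∈ box J) {t : ℝ} (ht : t ∈ J j) : f (update x j t) = f x := by
  refine dependsOnCoords_of_pd_eq_zero hJ hf (T := Finset.univ.erase j) (fun k hk => ?_)
    _ (update_mem_box hx ht) _ hx fun k hk => update_of_ne (Finset.ne_of_mem_erase hk) _ _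
  obtain rfl : k = j := by simpa using hk
  exact h0

end Basics

/-! ### Stäckel systems and the Levi-Civita equations -/

section LogDerivative

variable {ι : Type*} [Fintype ι] [DecidableEq ι]

/-- The logarithmic derivative `∂ⱼ log |gᵢ|`, as the quotient `∂ⱼgᵢ / gᵢ`. -/
noncomputable def logpd (g : ι → (ι → ℝ) → ℝ) (i j : ι) (x : ι → ℝ) : ℝ :=
  pd j (g i) x / g i x

variable {U : Set (ι → ℝ)} {g : ι → (ι → ℝ) → ℝ} {x : ι → ℝ} {i : ι}

lemma contDiffOn_logpd (hU : IsOpen U) (hg : ContDiffOn ℝ ∞ (g i) U)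
    (h0 : ∀ x ∈ U, g i x ≠ 0) (j : ι) : ContDiffOn ℝ ∞ (logpd g i j) U :=
  (contDiffOn_pd hU hg j).div hg h0

lemma pd_eq_logpd_mul (h0 : g i x ≠ 0) (k : ι) : pd k (g i) x = logpd g i k x * g i x :=
  (div_mul_cancel₀ _ h0).symm

lemma pd_inv_eq_logpd_mul (hg : DifferentiableAt ℝ (g i) x) (h0 : g i x ≠ 0) (k : ι) :
    pd k (fun y => (g i y)⁻¹) x = -logpd g i k x * (g i x)⁻¹ := by
  rw [pd_inv k hg h0, logpd]
  field_simp

lemma pd_logpd_comm (hU : IsOpen U) (hg : ContDiffOn ℝ ∞ (g i) U)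
    (h0 : ∀ x ∈ U, g i x ≠ 0) (hx : x ∈ U) (j k : ι) :
    pd j (logpd g i k) x = pd k (logpd g i j) x := by
  have pd_logpd (a b : ι) : pd a (logpd g i b) x =
      (pd a (pd b (g i)) x * g i x - pd b (g i) x * pd a (g i) x) / g i x ^ 2 :=
    pd_div a (differentiableAt_of_contDiffOn hU (contDiffOn_pd hU hg b) hx)
      (differentiableAt_of_contDiffOn hU hg hx) (h0 x hx)
  rw [pd_logpd, pd_logpd, pd_comm hU hg hx]
  ring

lemma pd_pd_inv_eq_logpd (hU : IsOpen U) (hg : ContDiffOn ℝ ∞ (g i) U)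
    (h0 : ∀ x ∈ U, g i x ≠ 0) (hx : x ∈ U) (k l : ι) :
    pd l (pd k fun y => (g i y)⁻¹) x =
      (-pd l (logpd g i k) x + logpd g i k x * logpd g i l x) * (g i x)⁻¹ := by
  have hgd : ∀ y ∈ U, DifferentiableAt ℝ (g i) y := fun y hy =>
    differentiableAt_of_contDiffOn hU hg hy
  have hA : DifferentiableAt ℝ (logpd g i k) x :=
    differentiableAt_of_contDiffOn hU (contDiffOn_logpd hU hg h0 k) hx
  rw [pd_congr_of_eqOn hU hx fun y hy => pd_inv_eq_logpd_mul (hgd y hy) (h0 y hy) k,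
    pd_mul l hA.fun_neg ((hgd x hx).fun_inv (h0 x hx)), pd_neg,
    pd_inv_eq_logpd_mul (hgd x hx) (h0 x hx)]
  ring

end LogDerivative

section SeparatedSums

variable {ι : Type*} [Fintype ι] [DecidableEq ι] {K : ι → Set ℝ} {f : ι → (ι → ℝ) → ℝ}
  {u : ι → ℝ → ℝ} {E : ℝ} {x : ι → ℝ}

lemma pd_sum_mul_comp_eval (hf : ∀ i, DifferentiableAt ℝ (f i) x)
    (hu : ∀ i, DifferentiableAt ℝ (u i) (x i)) (k : ι) :
    pd k (fun y => ∑ i, f i y * u i (y i)) x =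
      ∑ i, pd k (f i) x * u i (x i) + f k x * deriv (u k) (x k) := by
  have hue (i : ι) : DifferentiableAt ℝ (fun y : ι → ℝ => u i (y i)) x :=
    differentiableAt_comp_eval (hu i)
  rw [pd_sum _ _ fun i _ => (hf i).fun_mul (hue i),
    Finset.sum_congr rfl fun i _ => pd_mul k (hf i) (hue i), Finset.sum_add_distrib]
  congr 1
  rw [Fintype.sum_eq_single k fun i hi => by rw [pd_comp_eval_of_ne hi.symm (hu i), mul_zero],
    pd_comp_eval_self k (hu k)]

lemma sum_pd_mul_eq_of_sum_mul_eq_const (hK : ∀ i, IsOpen (K i))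
    (hf : ∀ i, DifferentiableOn ℝ (f i) (box K)) (hu : ∀ i, DifferentiableOn ℝ (u i) (K i))
    (hE : ∀ x ∈ box K, ∑ i, f i x * u i (x i) = E) (hx : x ∈ box K) (k : ι) :
    ∑ i, pd k (f i) x * u i (x i) = -(f k x * deriv (u k) (x k)) := by
  have hbox : IsOpen (box K) := isOpen_set_pi finite_univ fun i _ => hK i
  have h := pd_sum_mul_comp_eval (fun i => (hf i).differentiableAt (hbox.mem_nhds hx))
    (fun i => (hu i).differentiableAt ((hK i).mem_nhds (mem_box.1 hx i))) k
  rw [pd_congr_of_eqOn hbox hx hE k, pd_const] at h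
  linarith

lemma sum_pd_pd_mul_eq_of_sum_mul_eq_const (hK : ∀ i, IsOpen (K i))
    (hf : ∀ i, ContDiffOn ℝ ∞ (f i) (box K)) (hu : ∀ i, ContDiffOn ℝ ∞ (u i) (K i))
    (hE : ∀ x ∈ box K, ∑ i, f i x * u i (x i) = E) (hx : x ∈ box K) {k l : ι} (hkl : k ≠ l) :
    ∑ i, pd l (pd k (f i)) x * u i (x i) =
      -(pd k (f l) x * deriv (u l) (x l)) - pd l (f k) x * deriv (u k) (x k) := by
  have hbox : IsOpen (box K) := isOpen_set_pi finite_univ fun i _ => hK i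
  have hfd (i : ι) : DifferentiableAt ℝ (f i) x := differentiableAt_of_contDiffOn hbox (hf i) hx
  have hpfd (i : ι) : DifferentiableAt ℝ (pd k (f i)) x :=
    differentiableAt_of_contDiffOn hbox (contDiffOn_pd hbox (hf i) k) hx
  have hud (i : ι) : DifferentiableAt ℝ (u i) (x i) :=
    differentiableAt_of_contDiffOn (hK i) (hu i) (mem_box.1 hx i)
  have hu'd : DifferentiableAt ℝ (deriv (u k)) (x k) :=
    differentiableAt_of_contDiffOn (hK k)
      ((contDiffOn_infty_iff_deriv_of_isOpen (hK k)).1 (hu k)).2 (mem_box.1 hx k)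
  have h := pd_congr_of_eqOn hbox hx (fun y hy => sum_pd_mul_eq_of_sum_mul_eq_const hK
    (fun i => (hf i).differentiableOn (by simp)) (fun i => (hu i).differentiableOn (by simp))
    hE hy k) l
  rw [pd_sum_mul_comp_eval hpfd hud, pd_neg,
    pd_mul l (hfd k) (differentiableAt_comp_eval hu'd), pd_comp_eval_of_ne hkl.symm hu'd] at h
  linarith

end SeparatedSums

section Staeckel

variable {ι : Type*} {J K : ι → Set ℝ} {S : Finset ι} {g : ι → (ι → ℝ) → ℝ} {x x₀ : ι → ℝ}
  {u : ι → ι → ℝ → ℝ} {E : ι → ℝ}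

/-- Stäckel functions `u j i` for `∑_{i ∈ S} gᵢ dxᵢ²`: the `i`-th row of the Stäckel matrix
`(u j i (xᵢ))ᵢⱼ` depends on `xᵢ` only, and the `1 / gᵢ` solve the linear system with constant
right-hand side `E` given by that matrix, which is required to be nonsingular at `x₀`. For
`E = (1, 0, …, 0)` the `1 / gᵢ` are a row of the inverse of the Stäckel matrix. -/
structure IsStaeckelSystem (J : ι → Set ℝ) (S : Finset ι) (g : ι → (ι → ℝ) → ℝ) (x₀ : ι → ℝ)
    (u : ι → ι → ℝ → ℝ) (E : ι → ℝ) : Prop where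
  contDiffOn : ∀ j ∈ S, ∀ i ∈ S, ContDiffOn ℝ ∞ (u j i) (J i)
  sum_inv_mul : ∀ j ∈ S, ∀ x ∈ box J, ∑ i ∈ S, (g i x)⁻¹ * u j i (x i) = E j
  nondegenerate : ∀ c : ι → ℝ, (∀ i ∈ S, ∑ j ∈ S, c j * u j i (x₀ i) = 0) → ∀ j ∈ S, c j = 0

/-- `∑_{i ∈ S} gᵢ dxᵢ²` has Stäckel functions on the box that are nondegenerate at `x₀`. -/
def HasStaeckelSystem (J : ι → Set ℝ) (S : Finset ι) (g : ι → (ι → ℝ) → ℝ) (x₀ : ι → ℝ) : Prop :=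
  ∃ u E, IsStaeckelSystem J S g x₀ u E

/-- `∑ᵢ gᵢ dxᵢ²` has Stäckel functions on some box around `x₀` in `U`. -/
def HasLocalStaeckelSystem [Fintype ι] (U : Set (ι → ℝ)) (g : ι → (ι → ℝ) → ℝ)
    (x₀ : ι → ℝ) : Prop :=
  ∃ K : ι → Set ℝ, (∀ i, IsOpenInterval (K i)) ∧ x₀ ∈ box K ∧ box K ⊆ U ∧
    HasStaeckelSystem K Finset.univ g x₀

/-- The Stäckel matrix, with rows indexed by the coordinates. -/
def staeckelMatrix (u : ι → ι → ℝ → ℝ) (x : ι → ℝ) : Matrix ι ι ℝ :=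
  Matrix.of fun i j => u j i (x i)

variable [Fintype ι]

lemma IsStaeckelSystem.det_ne_zero [DecidableEq ι] (hS : IsStaeckelSystem K Finset.univ g x₀ u E) :
    (staeckelMatrix u x₀).det ≠ 0 := by
  intro hdet
  obtain ⟨v, hv, hMv⟩ := Matrix.exists_mulVec_eq_zero_iff.2 hdet
  refine hv (funext fun j => hS.nondegenerate v (fun i _ => ?_) j (Finset.mem_univ j))
  simpa [Matrix.mulVec, dotProduct, staeckelMatrix, mul_comm] using congrFun hMv i

lemma IsStaeckelSystem.eq_zero_of_sum_mul_eq_zero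
    (hS : IsStaeckelSystem K Finset.univ g x₀ u E) {v : ι → ℝ}
    (hv : ∀ j, ∑ i, v i * u j i (x₀ i) = 0) : v = 0 := by
  classical
  by_contra hv0
  exact hS.det_ne_zero (Matrix.exists_vecMul_eq_zero_iff.1 ⟨v, hv0, funext hv⟩)

variable [DecidableEq ι]

theorem IsStaeckelSystem.pd_pd_inv (hK : ∀ i, IsOpen (K i)) (hg : IsOrthMetric (box K) g)
    (hS : IsStaeckelSystem K Finset.univ g x₀ u E) (hx₀ : x₀ ∈ box K) (i : ι) {k l : ι}
    (hkl : k ≠ l) :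
    pd l (pd k fun y => (g i y)⁻¹) x₀ =
      pd k (fun y => (g l y)⁻¹) x₀ * g l x₀ * pd l (fun y => (g i y)⁻¹) x₀ +
        pd l (fun y => (g k y)⁻¹) x₀ * g k x₀ * pd k (fun y => (g i y)⁻¹) x₀ := by
  set f : ι → (ι → ℝ) → ℝ := fun i y => (g i y)⁻¹
  have hfs (i : ι) : ContDiffOn ℝ ∞ (f i) (box K) := (hg i).1.inv (hg i).2
  have hfd (i : ι) : DifferentiableOn ℝ (f i) (box K) := (hfs i).differentiableOn (by simp)
  have hu (j i : ι) : ContDiffOn ℝ ∞ (u j i) (K i) := hS.contDiffOn j (by simp) i (by simp)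
  have hud (j i : ι) : DifferentiableOn ℝ (u j i) (K i) := (hu j i).differentiableOn (by simp)
  have hE (j : ι) : ∀ x ∈ box K, ∑ i, f i x * u j i (x i) = E j := hS.sum_inv_mul j (by simp)
  have hcomb : (fun i => pd l (pd k (f i)) x₀ - pd k (f l) x₀ * g l x₀ * pd l (f i) x₀
      - pd l (f k) x₀ * g k x₀ * pd k (f i) x₀) = 0 := by
    refine hS.eq_zero_of_sum_mul_eq_zero fun j => ?_
    have hdkl := sum_pd_pd_mul_eq_of_sum_mul_eq_const hK hfs (hu j) (hE j) hx₀ hkl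
    have hdl := sum_pd_mul_eq_of_sum_mul_eq_const hK hfd (hud j) (hE j) hx₀ l
    have hdk := sum_pd_mul_eq_of_sum_mul_eq_const hK hfd (hud j) (hE j) hx₀ k
    have hgf (i : ι) : g i x₀ * f i x₀ = 1 := mul_inv_cancel₀ ((hg i).2 x₀ hx₀)
    simp only [sub_mul, Finset.sum_sub_distrib, mul_assoc, ← Finset.mul_sum]
    rw [hdkl, hdl, hdk]
    linear_combination (pd k (f l) x₀ * deriv (u j l) (x₀ l)) * hgf l +
      (pd l (f k) x₀ * deriv (u j k) (x₀ k)) * hgf k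
  have h := congrFun hcomb i
  simp only [Pi.zero_apply] at h
  linear_combination h

theorem HasLocalStaeckelSystem.pd_logpd {U : Set (ι → ℝ)} (hg : IsOrthMetric U g)
    (hS : HasLocalStaeckelSystem U g x₀) (i : ι) {k l : ι} (hkl : k ≠ l) :
    pd l (logpd g i k) x₀ = logpd g i k x₀ * logpd g i l x₀
      - logpd g l k x₀ * logpd g i l x₀ - logpd g k l x₀ * logpd g i k x₀ := by
  obtain ⟨K, hK, hx₀, hKU, u, E, hS⟩ := hS
  have hgK : IsOrthMetric (box K) g := fun i =>
    ⟨(hg i).1.mono hKU, fun x hx => (hg i).2 x (hKU hx)⟩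
  have hne (i : ι) : g i x₀ ≠ 0 := (hgK i).2 x₀ hx₀
  have pd_inv' (i k : ι) : pd k (fun y => (g i y)⁻¹) x₀ = -logpd g i k x₀ * (g i x₀)⁻¹ :=
    pd_inv_eq_logpd_mul (differentiableAt_of_contDiffOn (isOpen_box hK) (hgK i).1 hx₀) (hne i) k
  have h := hS.pd_pd_inv (fun i => (hK i).1) hgK hx₀ i hkl
  rw [pd_pd_inv_eq_logpd (isOpen_box hK) (hgK i).1 (hgK i).2 hx₀, pd_inv', pd_inv', pd_inv',
    pd_inv', inv_mul_cancel_right₀ (hne l), inv_mul_cancel_right₀ (hne k)] at h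
  refine mul_right_cancel₀ (inv_ne_zero (hne i)) ?_
  linear_combination -h

end Staeckel

/-! ### Separable coordinates have a Stäckel system -/

section PartialSmoothness

variable {E F : Type*} [NormedAddCommGroup E] [NormedSpace ℝ E]
  [NormedAddCommGroup F] [NormedSpace ℝ F]

lemma contDiffOn_deriv_fst {K : Set ℝ} {C : Set E} (hK : IsOpen K) (hC : IsOpen C)
    {W : ℝ → E → F} (hW : ContDiffOn ℝ ∞ (fun q : ℝ × E => W q.1 q.2) (K ×ˢ C)) :
    ContDiffOn ℝ ∞ (fun q : ℝ × E => deriv (fun t => W t q.2) q.1) (K ×ˢ C) := by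
  have hfderiv : ContDiffOn ℝ ∞ (fun q : ℝ × E =>
      fderiv ℝ (fun q : ℝ × E => W q.1 q.2) q ((1 : ℝ), (0 : E))) (K ×ˢ C) :=
    ((contDiffOn_infty_iff_fderiv_of_isOpen (hK.prod hC)).1 hW).2.clm_apply contDiffOn_const
  refine hfderiv.congr fun q hq => ?_
  have hWq := (differentiableAt_of_contDiffOn (hK.prod hC) hW hq).hasFDerivAt
  have hline : HasDerivAt (fun t : ℝ => (t, q.2)) ((1 : ℝ), (0 : E)) q.1 :=
    (hasDerivAt_id q.1).prodMk (hasDerivAt_const _ _)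
  exact (HasFDerivAt.comp_hasDerivAt (f := fun t : ℝ => (t, q.2)) q.1 hWq hline).deriv

lemma contDiffOn_pd_snd {ι : Type*} [Fintype ι] [DecidableEq ι] {K : Set E} {C : Set (ι → ℝ)}
    (hK : IsOpen K) (hC : IsOpen C) {p : E → (ι → ℝ) → ℝ}
    (hp : ContDiffOn ℝ ∞ (fun q : E × (ι → ℝ) => p q.1 q.2) (K ×ˢ C)) (j : ι) :
    ContDiffOn ℝ ∞ (fun q : E × (ι → ℝ) => pd j (p q.1) q.2) (K ×ˢ C) := by
  have hfderiv : ContDiffOn ℝ ∞ (fun q : E × (ι → ℝ) =>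
      fderiv ℝ (fun q : E × (ι → ℝ) => p q.1 q.2) q ((0 : E), Pi.single j (1 : ℝ))) (K ×ˢ C) :=
    ((contDiffOn_infty_iff_fderiv_of_isOpen (hK.prod hC)).1 hp).2.clm_apply contDiffOn_const
  refine hfderiv.congr fun q hq => ?_
  have hpq := (differentiableAt_of_contDiffOn (hK.prod hC) hp hq).hasFDerivAt
  have hslice : fderiv ℝ (p q.1) q.2 = _ :=
    (HasFDerivAt.comp (f := fun c : ι → ℝ => (q.1, c)) q.2 hpq
      (hasFDerivAt_prodMk_right q.1 q.2)).fderiv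
  rw [pd, hslice]
  simp

end PartialSmoothness

section Separable

variable {ι : Type*} [Fintype ι] [DecidableEq ι]
  {U C : Set (ι → ℝ)} {g : ι → (ι → ℝ) → ℝ} {x x₀ c : ι → ℝ} {K : ι → Set ℝ}

lemma diagMetric_inv (h0 : ∀ i, g i x ≠ 0) :
    (diagMetric g x)⁻¹ = Matrix.diagonal fun i => (g i x)⁻¹ := by
  refine Matrix.inv_eq_right_inv ?_
  rw [diagMetric, Matrix.diagonal_mul_diagonal, ← Matrix.diagonal_one]
  congr 1
  funext i
  exact mul_inv_cancel₀ (h0 i)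

lemma hamiltonian_diagMetric (h0 : ∀ i, g i x ≠ 0) (p : ι → ℝ) :
    hamiltonian (diagMetric g) x p = (1 / 2) * ∑ i, (g i x)⁻¹ * p i ^ 2 := by
  simp only [hamiltonian, diagMetric_inv h0, Matrix.diagonal_apply, ite_mul, zero_mul,
    Finset.sum_ite_eq, Finset.mem_univ, if_true, pow_two, mul_assoc]

lemma pd_half_sum_mul_sq {κ : Type*} [Fintype κ] (a : κ → ℝ) {p : κ → (ι → ℝ) → ℝ}
    (hp : ∀ i, DifferentiableAt ℝ (p i) c) (j : ι) :
    pd j (fun y => (1 / 2) * ∑ i, a i * p i y ^ 2) c = ∑ i, a i * (p i c * pd j (p i) c) := by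
  have hsq (i : κ) : DifferentiableAt ℝ (fun y => a i * p i y ^ 2) c :=
    ((hp i).fun_pow 2).const_mul _
  rw [pd_const_mul _ _ (.fun_sum fun i _ => hsq i), pd_sum _ _ fun i _ => hsq i, Finset.mul_sum]
  refine Finset.sum_congr rfl fun i _ => ?_
  rw [pd_const_mul _ _ ((hp i).fun_pow 2)]
  simp only [pow_two]
  rw [pd_mul _ (hp i) (hp i)]
  ring

lemma fderiv_pi_surjective_of_det_ne_zero {p : ι → (ι → ℝ) → ℝ}
    (hp : ∀ i, DifferentiableAt ℝ (p i) c) (hdet : (Matrix.of fun i j => pd j (p i) c).det ≠ 0) :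
    Surjective (fderiv ℝ (fun y i => p i y) c) := by
  have hmulVec (v : ι → ℝ) :
      fderiv ℝ (fun y i => p i y) c v = (Matrix.of fun i j => pd j (p i) c).mulVec v := by
    funext i
    rw [fderiv_pi hp]
    exact fderiv_apply_eq_sum_pd (p i) c v
  rw [show ⇑(fderiv ℝ (fun y i => p i y) c) = (Matrix.of fun i j => pd j (p i) c).mulVec from
    funext hmulVec]
  exact Matrix.mulVec_surjective_iff_isUnit.2 ((Matrix.isUnit_iff_isUnit_det _).2 hdet.isUnit)

lemma dense_setOf_forall_ne_zero {κ : Type*} : Dense {v : κ → ℝ | ∀ i, v i ≠ 0} := by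
  have h := dense_pi univ (s := fun _ : κ => ({0}ᶜ : Set ℝ)) fun i _ => dense_compl_singleton 0
  rwa [show univ.pi (fun _ : κ => ({0}ᶜ : Set ℝ)) = {v | ∀ i, v i ≠ 0} by ext; simp] at h

lemma exists_forall_ne_zero_of_det_ne_zero (hC : IsOpen C) (hc : c ∈ C)
    {p : ι → (ι → ℝ) → ℝ} (hp : ∀ i, ContDiffOn ℝ ∞ (p i) C)
    (hdet : (Matrix.of fun i j => pd j (p i) c).det ≠ 0) : ∃ c ∈ C, ∀ i, p i c ≠ 0 := by
  have hstrict : HasStrictFDerivAt (fun y i => p i y) (fderiv ℝ (fun y i => p i y) c) c :=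
    (contDiffAt_pi.2 fun i => (hp i).contDiffAt (hC.mem_nhds hc)).hasStrictFDerivAt (n := ∞)
      (by simp)
  have hsurj := fderiv_pi_surjective_of_det_ne_zero
    (fun i => differentiableAt_of_contDiffOn hC (hp i) hc) hdet
  have himage : (fun y i => p i y) '' C ∈ 𝓝 (fun i => p i c) := by
    rw [← hstrict.map_nhds_eq_of_surj (LinearMap.range_eq_top.2 hsurj)]
    exact image_mem_map (hC.mem_nhds hc)
  obtain ⟨_, hv, c', hc', rfl⟩ := dense_setOf_forall_ne_zero.inter_nhds_nonempty himage
  exact ⟨c', hc', hv⟩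

/-- A solution of the separated Hamilton-Jacobi equation on `box K`, in terms of the momenta
`p i t c = ∂Wᵢ/∂t`, where `c ∈ C` are the parameters and `E c` is the energy. -/
structure IsSeparatedMomenta (K : ι → Set ℝ) (C : Set (ι → ℝ)) (g : ι → (ι → ℝ) → ℝ)
    (p : ι → ℝ → (ι → ℝ) → ℝ) (E : (ι → ℝ) → ℝ) : Prop where
  contDiffOn : ∀ i, ContDiffOn ℝ ∞ (fun q : ℝ × (ι → ℝ) => p i q.1 q.2) (K i ×ˢ C)
  hamiltonJacobi : ∀ x ∈ box K, ∀ c ∈ C, (1 / 2) * ∑ i, (g i x)⁻¹ * p i (x i) c ^ 2 = E c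
  det_ne_zero : ∀ x ∈ box K, ∀ c ∈ C, (Matrix.of fun i j => pd j (p i (x i)) c).det ≠ 0

variable {p : ι → ℝ → (ι → ℝ) → ℝ} {E : (ι → ℝ) → ℝ}

lemma IsSeparatedMomenta.contDiffOn_snd (hp : IsSeparatedMomenta K C g p E) {i : ι} {t : ℝ}
    (ht : t ∈ K i) : ContDiffOn ℝ ∞ (p i t) C :=
  (hp.contDiffOn i).comp (contDiff_prodMk_right t).contDiffOn fun _ hc => ⟨ht, hc⟩

/-- Differentiating the Hamilton-Jacobi equation in `cⱼ` gives `∑ᵢ gᵢ⁻¹ pᵢ ∂pᵢ/∂cⱼ = ∂E/∂cⱼ`. -/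
theorem IsSeparatedMomenta.isStaeckelSystem (hp : IsSeparatedMomenta K C g p E)
    (hK : ∀ i, IsOpen (K i)) (hC : IsOpen C) (hx₀ : x₀ ∈ box K) (hc : c ∈ C)
    (hne : ∀ i, p i (x₀ i) c ≠ 0) :
    IsStaeckelSystem K Finset.univ g x₀ (fun j i t => p i t c * pd j (p i t) c)
      fun j => pd j E c where
  contDiffOn j _ i _ := by
    have hin : ContDiffOn ℝ ∞ (fun t : ℝ => (t, c)) (K i) := (contDiff_prodMk_left c).contDiffOn
    have hmaps : MapsTo (fun t : ℝ => (t, c)) (K i) (K i ×ˢ C) := fun t ht => ⟨ht, hc⟩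
    exact ((hp.contDiffOn i).comp hin hmaps).mul
      ((contDiffOn_pd_snd (hK i) hC (hp.contDiffOn i) j).comp hin hmaps)
  sum_inv_mul j _ x hx := by
    rw [← pd_congr_of_eqOn hC hc (fun c hc => hp.hamiltonJacobi x hx c hc)]
    exact (pd_half_sum_mul_sq _ (fun i => differentiableAt_of_contDiffOn hC
      (hp.contDiffOn_snd (mem_box.1 hx i)) hc) j).symm
  nondegenerate v hv := by
    by_contra hv0
    refine hp.det_ne_zero x₀ hx₀ c hc (Matrix.exists_mulVec_eq_zero_iff.1
      ⟨v, fun h => hv0 fun j _ => congrFun h j, funext fun i => mul_left_cancel₀ (hne i) ?_⟩)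
    rw [Pi.zero_apply, mul_zero, ← hv i (Finset.mem_univ i), Matrix.mulVec, dotProduct,
      Finset.mul_sum]
    exact Finset.sum_congr rfl fun j _ => by rw [Matrix.of_apply]; ring

theorem hasLocalStaeckelSystem_of_isSeparable (hg : IsOrthMetric U g)
    (hsep : IsSeparable U (diagMetric g)) (hx₀ : x₀ ∈ U) : HasLocalStaeckelSystem U g x₀ := by
  obtain ⟨K, C, W, E, hK, hxK, hKU, hC, ⟨c, hc⟩, hW, hHJ⟩ := hsep x₀ hx₀
  have hp : IsSeparatedMomenta K C g (fun i t c => deriv (fun t => W i t c) t) E :=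
    { contDiffOn := fun i => contDiffOn_deriv_fst (hK i).1 hC (hW i)
      hamiltonJacobi := fun x hx c hc => by
        rw [← (hHJ x hx c hc).1, hamiltonian_diagMetric fun i => (hg i).2 x (hKU hx)]
      det_ne_zero := fun x hx c hc => (hHJ x hx c hc).2 }
  obtain ⟨c, hc, hne⟩ := exists_forall_ne_zero_of_det_ne_zero hC hc
    (fun i => hp.contDiffOn_snd (mem_box.1 hxK i)) (hp.det_ne_zero x₀ hxK c hc)
  exact ⟨K, hK, hxK, hKU, _, _, hp.isStaeckelSystem (fun i => (hK i).1) hC hxK hc hne⟩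

end Separable

/-! ### Smooth dependence of integrals on parameters -/

section ParametricIntegral

open MeasureTheory

variable {H F : Type*} [NormedAddCommGroup H] [NormedSpace ℝ H] [FiniteDimensional ℝ H]
  [NormedAddCommGroup F] [NormedSpace ℝ F] {V : Set H} {Ω : Set (H × ℝ)} {P : H × ℝ → F} {a b : ℝ}

lemma hasFDerivAt_intervalIntegral_of_contDiffOn (hV : IsOpen V) (hΩ : IsOpen Ω)
    (hVΩ : ∀ q ∈ V, ∀ s ∈ uIcc a b, (q, s) ∈ Ω) (hP : ContDiffOn ℝ 1 P Ω) {q : H} (hq : q ∈ V) :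
    HasFDerivAt (fun q => ∫ s in a..b, P (q, s))
      (∫ s in a..b, (fderiv ℝ P (q, s)).comp (.inl ℝ H ℝ)) q := by
  have hP' : ContinuousOn (fun z => (fderiv ℝ P z).comp (.inl ℝ H ℝ)) Ω :=
    (hP.continuousOn_fderiv_of_isOpen hΩ le_rfl).clm_comp continuousOn_const
  have : ProperSpace H := FiniteDimensional.proper ℝ H
  obtain ⟨ε, hε, hball⟩ := Metric.nhds_basis_closedBall.mem_iff.1 (hV.mem_nhds hq)
  have hcompact : IsCompact (Metric.closedBall q ε ×ˢ uIcc a b) :=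
    (isCompact_closedBall q ε).prod isCompact_uIcc
  obtain ⟨B, hB⟩ := hcompact.exists_bound_of_continuousOn
    (hP'.mono fun z hz => hVΩ z.1 (hball hz.1) z.2 hz.2)
  have hslice {y : H} (hy : y ∈ V) : ContinuousOn (fun s => P (y, s)) (uIcc a b) :=
    hP.continuousOn.comp (Continuous.prodMk_right y).continuousOn (hVΩ y hy)
  have hslice' : ContinuousOn (fun s => (fderiv ℝ P (q, s)).comp (.inl ℝ H ℝ)) (uIcc a b) :=
    hP'.comp (Continuous.prodMk_right q).continuousOn (hVΩ q hq)
  refine intervalIntegral.hasFDerivAt_integral_of_dominated_of_fderiv_le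
    (F' := fun q s => (fderiv ℝ P (q, s)).comp (.inl ℝ H ℝ)) (bound := fun _ => B)
    (Metric.closedBall_mem_nhds q hε) ?_ (hslice hq).intervalIntegrable
    ((hslice'.mono uIoc_subset_uIcc).aestronglyMeasurable measurableSet_uIoc)
    (.of_forall fun s hs y hy => hB (y, s) ⟨hy, uIoc_subset_uIcc hs⟩) intervalIntegrable_const
    (.of_forall fun s hs y hy => ?_)
  · filter_upwards [hV.mem_nhds hq] with y hy
    exact ((hslice hy).mono uIoc_subset_uIcc).aestronglyMeasurable measurableSet_uIoc
  · have hPy := ((hP.contDiffAt (hΩ.mem_nhds (hVΩ y (hball hy) s (uIoc_subset_uIcc hs)))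
      ).differentiableAt one_ne_zero).hasFDerivAt
    exact HasFDerivAt.comp (f := fun y : H => (y, s)) y hPy (hasFDerivAt_prodMk_left y s)

lemma contDiffOn_intervalIntegral (hV : IsOpen V) (hΩ : IsOpen Ω)
    (hVΩ : ∀ q ∈ V, ∀ s ∈ uIcc a b, (q, s) ∈ Ω) (hP : ContDiffOn ℝ ∞ P Ω) :
    ContDiffOn ℝ ∞ (fun q => ∫ s in a..b, P (q, s)) V := by
  refine contDiffOn_infty.2 fun n => ?_
  have hderiv {Q : H × ℝ → F} (hQ : ContDiffOn ℝ ∞ Q Ω) {q : H} (hq : q ∈ V) :=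
    hasFDerivAt_intervalIntegral_of_contDiffOn hV hΩ hVΩ (hQ.of_le (by norm_num)) hq
  induction n generalizing P with
  | zero =>
    rw [Nat.cast_zero, contDiffOn_zero]
    exact fun q hq => (hderiv hP hq).continuousAt.continuousWithinAt
  | succ n ih =>
    rw [Nat.cast_succ, contDiffOn_succ_iff_fderiv_of_isOpen hV, contDiffOn_clm_apply]
    refine ⟨fun q hq => (hderiv hP hq).differentiableAt.differentiableWithinAt, by simp,
      fun v => ?_⟩
    have hPv : ContDiffOn ℝ ∞ (fun z => (fderiv ℝ P z).comp (.inl ℝ H ℝ) v) Ω :=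
      (((contDiffOn_infty_iff_fderiv_of_isOpen hΩ).1 hP).2.clm_comp contDiffOn_const).clm_apply
        contDiffOn_const
    refine (ih hPv).congr fun q hq => ?_
    rw [(hderiv hP hq).fderiv, ContinuousLinearMap.intervalIntegral_apply]
    exact (((hP.continuousOn_fderiv_of_isOpen hΩ (by simp)).clm_comp continuousOn_const).comp
      (Continuous.prodMk_right q).continuousOn (hVΩ q hq)).intervalIntegrable

variable {K : Set ℝ} {C : Set H} {p : ℝ → H → F}

/-- The substitution `s = a + (t - a) r` moves the variable endpoint `t` into the integrand. -/
lemma contDiffOn_primitive (hK : IsOpenInterval K) (hC : IsOpen C)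
    (hp : ContDiffOn ℝ ∞ (fun q : ℝ × H => p q.1 q.2) (K ×ˢ C)) (ha : a ∈ K) :
    ContDiffOn ℝ ∞ (fun q : ℝ × H => ∫ s in a..q.1, p s q.2) (K ×ˢ C) := by
  have hsubst : ContDiff ℝ ∞ fun z : (ℝ × H) × ℝ => (a + (z.1.1 - a) * z.2, z.1.2) := by fun_prop
  have hunit : ContDiffOn ℝ ∞
      (fun q : ℝ × H => ∫ r in (0 : ℝ)..1, p (a + (q.1 - a) * r) q.2) (K ×ˢ C) := by
    refine contDiffOn_intervalIntegral (hK.1.prod hC)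
      ((hK.1.prod hC).preimage hsubst.continuous) (fun q hq r hr => ⟨?_, hq.2⟩)
      (P := fun z : (ℝ × H) × ℝ => p (a + (z.1.1 - a) * z.2) z.1.2)
      (hp.comp hsubst.contDiffOn fun z hz => hz)
    rw [uIcc_of_le zero_le_one] at hr
    simpa [mul_comm] using hK.2.1.convex.add_smul_sub_mem ha hq.1 hr
  have hlength : ContDiffOn ℝ ∞ (fun q : ℝ × H => q.1 - a) (K ×ˢ C) :=
    (contDiff_fst.sub contDiff_const).contDiffOn
  refine (hlength.smul hunit).congr fun q _ => ?_
  simpa using (intervalIntegral.smul_integral_comp_add_mul (a := 0) (b := 1)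
    (fun s => p s q.2) (q.1 - a) a).symm

lemma hasDerivAt_primitive [CompleteSpace F] (hK : IsOpenInterval K) {p : ℝ → F}
    (hp : ContinuousOn p K) {t : ℝ} (ha : a ∈ K) (ht : t ∈ K) :
    HasDerivAt (fun t => ∫ s in a..t, p s) (p t) t :=
  intervalIntegral.integral_hasDerivAt_right
    (hp.mono (hK.2.1.uIcc_subset ha ht)).intervalIntegrable
    (hp.stronglyMeasurableAtFilter hK.1 t ht) (hp.continuousAt (hK.1.mem_nhds ht))

end ParametricIntegral

/-! ### Stäckel systems are separable -/

section CompleteIntegral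

variable {ι : Type*} [Fintype ι] [DecidableEq ι] {U C : Set (ι → ℝ)} {K : ι → Set ℝ}
  {g : ι → (ι → ℝ) → ℝ} {p : ι → ℝ → (ι → ℝ) → ℝ} {E : (ι → ℝ) → ℝ}

/-- The complete integral is `W(x, c) = ∑ᵢ ∫ pᵢ(t, c) dt`. -/
theorem isSeparable_of_isSeparatedMomenta (hg : ∀ x ∈ U, ∀ i, g i x ≠ 0)
    (h : ∀ x₀ ∈ U, ∃ K C p E, (∀ i, IsOpenInterval (K i)) ∧ x₀ ∈ box K ∧ box K ⊆ U ∧ IsOpen C ∧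
      C.Nonempty ∧ IsSeparatedMomenta K C g p E) :
    IsSeparable U (diagMetric g) := by
  intro x₀ hx₀
  obtain ⟨K, C, p, E, hK, hxK, hKU, hC, hCne, hp⟩ := h x₀ hx₀
  have hderiv {i : ι} {t : ℝ} (ht : t ∈ K i) {c : ι → ℝ} (hc : c ∈ C) :
      deriv (fun t => ∫ s in x₀ i..t, p i s c) t = p i t c :=
    (hasDerivAt_primitive (hK i) ((hp.contDiffOn i).continuousOn.comp
      (Continuous.prodMk_left c).continuousOn fun s hs => ⟨hs, hc⟩) (mem_box.1 hxK i) ht).deriv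
  refine ⟨K, C, fun i t c => ∫ s in x₀ i..t, p i s c, E, hK, hxK, hKU, hC, hCne,
    fun i => contDiffOn_primitive (hK i) hC (hp.contDiffOn i) (mem_box.1 hxK i),
    fun x hx c hc => ⟨?_, ?_⟩⟩
  · rw [hamiltonian_diagMetric (hg x (hKU hx)), ← hp.hamiltonJacobi x hx c hc]
    simp only [hderiv (mem_box.1 hx _) hc]
  · have hpd (i j : ι) : pd j (fun c' => deriv (fun t => ∫ s in x₀ i..t, p i s c') (x i)) c =
        pd j (p i (x i)) c :=
      pd_congr_of_eqOn hC hc (fun c' hc' => hderiv (mem_box.1 hx i) hc') j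
    simpa only [hpd] using hp.det_ne_zero x hx c hc

end CompleteIntegral

section StaeckelMomenta

variable {ι : Type*} [Fintype ι] {K L : ι → Set ℝ} {C U : Set (ι → ℝ)}
  {g : ι → (ι → ℝ) → ℝ} {u : ι → ι → ℝ → ℝ} {E x x₀ c : ι → ℝ}

/-- The linear combinations `∑ⱼ cⱼ uⱼᵢ(t)` of the Stäckel functions: these are half the squares of
the momenta in the complete integral with parameters `c`. -/
def staeckelForm (u : ι → ι → ℝ → ℝ) (i : ι) (t : ℝ) (c : ι → ℝ) : ℝ :=
  ∑ j, c j * u j i t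

lemma contDiffOn_staeckelForm {i : ι} {s : Set ℝ} {n : ℕ∞ω}
    (hu : ∀ j, ContDiffOn ℝ n (u j i) s) (C : Set (ι → ℝ)) :
    ContDiffOn ℝ n (fun q : ℝ × (ι → ℝ) => staeckelForm u i q.1 q.2) (s ×ˢ C) :=
  ContDiffOn.sum fun j _ => ((contDiff_apply ℝ ℝ j).comp contDiff_snd).contDiffOn.mul
    ((hu j).comp contDiff_fst.contDiffOn fun _ hq => hq.1)

lemma IsStaeckelSystem.mono (hS : IsStaeckelSystem K Finset.univ g x₀ u E)
    (hLK : ∀ i, L i ⊆ K i) : IsStaeckelSystem L Finset.univ g x₀ u E where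
  contDiffOn j hj i hi := (hS.contDiffOn j hj i hi).mono (hLK i)
  sum_inv_mul j hj x hx := hS.sum_inv_mul j hj x (pi_mono (fun i _ => hLK i) hx)
  nondegenerate := hS.nondegenerate

lemma IsStaeckelSystem.half_sum_inv_mul_sq (hS : IsStaeckelSystem K Finset.univ g x₀ u E)
    (hx : x ∈ box K) (hpos : ∀ i, 0 ≤ staeckelForm u i (x i) c) :
    (1 / 2) * ∑ i, (g i x)⁻¹ * √(2 * staeckelForm u i (x i) c) ^ 2 = ∑ j, c j * E j := calc
  _ = ∑ i, (g i x)⁻¹ * staeckelForm u i (x i) c := by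
    rw [Finset.mul_sum]
    refine Finset.sum_congr rfl fun i _ => ?_
    rw [Real.sq_sqrt (mul_nonneg two_pos.le (hpos i))]
    ring
  _ = ∑ j, c j * ∑ i, (g i x)⁻¹ * u j i (x i) := by
    simp only [staeckelForm, Finset.mul_sum]
    rw [Finset.sum_comm]
    exact Finset.sum_congr rfl fun j _ => Finset.sum_congr rfl fun i _ => mul_left_comm _ _ _
  _ = ∑ j, c j * E j :=
    Finset.sum_congr rfl fun j hj => by rw [hS.sum_inv_mul j hj x hx]

lemma IsStaeckelSystem.eventually_staeckelForm_pos
    (hS : IsStaeckelSystem K Finset.univ g x₀ u E) (hK : ∀ i, IsOpen (K i)) (hx₀ : x₀ ∈ box K)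
    {i : ι} (hc : staeckelForm u i (x₀ i) c = 1) :
    ∀ᶠ q in 𝓝 (x₀, c), 0 < staeckelForm u i (q.1 i) q.2 := by
  have hcont : ContinuousAt (fun q : ℝ × (ι → ℝ) => staeckelForm u i q.1 q.2) (x₀ i, c) :=
    (contDiffOn_staeckelForm (fun j => hS.contDiffOn j (Finset.mem_univ j) i (Finset.mem_univ i))
      univ).continuousOn.continuousAt
      (((hK i).prod isOpen_univ).mem_nhds ⟨mem_box.1 hx₀ i, trivial⟩)
  have hproj : Tendsto (fun q : (ι → ℝ) × (ι → ℝ) => (q.1 i, q.2)) (𝓝 (x₀, c)) (𝓝 (x₀ i, c)) :=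
    (((continuous_apply i).comp continuous_fst).prodMk continuous_snd).tendsto (x₀, c)
  exact hproj.eventually (hcont.eventually (lt_mem_nhds (by simp [hc])))

variable [DecidableEq ι]

lemma pd_sqrt {f : (ι → ℝ) → ℝ} (i : ι) (hf : DifferentiableAt ℝ f x) (h0 : f x ≠ 0) :
    pd i (fun y => √(f y)) x = pd i f x / (2 * √(f x)) := by
  have hsqrt := (hasDerivAt_comp_update i hf).sqrt (by simpa using h0)
  simpa using (hasDerivAt_comp_update i (hf.sqrt h0)).unique hsqrt

lemma pd_staeckelForm (i : ι) (t : ℝ) (j : ι) : pd j (staeckelForm u i t) c = u j i t := by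
  have hd (k : ι) : DifferentiableAt ℝ (fun s : ℝ => s * u k i t) (c k) := by fun_prop
  unfold staeckelForm
  rw [pd_sum _ _ fun k _ => differentiableAt_comp_eval (hd k), Fintype.sum_eq_single j
    fun k hk => pd_comp_eval_of_ne (φ := fun s => s * u k i t) hk.symm (hd k),
    pd_comp_eval_self (φ := fun s => s * u j i t) j (hd j)]
  simp

lemma det_pd_sqrt_staeckelForm_ne_zero (hdet : (staeckelMatrix u x).det ≠ 0)
    (hpos : ∀ i, 0 < staeckelForm u i (x i) c) :
    (Matrix.of fun i j => pd j (fun c => √(2 * staeckelForm u i (x i) c)) c).det ≠ 0 := by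
  have hpd (i j : ι) : pd j (fun c => √(2 * staeckelForm u i (x i) c)) c =
      (√(2 * staeckelForm u i (x i) c))⁻¹ * staeckelMatrix u x i j := by
    have hd : DifferentiableAt ℝ (staeckelForm u i (x i)) c := by
      unfold staeckelForm
      fun_prop
    rw [pd_sqrt j (hd.const_mul 2) (mul_pos two_pos (hpos i)).ne', pd_const_mul j 2 hd,
      pd_staeckelForm, mul_div_mul_left _ _ two_ne_zero, div_eq_inv_mul, staeckelMatrix,
      Matrix.of_apply]
  simp only [hpd, Matrix.det_mul_column]
  exact mul_ne_zero (Finset.prod_ne_zero_iff.2 fun i _ =>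
    inv_ne_zero (Real.sqrt_pos.2 (mul_pos two_pos (hpos i))).ne') hdet

theorem IsStaeckelSystem.isSeparatedMomenta (hS : IsStaeckelSystem K Finset.univ g x₀ u E)
    (hdet : ∀ x ∈ box K, (staeckelMatrix u x).det ≠ 0)
    (hpos : ∀ i, ∀ t ∈ K i, ∀ c ∈ C, 0 < staeckelForm u i t c) :
    IsSeparatedMomenta K C g (fun i t c => √(2 * staeckelForm u i t c))
      fun c => ∑ j, c j * E j where
  contDiffOn i := (contDiffOn_const.mul (contDiffOn_staeckelForm
    (fun j => hS.contDiffOn j (Finset.mem_univ j) i (Finset.mem_univ i)) C)).sqrt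
    fun q hq => (mul_pos two_pos (hpos i q.1 hq.1 q.2 hq.2)).ne'
  hamiltonJacobi _ hx c hc := hS.half_sum_inv_mul_sq hx fun i =>
    (hpos i _ (mem_box.1 hx i) c hc).le
  det_ne_zero x hx c hc := det_pd_sqrt_staeckelForm_ne_zero (hdet x hx) fun i =>
    hpos i _ (mem_box.1 hx i) c hc

lemma exists_staeckelForm_eq_one (hdet : (staeckelMatrix u x).det ≠ 0) :
    ∃ c, ∀ i, staeckelForm u i (x i) c = 1 := by
  obtain ⟨c, hc⟩ := Matrix.mulVec_surjective_iff_isUnit.2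
    ((Matrix.isUnit_iff_isUnit_det _).2 hdet.isUnit) 1
  exact ⟨c, fun i => (Finset.sum_congr rfl fun j _ => mul_comm _ _).trans (congrFun hc i)⟩

lemma IsStaeckelSystem.eventually_det_ne_zero (hS : IsStaeckelSystem K Finset.univ g x₀ u E)
    (hK : ∀ i, IsOpen (K i)) (hx₀ : x₀ ∈ box K) : ∀ᶠ x in 𝓝 x₀, (staeckelMatrix u x).det ≠ 0 := by
  have hcont : ContinuousAt (staeckelMatrix u) x₀ :=
    continuousAt_pi.2 fun i => continuousAt_pi.2 fun j =>
      ContinuousAt.comp (f := fun x : ι → ℝ => x i)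
        ((hS.contDiffOn j (by simp) i (by simp)).continuousOn.continuousAt
          ((hK i).mem_nhds (mem_box.1 hx₀ i))) (continuousAt_apply i x₀)
  exact ((continuous_id.matrix_det.continuousAt).comp hcont).eventually_ne hS.det_ne_zero

lemma isOpenInterval_ball (a : ℝ) {ε : ℝ} (hε : 0 < ε) : IsOpenInterval (Metric.ball a ε) :=
  ⟨Metric.isOpen_ball, (convex_ball a ε).ordConnected, Metric.nonempty_ball.2 hε⟩

/-- Near a parameter `c` with `∑ⱼ cⱼ uⱼᵢ(x₀) = 1` the square roots defining the momenta exist. -/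
theorem HasLocalStaeckelSystem.exists_isSeparatedMomenta (hS : HasLocalStaeckelSystem U g x₀) :
    ∃ K C p E, (∀ i, IsOpenInterval (K i)) ∧ x₀ ∈ box K ∧ box K ⊆ U ∧ IsOpen C ∧
      C.Nonempty ∧ IsSeparatedMomenta K C g p E := by
  obtain ⟨K, hK, hxK, hKU, u, E, hS⟩ := hS
  have hKo (i : ι) : IsOpen (K i) := (hK i).1
  obtain ⟨c, hc⟩ := exists_staeckelForm_eq_one hS.det_ne_zero
  obtain ⟨ε, hε, hball⟩ := Metric.eventually_nhds_iff_ball.1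
    ((continuous_fst.tendsto (x₀, c)).eventually (((isOpen_box hK).eventually_mem hxK).and
      (hS.eventually_det_ne_zero hKo hxK)) |>.and
      (eventually_all.2 fun i => hS.eventually_staeckelForm_pos hKo hxK (hc i)))
  simp only [← ball_prod_same, mem_prod, Prod.forall] at hball
  set L : ι → Set ℝ := fun i => Metric.ball (x₀ i) ε
  have hbox : box L = Metric.ball x₀ ε := (ball_pi x₀ hε).symm
  have hxL : x₀ ∈ box L := hbox ▸ Metric.mem_ball_self hε
  have hL {x : ι → ℝ} (hx : x ∈ box L) {c' : ι → ℝ} (hc' : c' ∈ Metric.ball c ε) :=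
    hball x c' ⟨hbox ▸ hx, hc'⟩
  have hcε : c ∈ Metric.ball c ε := Metric.mem_ball_self hε
  have hLK (i : ι) : L i ⊆ K i := fun t ht => by
    simpa using mem_box.1 (hL (update_mem_box hxL ht) hcε).1.1 i
  exact ⟨L, Metric.ball c ε, _, _, fun i => isOpenInterval_ball _ hε, hxL,
    fun x hx => hKU (hL hx hcε).1.1, Metric.isOpen_ball, ⟨c, hcε⟩,
    (hS.mono hLK).isSeparatedMomenta (fun x hx => (hL hx hcε).1.2) fun i t ht c' hc' => by
      simpa using (hL (update_mem_box hxL ht) hc').2 i⟩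

theorem isSeparable_of_hasLocalStaeckelSystem (hg : ∀ x ∈ U, ∀ i, g i x ≠ 0)
    (hS : ∀ x₀ ∈ U, HasLocalStaeckelSystem U g x₀) : IsSeparable U (diagMetric g) :=
  isSeparable_of_isSeparatedMomenta hg fun x₀ hx₀ => (hS x₀ hx₀).exists_isSeparatedMomenta

end StaeckelMomenta

/-! ### Curvature of orthogonal metrics -/

section Curvature

variable {ι : Type*} [Fintype ι] [DecidableEq ι]
  {U : Set (ι → ℝ)} {g : ι → (ι → ℝ) → ℝ} {x : ι → ℝ} {i j k m : ι}

lemma pd_diagMetric (l i j : ι) :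
    pd l (fun y => diagMetric g y i j) x = if i = j then pd l (g i) x else 0 := by
  obtain rfl | h := eq_or_ne i j
  · simp [diagMetric]
  · simp [diagMetric, h, pd_const]

lemma christoffel_diagMetric (h0 : ∀ i, g i x ≠ 0) (k i j : ι) :
    christoffel (diagMetric g) k i j x = (1 / 2) * ((g k x)⁻¹ *
      ((if j = k then pd i (g j) x else 0) + (if i = k then pd j (g i) x else 0)
        - (if i = j then pd k (g i) x else 0))) := by
  simp only [christoffel, diagMetric_inv h0, Matrix.diagonal_apply, ite_mul, zero_mul,
    Finset.sum_ite_eq, Finset.mem_univ, if_true, pd_diagMetric]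

lemma christoffel_of_distinct (h0 : ∀ i, g i x ≠ 0) (hki : k ≠ i) (hkj : k ≠ j)
    (hij : i ≠ j) : christoffel (diagMetric g) k i j x = 0 := by
  rw [christoffel_diagMetric h0, if_neg hkj.symm, if_neg hki.symm, if_neg hij]
  ring

lemma christoffel_comm (h0 : ∀ i, g i x ≠ 0) (k i j : ι) :
    christoffel (diagMetric g) k i j x = christoffel (diagMetric g) k j i x := by
  rw [christoffel_diagMetric h0, christoffel_diagMetric h0]
  obtain rfl | h := eq_or_ne i j
  · rfl
  · rw [if_neg h, if_neg h.symm, add_comm]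

lemma christoffel_self_left (h0 : ∀ i, g i x ≠ 0) (k j : ι) :
    christoffel (diagMetric g) k k j x = (1 / 2) * logpd g k j x := by
  rw [christoffel_diagMetric h0, logpd]
  obtain rfl | h := eq_or_ne j k
  · simp only [if_true]; ring
  · simp only [if_neg h, if_neg h.symm, if_true]; ring

lemma christoffel_self_right (h0 : ∀ i, g i x ≠ 0) (k j : ι) :
    christoffel (diagMetric g) k j k x = (1 / 2) * logpd g k j x := by
  rw [christoffel_comm h0, christoffel_self_left h0]

lemma christoffel_lower_eq (h0 : ∀ i, g i x ≠ 0) (h : k ≠ j) :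
    christoffel (diagMetric g) k j j x = -(1 / 2) * ((g k x)⁻¹ * pd k (g j) x) := by
  rw [christoffel_diagMetric h0, if_neg h.symm, if_pos rfl]
  ring

lemma riemann_diagMetric (l k i j : ι) :
    riemann (diagMetric g) l k i j x = g l x * riemannUp (diagMetric g) l k i j x := by
  simp only [riemann, diagMetric, Matrix.diagonal_apply, ite_mul, zero_mul, Finset.sum_ite_eq,
    Finset.mem_univ, if_true]

lemma pd_half_logpd (hU : IsOpen U) (hg : IsOrthMetric U g) (hx : x ∈ U) {Γ : (ι → ℝ) → ℝ}
    (hΓ : ∀ y ∈ U, Γ y = (1 / 2) * logpd g i j y) (k : ι) :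
    pd k Γ x = (1 / 2) * pd k (logpd g i j) x := by
  rw [pd_congr_of_eqOn hU hx hΓ, pd_const_mul k _
    (differentiableAt_of_contDiffOn hU (contDiffOn_logpd hU (hg i).1 (hg i).2 j) hx)]

lemma sum_christoffel_mul_christoffel_of_distinct (h0 : ∀ i, g i x ≠ 0) (hij : i ≠ j)
    (hik : i ≠ k) (hjk : j ≠ k) :
    ∑ m, (christoffel (diagMetric g) i i m x * christoffel (diagMetric g) m k j x
      - christoffel (diagMetric g) i k m x * christoffel (diagMetric g) m i j x) =
      (1 / 4) * (logpd g i k x * logpd g k j x + logpd g i j x * logpd g j k x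
        - logpd g i k x * logpd g i j x) := by
  have hleft : ∑ m, christoffel (diagMetric g) i i m x * christoffel (diagMetric g) m k j x =
      (1 / 4) * (logpd g i k x * logpd g k j x + logpd g i j x * logpd g j k x) := by
    rw [Fintype.sum_eq_add j k hjk fun m hm => by
      rw [christoffel_of_distinct h0 hm.2 hm.1 hjk.symm, mul_zero]]
    simp only [christoffel_self_left h0, christoffel_self_right h0]
    ring
  have hright : ∑ m, christoffel (diagMetric g) i k m x * christoffel (diagMetric g) m i j x =
      (1 / 4) * (logpd g i k x * logpd g i j x) := by
    rw [Fintype.sum_eq_single i fun m hmi => ?_, christoffel_self_left h0,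
      christoffel_self_right h0]
    · ring
    obtain rfl | hmk := eq_or_ne m k
    · rw [christoffel_of_distinct h0 hmi hjk.symm hij, mul_zero]
    · rw [christoffel_of_distinct h0 hik hmi.symm hmk.symm, zero_mul]
  rw [Finset.sum_sub_distrib, hleft, hright]
  ring

lemma riemannUp_of_distinct (hU : IsOpen U) (hg : IsOrthMetric U g) (hx : x ∈ U)
    (hij : i ≠ j) (hik : i ≠ k) (hjk : j ≠ k) :
    riemannUp (diagMetric g) i j i k x = -(1 / 2) * pd k (logpd g i j) x +
      (1 / 4) * (logpd g i k x * logpd g k j x + logpd g i j x * logpd g j k x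
        - logpd g i k x * logpd g i j x) := by
  have h0 {y : ι → ℝ} (hy : y ∈ U) (i : ι) : g i y ≠ 0 := (hg i).2 y hy
  have hpd_i : pd i (christoffel (diagMetric g) i k j) x = 0 := by
    rw [pd_congr_of_eqOn hU hx (h := fun _ => 0)
      (fun y hy => christoffel_of_distinct (h0 hy) hik hij hjk.symm), pd_const]
  rw [riemannUp, hpd_i, pd_half_logpd hU hg hx (fun y hy => christoffel_self_left (h0 hy) i j) k,
    sum_christoffel_mul_christoffel_of_distinct (h0 hx) hij hik hjk]
  ring

lemma riemannUp_self_left (hU : IsOpen U) (hg : IsOrthMetric U g) (hx : x ∈ U)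
    (hik : i ≠ k) : riemannUp (diagMetric g) i i i k x = 0 := by
  have h0 {y : ι → ℝ} (hy : y ∈ U) (i : ι) : g i y ≠ 0 := (hg i).2 y hy
  rw [riemannUp, pd_half_logpd hU hg hx (fun y hy => christoffel_self_right (h0 hy) i k) i,
    pd_half_logpd hU hg hx (fun y hy => christoffel_self_right (h0 hy) i i) k,
    pd_logpd_comm hU (hg i).1 (hg i).2 hx i k, Fintype.sum_eq_add i k hik fun m hm => by
      rw [christoffel_of_distinct (h0 hx) hm.2 hm.1 hik.symm,
        christoffel_of_distinct (h0 hx) hik hm.1.symm hm.2.symm, mul_zero, zero_mul, sub_zero]]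
  simp only [christoffel_self_left (h0 hx), christoffel_self_right (h0 hx),
    christoffel_lower_eq (h0 hx) hik, christoffel_lower_eq (h0 hx) hik.symm, logpd]
  ring

theorem hasDiagonalCurvature_iff_pd_logpd (hU : IsOpen U) (hg : IsOrthMetric U g) :
    HasDiagonalCurvature U (diagMetric g) ↔ ∀ x ∈ U, ∀ i j k : ι, i ≠ j → i ≠ k → j ≠ k →
      2 * pd k (logpd g i j) x = logpd g i k x * logpd g k j x + logpd g i j x * logpd g j k x
        - logpd g i k x * logpd g i j x := by
  refine forall₂_congr fun x hx => ⟨fun h i j k hij hik hjk => ?_, fun h i j k hjk => ?_⟩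
  · have hR := h i j k hjk
    rw [riemann_diagMetric, mul_eq_zero_iff_left ((hg i).2 x hx),
      riemannUp_of_distinct hU hg hx hij hik hjk] at hR
    linarith
  · rw [riemann_diagMetric, mul_eq_zero_iff_left ((hg i).2 x hx)]
    obtain rfl | hij := eq_or_ne i j
    · exact riemannUp_self_left hU hg hx hjk
    obtain rfl | hik := eq_or_ne i k
    · simp [riemannUp]
    · rw [riemannUp_of_distinct hU hg hx hij hik hjk]
      linarith [h i j k hij hik hjk]

end Curvature

/-! ### Classified metrics have Stäckel systems -/

section BlockForm

variable {ι : Type*} [DecidableEq ι] {J : ι → Set ℝ} {S M : Finset ι} {P : Finpartition (S \ M)}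
  {h : Finset ι → ι → (ι → ℝ) → ℝ} {g : ι → (ι → ℝ) → ℝ} {w : Finset ι → ι → ℝ → ℝ}
  {I : Finset ι} {i : ι} {x : ι → ℝ}

/-- `∑_{i ∈ S} gᵢ dxᵢ²` is smooth and nondegenerate on the box. -/
def IsOrthMetricOn [Fintype ι] (J : ι → Set ℝ) (S : Finset ι) (g : ι → (ι → ℝ) → ℝ) : Prop :=
  ∀ i ∈ S, ContDiffOn ℝ ∞ (g i) (box J) ∧ ∀ x ∈ box J, g i x ≠ 0

/-- The part of `g` outside `M` is a sum of blocks `g^I = ∑_{i ∈ I} (h I)ᵢ dxᵢ²`, each multiplied by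
a product of functions of the single variables `xₐ`, `a ∈ M`. This is what concircular-tensor forms
and exceptional metrics have in common. -/
structure IsBlockForm (J : ι → Set ℝ) (S M : Finset ι) (P : Finpartition (S \ M))
    (h : Finset ι → ι → (ι → ℝ) → ℝ) (g : ι → (ι → ℝ) → ℝ) (w : Finset ι → ι → ℝ → ℝ) : Prop where
  contDiffOn : ∀ I ∈ P.parts, ∀ a ∈ M, ContDiffOn ℝ ∞ (w I a) (J a)
  dependsOnlyOn : ∀ I ∈ P.parts, DependsOnlyOn J I (h I)
  eq_mul : ∀ x ∈ box J, ∀ I ∈ P.parts, ∀ i ∈ I, g i x = (∏ a ∈ M, w I a (x a)) * h I i x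

lemma mem_of_mem_parts (hI : I ∈ P.parts) (hi : i ∈ I) : i ∈ S :=
  (Finset.mem_sdiff.1 (P.le hI hi)).1

lemma notMem_of_mem_parts (hI : I ∈ P.parts) (hi : i ∈ I) : i ∉ M :=
  (Finset.mem_sdiff.1 (P.le hI hi)).2

lemma part_mem_parts (hi : i ∈ S) (hiM : i ∉ M) : P.part i ∈ P.parts :=
  P.part_mem.2 (Finset.mem_sdiff.2 ⟨hi, hiM⟩)

lemma mem_part (hi : i ∈ S) (hiM : i ∉ M) : i ∈ P.part i :=
  P.mem_part (Finset.mem_sdiff.2 ⟨hi, hiM⟩)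

lemma isBlockForm_singleton {a : ι} {P : Finpartition (S \ {a})} {w : Finset ι → ℝ → ℝ}
    (hw : ∀ I ∈ P.parts, ContDiffOn ℝ ∞ (w I) (J a))
    (hdep : ∀ I ∈ P.parts, DependsOnlyOn J I (h I))
    (hg : ∀ x ∈ box J, ∀ I ∈ P.parts, ∀ i ∈ I, g i x = w I (x a) * h I i x) :
    IsBlockForm J S {a} P h g fun I _ => w I where
  contDiffOn I hI b hb := by simpa only [Finset.mem_singleton.1 hb] using hw I hI
  dependsOnlyOn := hdep
  eq_mul x hx I hI i hi := by rw [Finset.prod_singleton, hg x hx I hI i hi]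

lemma IsConcircularForm.isBlockForm (hg : IsConcircularForm J S M P h g) :
    ∃ w, IsBlockForm J S M P h g w := by
  obtain ⟨-, Φ, σ, e, hs, hdep, -, hgP⟩ := hg
  exact ⟨fun I a t => e I - σ a t, fun I _ a ha => contDiffOn_const.sub (hs a ha).2.1, hdep, hgP⟩

lemma IsExceptional.isBlockForm {a : ι} {P : Finpartition (S \ {a})}
    (hg : IsExceptional J S a P h g) : ∃ w, IsBlockForm J S {a} P h g w := by
  obtain ⟨-, -, Φ, σ, -, hs, -, hgP⟩ := hg
  exact ⟨_, isBlockForm_singleton (fun I hI => (hs I hI).1) (fun I hI => (hs I hI).2.2) hgP⟩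

variable [Fintype ι]

lemma IsBlockForm.weight_ne_zero (hB : IsBlockForm J S M P h g w) (hg : IsOrthMetricOn J S g)
    (hI : I ∈ P.parts) (hx : x ∈ box J) : ∏ a ∈ M, w I a (x a) ≠ 0 := by
  obtain ⟨i, hi⟩ := P.nonempty_of_mem_parts hI
  have hgi := (hg i (mem_of_mem_parts hI hi)).2 x hx
  rw [hB.eq_mul x hx I hI i hi] at hgi
  exact left_ne_zero_of_mul hgi

lemma IsBlockForm.contDiffOn_weight (hB : IsBlockForm J S M P h g w) (hI : I ∈ P.parts) :
    ContDiffOn ℝ ∞ (fun x : ι → ℝ => ∏ a ∈ M, w I a (x a)) (box J) :=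
  contDiffOn_prod fun a ha => contDiffOn_comp_eval (hB.contDiffOn I hI a ha)

lemma IsBlockForm.isOrthMetricOn (hB : IsBlockForm J S M P h g w) (hg : IsOrthMetricOn J S g)
    (hI : I ∈ P.parts) : IsOrthMetricOn J I (h I) := by
  intro i hi
  have hgi := hg i (mem_of_mem_parts hI hi)
  have hw {x : ι → ℝ} (hx : x ∈ box J) := hB.weight_ne_zero hg hI hx
  refine ⟨(hgi.1.div (hB.contDiffOn_weight hI) fun x hx => hw hx).congr fun x hx => ?_,
    fun x hx => ?_⟩
  · rw [Pi.div_apply, hB.eq_mul x hx I hI i hi, mul_div_cancel_left₀ _ (hw hx)]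
  · have hgix := hgi.2 x hx
    rw [hB.eq_mul x hx I hI i hi] at hgix
    exact right_ne_zero_of_mul hgix

end BlockForm

section BlockStaeckel

variable {ι : Type*} [DecidableEq ι] {J : ι → Set ℝ} {S M : Finset ι} {P : Finpartition (S \ M)}
  {h : Finset ι → ι → (ι → ℝ) → ℝ} {g : ι → (ι → ℝ) → ℝ} {w v : Finset ι → ι → ℝ → ℝ}
  {u₀ : ι → ι → ℝ → ℝ} {u : Finset ι → ι → ι → ℝ → ℝ} {E₀ : ι → ℝ} {E : Finset ι → ι → ℝ}
  {κ : Finset ι → ℝ} {x x₀ : ι → ℝ} {I : Finset ι} {i j : ι}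

/-- The Stäckel functions of a metric in block form, put together from Stäckel functions `u₀` of the
part in `M` and `u I` of the blocks `I`. Their only further entries are the multiples of `v I a`, in
the rows `a ∈ M` and the columns of the block `I`; these compensate for the weights of the
blocks. -/
def blockStaeckel (M : Finset ι) (P : Finpartition (S \ M)) (u₀ : ι → ι → ℝ → ℝ)
    (u : Finset ι → ι → ι → ℝ → ℝ) (E : Finset ι → ι → ℝ) (v : Finset ι → ι → ℝ → ℝ)
    (j i : ι) (t : ℝ) : ℝ :=
  if j ∈ M then if i ∈ M then u₀ j i t else 0
  else if i ∈ M then E (P.part j) j * v (P.part j) i t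
  else if i ∈ P.part j then u (P.part j) j i t else 0

lemma contDiffOn_blockStaeckel (hM : IsStaeckelSystem J M g x₀ u₀ E₀)
    (hP : ∀ I ∈ P.parts, IsStaeckelSystem J I (h I) x₀ (u I) (E I))
    (hv : ∀ I ∈ P.parts, ∀ a ∈ M, ContDiffOn ℝ ∞ (v I a) (J a)) (hj : j ∈ S) (i : ι) :
    ContDiffOn ℝ ∞ (blockStaeckel M P u₀ u E v j i) (J i) := by
  unfold blockStaeckel
  by_cases hjM : j ∈ M
  · simp only [if_pos hjM]
    split_ifs with hiM
    exacts [hM.contDiffOn j hjM i hiM, contDiffOn_const]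
  · have hI := part_mem_parts (P := P) hj hjM
    simp only [if_neg hjM]
    split_ifs with hiM hiI
    exacts [contDiffOn_const.mul (hv _ hI i hiM),
      (hP _ hI).contDiffOn j (mem_part hj hjM) i hiI, contDiffOn_const]

lemma sum_inv_mul_blockStaeckel_of_mem (hMS : M ⊆ S) (hjM : j ∈ M) (x : ι → ℝ) :
    ∑ i ∈ S, (g i x)⁻¹ * blockStaeckel M P u₀ u E v j i (x i) =
      ∑ i ∈ M, (g i x)⁻¹ * u₀ j i (x i) := by
  refine (Finset.sum_subset_zero_on_sdiff hMS (fun i hi => ?_) fun i hi => ?_).symm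
  · simp [blockStaeckel, hjM, (Finset.mem_sdiff.1 hi).2]
  · simp [blockStaeckel, hjM, hi]

lemma IsBlockForm.sum_inv_mul_blockStaeckel_of_notMem (hB : IsBlockForm J S M P h g w)
    (hMS : M ⊆ S) (hj : j ∈ S) (hjM : j ∉ M) (hx : x ∈ box J) :
    ∑ i ∈ S, (g i x)⁻¹ * blockStaeckel M P u₀ u E v j i (x i) =
      E (P.part j) j * ∑ a ∈ M, (g a x)⁻¹ * v (P.part j) a (x a) +
        (∏ a ∈ M, w (P.part j) a (x a))⁻¹ *
          ∑ i ∈ P.part j, (h (P.part j) i x)⁻¹ * u (P.part j) j i (x i) := by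
  have hI : P.part j ∈ P.parts := part_mem_parts hj hjM
  rw [← Finset.sum_sdiff hMS, add_comm, Finset.mul_sum, Finset.mul_sum]
  congr 1
  · refine Finset.sum_congr rfl fun a ha => ?_
    simp only [blockStaeckel, if_neg hjM, if_pos ha]
    ring
  · refine (Finset.sum_subset_zero_on_sdiff (P.le hI) (fun i hi => ?_) fun i hi => ?_).symm
    · simp [blockStaeckel, hjM, (Finset.mem_sdiff.1 (Finset.mem_sdiff.1 hi).1).2,
        (Finset.mem_sdiff.1 hi).2]
    · simp only [blockStaeckel, if_neg hjM, if_neg (notMem_of_mem_parts hI hi), if_pos hi]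
      rw [hB.eq_mul x hx _ hI i hi, mul_inv]
      ring

lemma sum_mul_blockStaeckel_of_mem_parts (hI : I ∈ P.parts) (hi : i ∈ I) (c : ι → ℝ) (t : ℝ) :
    ∑ j ∈ S, c j * blockStaeckel M P u₀ u E v j i t = ∑ j ∈ I, c j * u I j i t := by
  have hiM : i ∉ M := notMem_of_mem_parts hI hi
  refine (Finset.sum_subset_zero_on_sdiff (fun j hj => mem_of_mem_parts hI hj)
    (fun j hj => ?_) fun j hj => ?_).symm
  · obtain ⟨hjS, hjI⟩ := Finset.mem_sdiff.1 hj
    by_cases hjM : j ∈ M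
    · simp [blockStaeckel, hjM, hiM]
    have hij : i ∉ P.part j := fun hij => hjI <| by
      rw [P.eq_of_mem_parts hI (part_mem_parts hjS hjM) hi hij]
      exact mem_part hjS hjM
    simp [blockStaeckel, hjM, hiM, hij]
  · simp [blockStaeckel, P.part_eq_of_mem hI hj, notMem_of_mem_parts hI hj, hiM, hi]

lemma sum_mul_blockStaeckel_of_mem (hMS : M ⊆ S) (hi : i ∈ M) {c : ι → ℝ}
    (hc : ∀ j ∈ S, j ∉ M → c j = 0) (t : ℝ) :
    ∑ j ∈ S, c j * blockStaeckel M P u₀ u E v j i t = ∑ j ∈ M, c j * u₀ j i t := by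
  refine (Finset.sum_subset_zero_on_sdiff hMS (fun j hj => ?_) fun j hj => ?_).symm
  · rw [hc j (Finset.mem_sdiff.1 hj).1 (Finset.mem_sdiff.1 hj).2, zero_mul]
  · simp [blockStaeckel, hj, hi]

theorem IsBlockForm.isStaeckelSystem (hB : IsBlockForm J S M P h g w) (hMS : M ⊆ S)
    (hM : IsStaeckelSystem J M g x₀ u₀ E₀)
    (hP : ∀ I ∈ P.parts, IsStaeckelSystem J I (h I) x₀ (u I) (E I))
    (hv : ∀ I ∈ P.parts, ∀ a ∈ M, ContDiffOn ℝ ∞ (v I a) (J a))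
    (hκ : ∀ I ∈ P.parts, ∀ x ∈ box J,
      ∑ a ∈ M, (g a x)⁻¹ * v I a (x a) + (∏ a ∈ M, w I a (x a))⁻¹ = κ I) :
    IsStaeckelSystem J S g x₀ (blockStaeckel M P u₀ u E v)
      fun j => if j ∈ M then E₀ j else E (P.part j) j * κ (P.part j) where
  contDiffOn j hj i _ := contDiffOn_blockStaeckel hM hP hv hj i
  sum_inv_mul j hj x hx := by
    split_ifs with hjM
    · rw [sum_inv_mul_blockStaeckel_of_mem hMS hjM, hM.sum_inv_mul j hjM x hx]
    · have hI : P.part j ∈ P.parts := part_mem_parts hj hjM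
      rw [hB.sum_inv_mul_blockStaeckel_of_notMem hMS hj hjM hx,
        (hP _ hI).sum_inv_mul j (mem_part hj hjM) x hx, ← hκ _ hI x hx]
      ring
  nondegenerate c hc := by
    have hc_notMem (j : ι) (hj : j ∈ S) (hjM : j ∉ M) : c j = 0 := by
      have hI : P.part j ∈ P.parts := part_mem_parts hj hjM
      refine (hP _ hI).nondegenerate c (fun i hi => ?_) j (mem_part hj hjM)
      rw [← sum_mul_blockStaeckel_of_mem_parts hI hi, hc i (mem_of_mem_parts hI hi)]
    intro j hj
    by_cases hjM : j ∈ M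
    · refine hM.nondegenerate c (fun i hi => ?_) j hjM
      rw [← sum_mul_blockStaeckel_of_mem hMS hi hc_notMem, hc i (hMS hi)]
    · exact hc_notMem j hj hjM

theorem IsBlockForm.hasStaeckelSystem (hB : IsBlockForm J S M P h g w) (hMS : M ⊆ S)
    (hM : HasStaeckelSystem J M g x₀) (hP : ∀ I ∈ P.parts, HasStaeckelSystem J I (h I) x₀)
    (hv : ∀ I ∈ P.parts, ∀ a ∈ M, ContDiffOn ℝ ∞ (v I a) (J a))
    (hκ : ∀ I ∈ P.parts, ∀ x ∈ box J,
      ∑ a ∈ M, (g a x)⁻¹ * v I a (x a) + (∏ a ∈ M, w I a (x a))⁻¹ = κ I) :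
    HasStaeckelSystem J S g x₀ := by
  obtain ⟨u₀, E₀, hM⟩ := hM
  have hP : ∀ I ∈ P.parts, ∃ u E, IsStaeckelSystem J I (h I) x₀ u E := hP
  choose! u E hP using hP
  exact ⟨_, _, hB.isStaeckelSystem hMS hM hP hv hκ⟩

end BlockStaeckel

section Vandermonde

variable {ι : Type*} {J : ι → Set ℝ} {M : Finset ι} {g : ι → (ι → ℝ) → ℝ}
  {Φ σ : ι → ℝ → ℝ} {x₀ : ι → ℝ}

lemma hasStaeckelSystem_singleton {a : ι} {Φ : ℝ → ℝ} (hΦ : ContDiffOn ℝ ∞ Φ (J a))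
    (hg : ∀ x ∈ box J, g a x = Φ (x a)) (h0 : ∀ x ∈ box J, g a x ≠ 0) (hx₀ : x₀ ∈ box J) :
    HasStaeckelSystem J {a} g x₀ := by
  refine ⟨fun _ _ => Φ, fun _ => 1, ?_, ?_, ?_⟩
  · simpa using hΦ
  · simpa [← hg _ _] using fun x hx => by rw [← hg x hx, inv_mul_cancel₀ (h0 x hx)]
  · simpa [← hg x₀ hx₀] using fun c hc => hc.resolve_right (h0 x₀ hx₀)

variable [DecidableEq ι]

lemma injOn_of_mul_prod_sub_ne_zero {K : Type*} [CommRing K] [IsDomain K] {φ s : ι → K}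
    (h0 : ∀ a ∈ M, φ a * ∏ b ∈ M.erase a, (s a - s b) ≠ 0) : Set.InjOn s M := by
  intro a ha b hb hab
  by_contra hne
  exact Finset.prod_ne_zero_iff.1 (right_ne_zero_of_mul (h0 a ha)) b
    (Finset.mem_erase.2 ⟨Ne.symm hne, hb⟩) (sub_eq_zero.2 hab)

/-- Row `a` of the Stäckel matrix lists `Φₐ` times the values at `σₐ` of the polynomials
`∏_{c ≠ b} (X - σ_c(x₀))`, so that the Stäckel matrix is diagonal at `x₀`; the Stäckel equations are
Lagrange's formula for the leading coefficient of the interpolating polynomial. -/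
theorem hasStaeckelSystem_vandermonde
    (hΦ : ∀ a ∈ M, ContDiffOn ℝ ∞ (Φ a) (J a)) (hσ : ∀ a ∈ M, ContDiffOn ℝ ∞ (σ a) (J a))
    (hg : ∀ x ∈ box J, ∀ a ∈ M, g a x = Φ a (x a) * ∏ b ∈ M.erase a, (σ a (x a) - σ b (x b)))
    (h0 : ∀ a ∈ M, ∀ x ∈ box J, g a x ≠ 0) (hx₀ : x₀ ∈ box J) : HasStaeckelSystem J M g x₀ := by
  refine ⟨fun b a t => Φ a t * ∏ c ∈ M.erase b, (σ a t - σ c (x₀ c)),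
    fun b => (Lagrange.nodal (M.erase b) fun c => σ c (x₀ c)).coeff (M.card - 1),
    fun b _ a ha => ?_, fun b hb x hx => ?_, fun c hc a ha => ?_⟩
  · exact (hΦ a ha).mul (contDiffOn_prod fun c _ => (hσ a ha).sub contDiffOn_const)
  · have hne (a : ι) (ha : a ∈ M) : Φ a (x a) * ∏ b ∈ M.erase a, (σ a (x a) - σ b (x b)) ≠ 0 :=
      hg x hx a ha ▸ h0 a ha x hx
    rw [Lagrange.coeff_eq_sum (injOn_of_mul_prod_sub_ne_zero hne)
      (by rw [Lagrange.degree_nodal]; exact_mod_cast Finset.card_erase_lt_of_mem hb)]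
    refine Finset.sum_congr rfl fun a ha => ?_
    rw [hg x hx a ha, Lagrange.eval_nodal]
    have := left_ne_zero_of_mul (hne a ha)
    have := right_ne_zero_of_mul (hne a ha)
    field_simp
  · have hca := hc a ha
    rw [Finset.sum_eq_single_of_mem a ha fun b _ hba => by
      rw [Finset.prod_eq_zero (Finset.mem_erase.2 ⟨hba.symm, ha⟩) (sub_self _), mul_zero,
        mul_zero], ← hg x₀ hx₀ a ha] at hca
    exact (mul_eq_zero.1 hca).resolve_right (h0 a ha x₀ hx₀)

lemma sum_inv_prod_sub_mul_inv_sub {K : Type*} [Field K] {s : ι → K} (hs : Set.InjOn s M)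
    (hM : M.Nonempty) {e : K} (he : ∀ a ∈ M, e ≠ s a) :
    ∑ a ∈ M, (∏ b ∈ M.erase a, (s a - s b))⁻¹ * (e - s a)⁻¹ = (∏ a ∈ M, (e - s a))⁻¹ := by
  have hinterp := Lagrange.eval_interpolate_not_at_node (r := (1 : ι → K)) he
  rw [Lagrange.interpolate_one hs hM, Polynomial.eval_one, Lagrange.eval_nodal] at hinterp
  rw [← eq_inv_of_mul_eq_one_right hinterp.symm]
  simp [Lagrange.nodalWeight]

lemma sum_inv_vandermonde_mul {K : Type*} [Field K] {φ s : ι → K} (hM : M.Nonempty)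
    (h0 : ∀ a ∈ M, φ a * ∏ b ∈ M.erase a, (s a - s b) ≠ 0) {e : K}
    (he : ∏ a ∈ M, (e - s a) ≠ 0) :
    ∑ a ∈ M, (φ a * ∏ b ∈ M.erase a, (s a - s b))⁻¹ * (φ a / (e - s a)) =
      (∏ a ∈ M, (e - s a))⁻¹ := by
  have he' (a : ι) (ha : a ∈ M) : e - s a ≠ 0 := Finset.prod_ne_zero_iff.1 he a ha
  rw [← sum_inv_prod_sub_mul_inv_sub (injOn_of_mul_prod_sub_ne_zero h0) hM fun a ha =>
    sub_ne_zero.1 (he' a ha)]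
  refine Finset.sum_congr rfl fun a ha => ?_
  have := left_ne_zero_of_mul (h0 a ha)
  field_simp

end Vandermonde

section Classified

variable {ι : Type*} [Fintype ι] [DecidableEq ι] {J : ι → Set ℝ} {S M : Finset ι}
  {h : Finset ι → ι → (ι → ℝ) → ℝ} {g : ι → (ι → ℝ) → ℝ} {x₀ : ι → ℝ}

theorem IsConcircularForm.hasStaeckelSystem {P : Finpartition (S \ M)}
    (hcon : IsConcircularForm J S M P h g) (hg : IsOrthMetricOn J S g) (hx₀ : x₀ ∈ box J)
    (hP : ∀ I ∈ P.parts, HasStaeckelSystem J I (h I) x₀) : HasStaeckelSystem J S g x₀ := by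
  obtain ⟨hMS, Φ, σ, e, hs, hdep, hgM, hgP⟩ := hcon
  have hB : IsBlockForm J S M P h g fun I a t => e I - σ a t :=
    ⟨fun I _ a ha => contDiffOn_const.sub (hs a ha).2.1, hdep, hgP⟩
  have h0 (a : ι) (ha : a ∈ M) : ∀ x ∈ box J, g a x ≠ 0 := (hg a (hMS ha)).2
  refine hB.hasStaeckelSystem hMS (hasStaeckelSystem_vandermonde (fun a ha => (hs a ha).1)
    (fun a ha => (hs a ha).2.1) hgM h0 hx₀) hP (v := fun I a t => -(Φ a t / (e I - σ a t)))
    (κ := fun _ => if M.Nonempty then 0 else 1) (fun I hI a ha => ?_) fun I hI x hx => ?_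
  · refine ((hs a ha).1.div (contDiffOn_const.sub (hs a ha).2.1) fun t ht => ?_).neg
    simpa using Finset.prod_ne_zero_iff.1
      (hB.weight_ne_zero hg hI (update_mem_box hx₀ (i := a) ht)) a ha
  · split_ifs with hM
    · rw [← sum_inv_vandermonde_mul hM (fun a ha => hgM x hx a ha ▸ h0 a ha x hx)
        (hB.weight_ne_zero hg hI hx), ← Finset.sum_add_distrib]
      exact Finset.sum_eq_zero fun a ha => by rw [hgM x hx a ha]; ring
    · simp [Finset.not_nonempty_iff_eq_empty.1 hM]

theorem IsExceptional.hasStaeckelSystem {a : ι} {P : Finpartition (S \ {a})}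
    (hexc : IsExceptional J S a P h g) (hg : IsOrthMetricOn J S g) (hx₀ : x₀ ∈ box J)
    (hP : ∀ I ∈ P.parts, HasStaeckelSystem J I (h I) x₀) : HasStaeckelSystem J S g x₀ := by
  obtain ⟨ha, -, Φ, σ, hΦ, hs, hga, hgP⟩ := hexc
  have hB := isBlockForm_singleton (fun I hI => (hs I hI).1) (fun I hI => (hs I hI).2.2) hgP
  have hσ (I : Finset ι) (hI : I ∈ P.parts) (x : ι → ℝ) (hx : x ∈ box J) : σ I (x a) ≠ 0 := by
    simpa using hB.weight_ne_zero hg hI hx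
  refine hB.hasStaeckelSystem (Finset.singleton_subset_iff.2 ha)
    (hasStaeckelSystem_singleton hΦ hga (hg a ha).2 hx₀) hP (v := fun I _ t => -(Φ t / σ I t))
    (κ := fun _ => 0) (fun I hI b hb => ?_) fun I hI x hx => ?_
  · obtain rfl := Finset.mem_singleton.1 hb
    refine (hΦ.div (hs I hI).1 fun t ht => ?_).neg
    simpa using hσ I hI _ (update_mem_box hx₀ (i := b) ht)
  · have hσx := hσ I hI x hx
    have hΦx := hga x hx ▸ (hg a ha).2 x hx
    rw [Finset.sum_singleton, Finset.prod_singleton, hga x hx]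
    field_simp
    ring

theorem IsClassified.hasStaeckelSystem (hcl : IsClassified J S g) (hg : IsOrthMetricOn J S g)
    (hx₀ : x₀ ∈ box J) : HasStaeckelSystem J S g x₀ := by
  induction hcl with
  | irreducible hirr =>
    obtain ⟨P, h, hirr⟩ := hirr
    refine hirr.hasStaeckelSystem hg hx₀ fun I hI => ?_
    obtain ⟨i, hi⟩ := P.nonempty_of_mem_parts hI
    exact absurd (mem_of_mem_parts hI hi) (notMem_of_mem_parts hI hi)
  | product P h hprod _ ih =>
    obtain ⟨w, hB⟩ := hprod.2.isBlockForm
    exact hprod.2.hasStaeckelSystem hg hx₀ fun I hI => ih I hI (hB.isOrthMetricOn hg hI)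
  | warped M P h hwarp _ ih =>
    obtain ⟨w, hB⟩ := hwarp.2.2.isBlockForm
    exact hwarp.2.2.hasStaeckelSystem hg hx₀ fun I hI => ih I hI (hB.isOrthMetricOn hg hI)
  | exceptional a P h hexc _ ih =>
    obtain ⟨w, hB⟩ := hexc.isBlockForm
    exact hexc.hasStaeckelSystem hg hx₀ fun I hI => ih I hI (hB.isOrthMetricOn hg hI)

end Classified

section PairFactors

variable {ι : Type*} {J : ι → Set ℝ} {S M : Finset ι} {h : Finset ι → ι → (ι → ℝ) → ℝ}
  {g : ι → (ι → ℝ) → ℝ} {w : Finset ι → ι → ℝ → ℝ}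

/-- Each `gᵢ` with `i ∈ S` is a product of functions of `xᵢ` and one further coordinate. Together
with the Levi-Civita equations this forces diagonal curvature. -/
def HasPairFactors (J : ι → Set ℝ) (S : Finset ι) (g : ι → (ι → ℝ) → ℝ) : Prop :=
  ∃ F : ι → ι → ℝ → ℝ → ℝ, ∀ i ∈ S, ∀ x ∈ box J, g i x = ∏ j ∈ S, F i j (x i) (x j)

lemma hasPairFactors_singleton {a : ι} {Φ : ℝ → ℝ} (hg : ∀ x ∈ box J, g a x = Φ (x a)) :
    HasPairFactors J {a} g :=
  ⟨fun _ _ s _ => Φ s, by simpa using hg⟩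

variable [DecidableEq ι]

lemma hasPairFactors_vandermonde {Φ σ : ι → ℝ → ℝ}
    (hg : ∀ x ∈ box J, ∀ a ∈ M, g a x = Φ a (x a) * ∏ b ∈ M.erase a, (σ a (x a) - σ b (x b))) :
    HasPairFactors J M g := by
  refine ⟨fun i j s t => if i = j then Φ i s else σ i s - σ j t, fun i hi x hx => ?_⟩
  rw [hg x hx i hi, ← Finset.mul_prod_erase M _ hi]
  congr 1
  · exact (if_pos rfl).symm
  · exact Finset.prod_congr rfl fun j hj => (if_neg (Finset.ne_of_mem_erase hj).symm).symm

theorem IsBlockForm.hasPairFactors {P : Finpartition (S \ M)} (hB : IsBlockForm J S M P h g w)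
    (hMS : M ⊆ S) (hM : HasPairFactors J M g) (hP : ∀ I ∈ P.parts, HasPairFactors J I (h I)) :
    HasPairFactors J S g := by
  obtain ⟨F₀, hF₀⟩ := hM
  have hP : ∀ I ∈ P.parts, ∃ F : ι → ι → ℝ → ℝ → ℝ,
      ∀ i ∈ I, ∀ x ∈ box J, h I i x = ∏ j ∈ I, F i j (x i) (x j) := hP
  choose! F hF using hP
  refine ⟨fun i j s t => if i ∈ M then if j ∈ M then F₀ i j s t else 1
    else if j ∈ M then w (P.part i) j t else if j ∈ P.part i then F (P.part i) i j s t else 1,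
    fun i hi x hx => ?_⟩
  by_cases hiM : i ∈ M
  · simp only [if_pos hiM, hF₀ i hiM x hx]
    exact Finset.prod_subset_one_on_sdiff hMS (fun k hk => if_neg (Finset.mem_sdiff.1 hk).2)
      fun k hk => (if_pos hk).symm
  · have hI : P.part i ∈ P.parts := part_mem_parts hi hiM
    simp only [if_neg hiM]
    rw [hB.eq_mul x hx _ hI i (mem_part hi hiM), hF _ hI i (mem_part hi hiM) x hx,
      ← Finset.prod_sdiff hMS, mul_comm]
    congr 1
    · refine Finset.prod_subset_one_on_sdiff (P.le hI) (fun k hk => ?_) fun k hk => ?_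
      · rw [if_neg (Finset.mem_sdiff.1 (Finset.mem_sdiff.1 hk).1).2,
          if_neg (Finset.mem_sdiff.1 hk).2]
      · rw [if_neg (notMem_of_mem_parts hI hk), if_pos hk]
    · exact Finset.prod_congr rfl fun k hk => (if_pos hk).symm

lemma IsConcircularForm.hasPairFactors {P : Finpartition (S \ M)}
    (hcon : IsConcircularForm J S M P h g) (hP : ∀ I ∈ P.parts, HasPairFactors J I (h I)) :
    HasPairFactors J S g := by
  obtain ⟨w, hB⟩ := hcon.isBlockForm
  obtain ⟨hMS, Φ, σ, e, -, -, hgM, -⟩ := hcon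
  exact hB.hasPairFactors hMS (hasPairFactors_vandermonde hgM) hP

theorem IsClassified.hasPairFactors (hcl : IsClassified J S g) : HasPairFactors J S g := by
  induction hcl with
  | irreducible hirr =>
    obtain ⟨P, h, -, Φ, σ, e, -, -, hg, -⟩ := hirr
    exact hasPairFactors_vandermonde hg
  | product P h hprod _ ih => exact hprod.2.hasPairFactors ih
  | warped M P h hwarp _ ih => exact hwarp.2.2.hasPairFactors ih
  | exceptional a P h hexc _ ih =>
    obtain ⟨w, hB⟩ := hexc.isBlockForm
    obtain ⟨ha, -, Φ, σ, -, -, hga, -⟩ := hexc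
    exact hB.hasPairFactors (Finset.singleton_subset_iff.2 ha) (hasPairFactors_singleton hga) ih

end PairFactors

/-! ### The differential system of separable metrics with diagonal curvature -/

section System

variable {ι : Type*} [Fintype ι] [DecidableEq ι] {U : Set (ι → ℝ)} {J : ι → Set ℝ}
  {S I : Finset ι} {g h : ι → (ι → ℝ) → ℝ} {x y : ι → ℝ} {i k : ι}

/-- The differential system satisfied by separable metrics with diagonal curvature: the Levi-Civita
equations and the vanishing of `Rᵢⱼᵢₖ`, in terms of the logarithmic derivatives `∂ⱼ log |gᵢ|`.
Unlike separability and curvature it makes sense for a tensor `∑_{i ∈ S} gᵢ dxᵢ²` in some of the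
coordinates. -/
structure SepDiagSystem (J : ι → Set ℝ) (S : Finset ι) (g : ι → (ι → ℝ) → ℝ) : Prop where
  isOrthMetricOn : IsOrthMetricOn J S g
  dependsOnlyOn : DependsOnlyOn J S g
  pd_logpd : ∀ i ∈ S, ∀ j ∈ S, i ≠ j → ∀ x ∈ box J,
    pd i (logpd g i j) x = -(logpd g i j x * logpd g j i x)
  dependsOnCoords_logpd : ∀ i ∈ S, ∀ j ∈ S, i ≠ j → DependsOnCoords J {i, j} (logpd g i j)
  logpd_mul_logpd : ∀ i ∈ S, ∀ j ∈ S, ∀ k ∈ S, i ≠ j → i ≠ k → j ≠ k → ∀ x ∈ box J,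
    logpd g i j x * logpd g i k x = logpd g i j x * logpd g j k x + logpd g i k x * logpd g k j x

theorem sepDiagSystem_of_isOrthSepDiag (hJ : ∀ i, IsOpenInterval (J i))
    (hg : IsOrthSepDiag (box J) g) : SepDiagSystem J Finset.univ g := by
  obtain ⟨hg, hsep, hcurv⟩ := hg
  have hU := isOpen_box hJ
  have hLC {x : ι → ℝ} (hx : x ∈ box J) (i : ι) {j k : ι} (hjk : j ≠ k) :=
    (hasLocalStaeckelSystem_of_isSeparable hg hsep hx).pd_logpd hg i hjk
  rw [hasDiagonalCurvature_iff_pd_logpd hU hg] at hcurv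
  refine ⟨fun i _ => hg i, fun i _ x _ y _ hxy => ?_, fun i _ j _ hij x hx => ?_,
    fun i _ j _ hij => ?_, fun i _ j _ k _ hij hik hjk x hx => ?_⟩
  · rw [show x = y from funext fun j => hxy j (Finset.mem_univ j)]
  · rw [hLC hx i hij.symm]
    ring
  · refine dependsOnCoords_of_pd_eq_zero hJ ((contDiffOn_logpd hU (hg i).1 (hg i).2
      j).differentiableOn (by simp)) fun k hk z hz => ?_
    simp only [Finset.mem_insert, Finset.mem_singleton, not_or] at hk
    linarith [hLC hz i (Ne.symm hk.2), hcurv z hz i j k hij (Ne.symm hk.1) (Ne.symm hk.2)]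
  · linarith [hLC hx i hjk, hcurv x hx i j k hij hik hjk]

lemma logpd_eq_of_eq_mul (hJ : ∀ i, IsOpenInterval (J i)) (hh : ContDiffOn ℝ ∞ (h i) (box J))
    {w : (ι → ℝ) → ℝ} (hw : ContDiffOn ℝ ∞ w (box J)) (hw0 : ∀ x ∈ box J, w x ≠ 0)
    {T : Finset ι} (hwT : DependsOnCoords J T w) (hk : k ∉ T)
    (hgh : ∀ x ∈ box J, g i x = w x * h i x) (hx : x ∈ box J) :
    logpd g i k x = logpd h i k x := by
  have hU := isOpen_box hJ
  rw [logpd, logpd, pd_congr_of_eqOn hU hx hgh,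
    pd_mul k (differentiableAt_of_contDiffOn hU hw hx) (differentiableAt_of_contDiffOn hU hh hx),
    hwT.pd_eq_zero hJ (differentiableAt_of_contDiffOn hU hw hx) hk hx, hgh x hx, zero_mul, zero_add,
    mul_div_mul_left _ _ (hw0 x hx)]

theorem SepDiagSystem.of_eq_mul (hJ : ∀ i, IsOpenInterval (J i)) (hg : SepDiagSystem J S g)
    {T : Finset ι} (hIS : I ⊆ S) (hIT : Disjoint I T) (hh : IsOrthMetricOn J I h)
    (hdep : DependsOnlyOn J I h) {w : (ι → ℝ) → ℝ} (hw : ContDiffOn ℝ ∞ w (box J))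
    (hw0 : ∀ x ∈ box J, w x ≠ 0) (hwT : DependsOnCoords J T w)
    (hgh : ∀ i ∈ I, ∀ x ∈ box J, g i x = w x * h i x) : SepDiagSystem J I h := by
  have hU := isOpen_box hJ
  have logpd_eq {i k : ι} (hi : i ∈ I) (hk : k ∈ I) (x : ι → ℝ) (hx : x ∈ box J) :
      logpd h i k x = logpd g i k x :=
    (logpd_eq_of_eq_mul hJ (hh i hi).1 hw hw0 hwT (Finset.disjoint_left.1 hIT hk) (hgh i hi)
      hx).symm
  refine ⟨hh, hdep, fun i hi j hj hij x hx => ?_, fun i hi j hj hij x hx y hy hxy => ?_,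
    fun i hi j hj k hk hij hik hjk x hx => ?_⟩
  · rw [pd_congr_of_eqOn hU hx (logpd_eq hi hj), logpd_eq hi hj x hx, logpd_eq hj hi x hx]
    exact hg.pd_logpd i (hIS hi) j (hIS hj) hij x hx
  · rw [logpd_eq hi hj x hx, logpd_eq hi hj y hy]
    exact hg.dependsOnCoords_logpd i (hIS hi) j (hIS hj) hij x hx y hy hxy
  · rw [logpd_eq hi hj x hx, logpd_eq hi hk x hx, logpd_eq hj hk x hx, logpd_eq hk hj x hx]
    exact hg.logpd_mul_logpd i (hIS hi) j (hIS hj) k (hIS hk) hij hik hjk x hx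

theorem IsBlockForm.sepDiagSystem {M : Finset ι} {P : Finpartition (S \ M)}
    {h : Finset ι → ι → (ι → ℝ) → ℝ} {w : Finset ι → ι → ℝ → ℝ}
    (hB : IsBlockForm J S M P h g w) (hJ : ∀ i, IsOpenInterval (J i)) (hg : SepDiagSystem J S g)
    (hI : I ∈ P.parts) : SepDiagSystem J I (h I) :=
  hg.of_eq_mul hJ (fun _ hi => mem_of_mem_parts hI hi)
    (Finset.disjoint_left.2 fun _ hi => notMem_of_mem_parts hI hi)
    (hB.isOrthMetricOn hg.isOrthMetricOn hI) (hB.dependsOnlyOn I hI) (hB.contDiffOn_weight hI)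
    (fun _ hx => hB.weight_ne_zero hg.isOrthMetricOn hI hx) (dependsOnCoords_prod_comp_eval (w I))
    fun i hi x hx => hB.eq_mul x hx I hI i hi

end System

section Synthesis

variable {ι : Type*} [Fintype ι] [DecidableEq ι] {U : Set (ι → ℝ)} {J : ι → Set ℝ}
  {S : Finset ι} {g : ι → (ι → ℝ) → ℝ} {x y : ι → ℝ} {i k : ι}

lemma logpd_eq_of_comp_update_eq_mul {s : Set ℝ} (hs : s ∈ 𝓝 (x k))
    (hx : DifferentiableAt ℝ (g i) x) (hy : DifferentiableAt ℝ (g i) y) (hxy : x k = y k)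
    {r : ℝ} (hr : r ≠ 0) (hg : ∀ t ∈ s, g i (update x k t) = r * g i (update y k t)) :
    logpd g i k x = logpd g i k y := by
  have hdy := (hasDerivAt_comp_update k hy).const_mul r
  rw [← hxy] at hdy
  have hpd : pd k (g i) x = r * pd k (g i) y :=
    (hasDerivAt_comp_update k hx).unique (hdy.congr_of_eventuallyEq (eventually_of_mem hs hg))
  have hval := hg (x k) (mem_of_mem_nhds hs)
  rw [update_eq_self, hxy, update_eq_self] at hval
  rw [logpd, logpd, hpd, hval, mul_div_mul_left _ _ hr]

lemma HasPairFactors.dependsOnCoords_logpd (hF : HasPairFactors J S g)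
    (hJ : ∀ i, IsOpenInterval (J i)) (hg : IsOrthMetricOn J S g) (hi : i ∈ S) (hk : k ∈ S)
    (hik : i ≠ k) : DependsOnCoords J {i, k} (logpd g i k) := by
  obtain ⟨F, hF⟩ := hF
  intro x hx y hy hxy
  have hxi : x i = y i := hxy i (by simp)
  have hxk : x k = y k := hxy k (by simp)
  set R : (ι → ℝ) → ℝ := fun z => ∏ j ∈ S.erase k, F i j (z i) (z j) with hR
  have hline (z : ι → ℝ) (hz : z ∈ box J) (t : ℝ) (ht : t ∈ J k) :
      g i (update z k t) = F i k (z i) t * R z := by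
    rw [hF i hi _ (update_mem_box hz ht), ← Finset.mul_prod_erase S _ hk, hR, update_self,
      update_of_ne hik]
    congr 1
    exact Finset.prod_congr rfl fun j hj => by rw [update_of_ne (Finset.ne_of_mem_erase hj)]
  have hR0 (z : ι → ℝ) (hz : z ∈ box J) : R z ≠ 0 := by
    have hgz := (hg i hi).2 z hz
    rw [← update_eq_self k z, hline z hz (z k) (mem_box.1 hz k)] at hgz
    exact right_ne_zero_of_mul hgz
  have hd (z : ι → ℝ) (hz : z ∈ box J) : DifferentiableAt ℝ (g i) z :=
    differentiableAt_of_contDiffOn (isOpen_box hJ) (hg i hi).1 hz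
  refine logpd_eq_of_comp_update_eq_mul ((hJ k).1.mem_nhds (mem_box.1 hx k)) (hd x hx) (hd y hy)
    hxk (div_ne_zero (hR0 x hx) (hR0 y hy)) fun t ht => ?_
  rw [hline x hx t ht, hline y hy t ht, hxi]
  have := hR0 y hy
  field_simp

lemma pd_log_abs (hg : DifferentiableAt ℝ (g i) x) (h0 : g i x ≠ 0) (k : ι) :
    pd k (fun y => Real.log |g i y|) x = logpd g i k x := by
  simp only [Real.log_abs, pd]
  rw [fderiv.log hg h0, logpd, pd, smul_apply, smul_eq_mul, div_eq_inv_mul]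

theorem leviCivitaEquations_of_isSeparable (hU : IsOpen U) (hg : IsOrthMetric U g)
    (hsep : IsSeparable U (diagMetric g)) : LeviCivitaEquations U g := by
  have hlog (i j : ι) (x : ι → ℝ) (hx : x ∈ U) :
      pd j (fun x => Real.log |g i x|) x = logpd g i j x :=
    pd_log_abs (differentiableAt_of_contDiffOn hU (hg i).1 hx) ((hg i).2 x hx) j
  refine fun x hx => ⟨fun i j hij => ?_, fun i j k _ _ hjk => ?_⟩
  · have hLC := (hasLocalStaeckelSystem_of_isSeparable hg hsep hx).pd_logpd hg i hij.symm
    rw [pd_congr_of_eqOn hU hx (hlog i j), hlog i j x hx, hlog j i x hx, hLC]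
    ring
  · have hLC := (hasLocalStaeckelSystem_of_isSeparable hg hsep hx).pd_logpd hg i hjk.symm
    rw [pd_congr_of_eqOn hU hx (hlog i k), hlog i k x hx, hlog i j x hx, hlog j k x hx,
      hlog k j x hx, hLC]
    ring

theorem isOrthSepDiag_of_hasStaeckelSystem (hJ : ∀ i, IsOpenInterval (J i))
    (hg : IsOrthMetric (box J) g) (hS : ∀ x₀ ∈ box J, HasStaeckelSystem J Finset.univ g x₀)
    (hF : HasPairFactors J Finset.univ g) : IsOrthSepDiag (box J) g := by
  have hU := isOpen_box hJ
  have hloc (x : ι → ℝ) (hx : x ∈ box J) : HasLocalStaeckelSystem (box J) g x :=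
    ⟨J, hJ, hx, subset_rfl, hS x hx⟩
  refine ⟨hg, isSeparable_of_hasLocalStaeckelSystem (fun x hx i => (hg i).2 x hx) hloc, ?_⟩
  rw [hasDiagonalCurvature_iff_pd_logpd hU hg]
  intro x hx i j k hij hik hjk
  have hpd : pd k (logpd g i j) x = 0 :=
    (hF.dependsOnCoords_logpd hJ (fun i _ => hg i) (Finset.mem_univ i) (Finset.mem_univ j)
      hij).pd_eq_zero hJ
      (differentiableAt_of_contDiffOn hU (contDiffOn_logpd hU (hg i).1 (hg i).2 j) hx)
      (by simp [hik.symm, hjk.symm]) hx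
  linarith [(hloc x hx).pd_logpd hg i hjk]

end Synthesis

section Pullback

variable {ι : Type*} [DecidableEq ι] {J : ι → Set ℝ} {I : Finset ι} {h : ι → (ι → ℝ) → ℝ}
  {x₀ : ι → ℝ} {y : I → ℝ}

/-- The point with coordinates `x_I = y` on the coordinate submanifold through `x₀`; by definition
`pullback I x₀ h i y` is `h i (submanifoldPoint I x₀ y)`. -/
def submanifoldPoint (I : Finset ι) (x₀ : ι → ℝ) (y : I → ℝ) (j : ι) : ℝ :=
  if hj : j ∈ I then y ⟨j, hj⟩ else x₀ j

lemma submanifoldPoint_apply (i : I) : submanifoldPoint I x₀ y i = y i :=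
  dif_pos i.2

lemma submanifoldPoint_mem_box (hx₀ : x₀ ∈ box J) (hy : y ∈ box fun i : I => J i) :
    submanifoldPoint I x₀ y ∈ box J := by
  refine mem_box.2 fun j => ?_
  unfold submanifoldPoint
  split_ifs with hj
  exacts [mem_box.1 hy ⟨j, hj⟩, mem_box.1 hx₀ j]

lemma HasStaeckelSystem.pullback (hx₀ : x₀ ∈ box J) {y₀ : I → ℝ}
    (hS : HasStaeckelSystem J I h (submanifoldPoint I x₀ y₀)) :
    HasStaeckelSystem (fun i : I => J i) Finset.univ (pullback I x₀ h) y₀ := by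
  obtain ⟨u, E, hS⟩ := hS
  refine ⟨fun j i => u j i, fun j => E j, fun j _ i _ => hS.contDiffOn j j.2 i i.2,
    fun j _ y hy => ?_, fun c hc j _ => ?_⟩
  · rw [← hS.sum_inv_mul j j.2 _ (submanifoldPoint_mem_box hx₀ hy), ← Finset.sum_coe_sort I]
    exact Finset.sum_congr rfl fun i _ => by rw [submanifoldPoint_apply]; rfl
  · have hcj := hS.nondegenerate (submanifoldPoint I 0 c) (fun i hi => ?_) j j.2
    · rwa [submanifoldPoint_apply] at hcj
    · rw [← hc ⟨i, hi⟩ (Finset.mem_univ _), ← Finset.sum_coe_sort I]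
      exact Finset.sum_congr rfl fun k _ => by
        rw [submanifoldPoint_apply, submanifoldPoint_apply ⟨i, hi⟩]

lemma HasPairFactors.pullback (hx₀ : x₀ ∈ box J) (hF : HasPairFactors J I h) :
    HasPairFactors (fun i : I => J i) Finset.univ (pullback I x₀ h) := by
  obtain ⟨F, hF⟩ := hF
  refine ⟨fun i j => F i j, fun i _ y hy => ?_⟩
  have hFi := hF i i.2 _ (submanifoldPoint_mem_box hx₀ hy)
  rw [← Finset.prod_coe_sort I] at hFi
  exact hFi.trans (Finset.prod_congr rfl fun j _ => by simp only [submanifoldPoint_apply])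

variable [Fintype ι]

lemma contDiff_submanifoldPoint (I : Finset ι) (x₀ : ι → ℝ) :
    ContDiff ℝ ∞ (submanifoldPoint I x₀) := by
  refine contDiff_pi.2 fun j => ?_
  unfold submanifoldPoint
  split_ifs with hj
  exacts [contDiff_apply ℝ ℝ _, contDiff_const]

lemma IsOrthMetricOn.pullback (hx₀ : x₀ ∈ box J) (hh : IsOrthMetricOn J I h) :
    IsOrthMetric (box fun i : I => J i) (pullback I x₀ h) := fun i =>
  ⟨(hh i i.2).1.comp (contDiff_submanifoldPoint I x₀).contDiffOn fun _ =>
    submanifoldPoint_mem_box hx₀, fun _ hy => (hh i i.2).2 _ (submanifoldPoint_mem_box hx₀ hy)⟩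

theorem IsClassified.blockIsOrthSepDiag (hJ : ∀ i, IsOpenInterval (J i))
    (hcl : IsClassified J I h) (hh : IsOrthMetricOn J I h) : BlockIsOrthSepDiag J I h :=
  fun _ hx₀ => isOrthSepDiag_of_hasStaeckelSystem (fun i => hJ i) (hh.pullback hx₀)
    (fun _ hy₀ => (hcl.hasStaeckelSystem hh (submanifoldPoint_mem_box hx₀ hy₀)).pullback hx₀)
    (hcl.hasPairFactors.pullback hx₀)

end Pullback

/-! ### Dependence between coordinates -/

section Involves

variable {ι : Type*} [Fintype ι] [DecidableEq ι] {J : ι → Set ℝ} {S : Finset ι}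
  {g : ι → (ι → ℝ) → ℝ} {x y : ι → ℝ} {i j k : ι}

/-- The arrow `i → j` of the dependence relation: the component `gᵢ` depends on the coordinate
`xⱼ`, where `j ≠ i`. -/
def Involves (J : ι → Set ℝ) (g : ι → (ι → ℝ) → ℝ) (i j : ι) : Prop :=
  i ≠ j ∧ ∃ x ∈ box J, logpd g i j x ≠ 0

lemma not_involves_iff (hij : i ≠ j) :
    ¬ Involves J g i j ↔ ∀ x ∈ box J, logpd g i j x = 0 := by
  simp [Involves, hij]

namespace SepDiagSystem

lemma differentiableAt (hJ : ∀ i, IsOpenInterval (J i)) (hg : SepDiagSystem J S g) (hi : i ∈ S)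
    (hx : x ∈ box J) : DifferentiableAt ℝ (g i) x :=
  differentiableAt_of_contDiffOn (isOpen_box hJ) (hg.isOrthMetricOn i hi).1 hx

lemma contDiffOn_logpd (hJ : ∀ i, IsOpenInterval (J i)) (hg : SepDiagSystem J S g) (hi : i ∈ S)
    (j : ι) : ContDiffOn ℝ ∞ (logpd g i j) (box J) :=
  OrthSep.contDiffOn_logpd (isOpen_box hJ) (hg.isOrthMetricOn i hi).1 (hg.isOrthMetricOn i hi).2 j

lemma differentiableAt_logpd (hJ : ∀ i, IsOpenInterval (J i)) (hg : SepDiagSystem J S g)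
    (hi : i ∈ S) (j : ι) (hx : x ∈ box J) : DifferentiableAt ℝ (logpd g i j) x :=
  differentiableAt_of_contDiffOn (isOpen_box hJ) (hg.contDiffOn_logpd hJ hi j) hx

lemma pd_eq_zero (hJ : ∀ i, IsOpenInterval (J i)) (hg : SepDiagSystem J S g) (hi : i ∈ S)
    (hx : x ∈ box J) (hk : k ∈ S → logpd g i k x = 0) : pd k (g i) x = 0 := by
  by_cases hkS : k ∈ S
  · rw [pd_eq_logpd_mul ((hg.isOrthMetricOn i hi).2 x hx) k, hk hkS, zero_mul]
  · exact DependsOnCoords.pd_eq_zero hJ (hg.differentiableAt hJ hi hx) (hg.dependsOnlyOn i hi) hkS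
      hx

lemma logpd_congr (hg : SepDiagSystem J S g) (hi : i ∈ S) (hj : j ∈ S) (hij : i ≠ j)
    (hx : x ∈ box J) (hy : y ∈ box J) (hxyi : x i = y i) (hxyj : x j = y j) :
    logpd g i j x = logpd g i j y :=
  hg.dependsOnCoords_logpd i hi j hj hij x hx y hy (by simp [hxyi, hxyj])

-- `∂ⱼ log |gᵢ| · gⱼ` does not depend on `xᵢ`, and `∂ⱼ log |gᵢ|` depends on `xᵢ` and `xⱼ` only.
lemma logpd_ne_zero (hJ : ∀ i, IsOpenInterval (J i)) (hg : SepDiagSystem J S g) (hi : i ∈ S)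
    (hj : j ∈ S) (hij : i ≠ j) (hx : x ∈ box J) (hy : y ∈ box J) (hxy : x j = y j)
    (hne : logpd g i j x ≠ 0) : logpd g i j y ≠ 0 := by
  have hpd (z : ι → ℝ) (hz : z ∈ box J) : pd i (fun z => logpd g i j z * g j z) z = 0 := by
    rw [pd_mul i (hg.differentiableAt_logpd hJ hi j hz) (hg.differentiableAt hJ hj hz),
      hg.pd_logpd i hi j hj hij z hz, pd_eq_logpd_mul ((hg.isOrthMetricOn j hj).2 z hz) i]
    ring
  have hyi := mem_box.1 hy i
  have hline := update_eq_of_pd_eq_zero hJ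
    (((hg.contDiffOn_logpd hJ hi j).mul (hg.isOrthMetricOn j hj).1).differentiableOn (by simp)) hpd
    hx hyi
  rw [hg.logpd_congr hi hj hij hy (update_mem_box hx hyi) (by simp) (by simp [hij.symm, hxy])]
  intro h0
  rw [h0, zero_mul] at hline
  exact mul_ne_zero hne ((hg.isOrthMetricOn j hj).2 x hx) hline.symm

lemma logpd_ne_zero_of_involves (hJ : ∀ i, IsOpenInterval (J i)) (hg : SepDiagSystem J S g)
    (hi : i ∈ S) (hj : j ∈ S) (hk : k ∈ S) (hik : i ≠ k) (hjk : j ≠ k) (hij : Involves J g i j)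
    (hx : x ∈ box J) (hne : logpd g j k x ≠ 0) : logpd g i k x ≠ 0 := by
  obtain ⟨hij, y, hy, hyne⟩ := hij
  intro h0
  have hz := update_mem_box hx (mem_box.1 hy j)
  have hmul := hg.logpd_mul_logpd i hi j hj k hk hij hik hjk _ hz
  rw [hg.logpd_congr hi hk hik hz hx (by simp [hij]) (by simp [hjk.symm]), h0, mul_zero, zero_mul,
    add_zero] at hmul
  exact mul_ne_zero (hg.logpd_ne_zero hJ hi hj hij hy hz (by simp) hyne)
    (hg.logpd_ne_zero hJ hj hk hjk hx hz (by simp [hjk.symm]) hne) hmul.symm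

lemma involves_trans (hJ : ∀ i, IsOpenInterval (J i)) (hg : SepDiagSystem J S g) (hi : i ∈ S)
    (hj : j ∈ S) (hk : k ∈ S) (hik : i ≠ k) (hij : Involves J g i j) (hjk : Involves J g j k) :
    Involves J g i k :=
  let ⟨hjk, x, hx, hne⟩ := hjk
  ⟨hik, x, hx, hg.logpd_ne_zero_of_involves hJ hi hj hk hik hjk hij hx hne⟩

lemma involves_or_involves (hJ : ∀ i, IsOpenInterval (J i)) (hg : SepDiagSystem J S g)
    (hi : i ∈ S) (hj : j ∈ S) (hk : k ∈ S) (hjk : j ≠ k) (hij : Involves J g i j)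
    (hik : Involves J g i k) : Involves J g j k ∨ Involves J g k j := by
  obtain ⟨hij, x, hx, hxne⟩ := hij
  obtain ⟨hik, y, hy, hyne⟩ := hik
  by_contra! hcon
  rw [not_involves_iff hjk, not_involves_iff hjk.symm] at hcon
  have hz := update_mem_box hx (mem_box.1 hy k)
  have hmul := hg.logpd_mul_logpd i hi j hj k hk hij hik hjk _ hz
  rw [hcon.1 _ hz, hcon.2 _ hz, mul_zero, mul_zero, add_zero] at hmul
  exact mul_ne_zero (hg.logpd_ne_zero hJ hi hj hij hx hz (by simp [hjk]) hxne)
    (hg.logpd_ne_zero hJ hi hk hik hy hz (by simp) hyne) hmul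

lemma exists_terminal (hJ : ∀ i, IsOpenInterval (J i)) (hg : SepDiagSystem J S g)
    (hS : S.Nonempty) : ∃ o ∈ S, ∀ j ∈ S, Involves J g o j → Involves J g j o := by
  classical
  let succ (i : ι) : Finset ι := S.filter fun j => j = i ∨ Involves J g i j
  obtain ⟨o, ho, hmin⟩ := Finset.exists_min_image S (fun i => (succ i).card) hS
  refine ⟨o, ho, fun j hj hoj => ?_⟩
  have hsub : succ j ⊆ succ o := by
    intro k hk
    obtain ⟨hkS, rfl | hjk⟩ := Finset.mem_filter.1 hk
    · exact Finset.mem_filter.2 ⟨hkS, .inr hoj⟩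
    · refine Finset.mem_filter.2 ⟨hkS, or_iff_not_imp_left.2 fun hko => ?_⟩
      exact hg.involves_trans hJ ho hj hkS (Ne.symm hko) hoj hjk
  have hmem : o ∈ succ j := by
    rw [Finset.eq_of_subset_of_card_le hsub (hmin j hj)]
    exact Finset.mem_filter.2 ⟨ho, .inl rfl⟩
  exact (Finset.mem_filter.1 hmem).2.resolve_left hoj.1

theorem div (hJ : ∀ i, IsOpenInterval (J i)) (hg : SepDiagSystem J S g) {I M : Finset ι}
    (hIS : I ⊆ S) (hIM : Disjoint I M) {w : (ι → ℝ) → ℝ} (hw : ContDiffOn ℝ ∞ w (box J))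
    (hw0 : ∀ x ∈ box J, w x ≠ 0) (hwM : DependsOnCoords J M w)
    (hpd : ∀ i ∈ I, ∀ k ∈ M, ∀ x ∈ box J, pd k w x = logpd g i k x * w x)
    (hout : ∀ i ∈ I, ∀ k ∈ S, k ∉ M → k ∉ I → ∀ x ∈ box J, logpd g i k x = 0) :
    SepDiagSystem J I fun i x => g i x / w x := by
  have hquot (i : ι) (hi : i ∈ I) : ContDiffOn ℝ ∞ (fun x => g i x / w x) (box J) :=
    (hg.isOrthMetricOn i (hIS hi)).1.div hw hw0
  refine hg.of_eq_mul hJ hIS hIM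
    (fun i hi => ⟨hquot i hi,
      fun x hx => div_ne_zero ((hg.isOrthMetricOn i (hIS hi)).2 x hx) (hw0 x hx)⟩)
    (fun i hi => dependsOnCoords_of_pd_eq_zero hJ ((hquot i hi).differentiableOn (by simp))
      fun k hkI z hz => ?_) hw hw0 hwM fun i _ x hx => (mul_div_cancel₀ _ (hw0 x hx)).symm
  have hgd := hg.differentiableAt hJ (hIS hi) hz
  have hwd := differentiableAt_of_contDiffOn (isOpen_box hJ) hw hz
  have hwronskian : pd k (g i) z * w z = g i z * pd k w z := by
    by_cases hkM : k ∈ M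
    · rw [hpd i hi k hkM z hz, pd_eq_logpd_mul ((hg.isOrthMetricOn i (hIS hi)).2 z hz) k]
      ring
    rw [hwM.pd_eq_zero hJ hwd hkM hz, mul_zero]
    rw [hg.pd_eq_zero hJ (hIS hi) hz fun hkS => hout i hi k hkS hkM hkI z hz, zero_mul]
  rw [pd_div k hgd hwd (hw0 z hz), hwronskian, sub_self, zero_div]

end SepDiagSystem

end Involves

lemma exists_finpartition_mem_iff_eq {ι β : Type*} [DecidableEq ι] (s : Finset ι) (f : ι → β) :
    ∃ P : Finpartition s, ∀ I ∈ P.parts, ∀ i ∈ I, ∀ k ∈ s, k ∈ I ↔ f k = f i := by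
  classical
  refine ⟨.ofSetSetoid (Setoid.ker f) s, fun I hI i hi k hk => ?_⟩
  have his : i ∈ s := Finpartition.le _ hI hi
  rw [← Finpartition.part_eq_of_mem _ hI hi, Finpartition.mem_part_ofSetSetoid_iff_rel,
    Setoid.ker_def]
  simp [his, hk, eq_comm]

/-! ### The eigenvalues of the concircular tensor -/

section Eigenvalues

variable {ι : Type*} [Fintype ι] [DecidableEq ι] {J : ι → Set ℝ} {S : Finset ι}
  {f : (ι → ℝ) → ℝ} {g : ι → (ι → ℝ) → ℝ} {x b : ι → ℝ} {i j k o : ι} {s t : ℝ}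

lemma contDiffOn_comp_update_left (hf : ContDiffOn ℝ ∞ f (box J)) (ht : t ∈ J j) :
    ContDiffOn ℝ ∞ (fun x => f (update x j t)) (box J) := by
  refine hf.comp (contDiff_pi.2 fun l => ?_).contDiffOn fun x hx => update_mem_box hx ht
  obtain rfl | hlj := eq_or_ne l j
  · simpa using contDiff_const
  · simpa [hlj] using contDiff_apply ℝ ℝ l

lemma pd_comp_update_left_of_ne (hJ : ∀ i, IsOpenInterval (J i)) (hf : ContDiffOn ℝ ∞ f (box J))
    (ht : t ∈ J j) (hx : x ∈ box J) (hij : i ≠ j) :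
    pd i (fun x => f (update x j t)) x = pd i f (update x j t) := by
  have hU := isOpen_box hJ
  have hleft := hasDerivAt_comp_update i
    (differentiableAt_of_contDiffOn hU (contDiffOn_comp_update_left hf ht) hx)
  have hright := hasDerivAt_comp_update i
    (differentiableAt_of_contDiffOn hU hf (update_mem_box hx ht))
  rw [update_of_ne hij] at hright
  refine hleft.unique ?_
  simpa only [update_comm hij] using hright

lemma pd_comp_update_left_self (hJ : ∀ i, IsOpenInterval (J i)) (hf : ContDiffOn ℝ ∞ f (box J))
    (ht : t ∈ J j) (hx : x ∈ box J) : pd j (fun x => f (update x j t)) x = 0 := by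
  have h := hasDerivAt_comp_update j
    (differentiableAt_of_contDiffOn (isOpen_box hJ) (contDiffOn_comp_update_left hf ht) hx)
  simp only [update_idem] at h
  exact h.unique (hasDerivAt_const _ _)

lemma sub_comp_update_eq_of_pd_pd_eq_zero (hJ : ∀ i, IsOpenInterval (J i))
    (hf : ContDiffOn ℝ ∞ f (box J)) (hij : i ≠ j) (h0 : ∀ z ∈ box J, pd j (pd i f) z = 0)
    (hx : x ∈ box J) (hs : s ∈ J j) (ht : t ∈ J i) :
    f (update x i t) - f (update (update x i t) j s) = f x - f (update x j s) := by
  have hU := isOpen_box hJ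
  have hf' := contDiffOn_comp_update_left hf hs
  refine update_eq_of_pd_eq_zero (f := fun x => f x - f (update x j s)) hJ
    ((hf.sub hf').differentiableOn (by simp)) (fun z hz => ?_) hx ht
  rw [pd_sub i (differentiableAt_of_contDiffOn hU hf hz) (differentiableAt_of_contDiffOn hU hf' hz),
    pd_comp_update_left_of_ne hJ hf hs hz hij, update_eq_of_pd_eq_zero hJ
      ((contDiffOn_pd hU hf i).differentiableOn (by simp)) h0 hz hs, sub_self]

lemma deriv_eq_zero_of_not_nonconstOn {φ : ℝ → ℝ} {A : Set ℝ} (hA : IsOpen A) (ht : t ∈ A)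
    (hφ : ¬ NonconstOn φ A) : deriv φ t = 0 := by
  have hconst : φ =ᶠ[𝓝 t] fun _ => φ t := eventually_of_mem (hA.mem_nhds ht) fun u hu => by
    by_contra hne
    exact hφ ⟨u, hu, t, ht, hne⟩
  rw [hconst.deriv_eq, deriv_const]

/-- The functions `σᵢ` of the single variables `xᵢ` are the eigenvalues of a concircular tensor of
`∑_{i ∈ S} gᵢ dxᵢ²` that is diagonal in the coordinates. -/
structure IsConcircularSpectrum (J : ι → Set ℝ) (S : Finset ι) (g : ι → (ι → ℝ) → ℝ)
    (σ : ι → ℝ → ℝ) : Prop where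
  contDiffOn : ∀ i ∈ S, ContDiffOn ℝ ∞ (σ i) (J i)
  logpd_mul_sub : ∀ i ∈ S, ∀ k ∈ S, i ≠ k → ∀ x ∈ box J,
    logpd g i k x * (σ i (x i) - σ k (x k)) = -deriv (σ k) (x k)

/-- The conformal factor of the two-dimensional metric `gₒ dxₒ² + gⱼ dxⱼ²`, after the rescaling of
`xₒ` and `xⱼ` that brings it to Liouville form and makes the factor equal to `gⱼ` at `xⱼ = s`. -/
noncomputable def liouvilleFactor (g : ι → (ι → ℝ) → ℝ) (o j : ι) (s : ℝ) (x : ι → ℝ) : ℝ :=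
  g o x * (g j (update x j s) / g o (update x j s))

/-- The eigenvalue `σᵢ`, for `i ≠ o`, under the normalisation `σₒ = 0`, `σₒ' = 1` at `bₒ`; it is
read off from `∂ₒ log |gᵢ| · (σₒ - σᵢ) = σₒ'`. -/
noncomputable def sliceEigenvalue (g : ι → (ι → ℝ) → ℝ) (o : ι) (b : ι → ℝ) (i : ι) (t : ℝ) : ℝ :=
  -(logpd g i o (update b i t))⁻¹

/-- The eigenvalue `σₒ` under the normalisation `σₒ = 0`, `σₒ' = 1` at `bₒ`, found from a second
coordinate `xⱼ` by Liouville's theorem. -/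
noncomputable def pivotEigenvalue (g : ι → (ι → ℝ) → ℝ) (o : ι) (b : ι → ℝ) (j : ι) (t : ℝ) : ℝ :=
  (g j (update b o t) - g j b) / pd o (g j) b

namespace SepDiagSystem

lemma logpd_self_sub_logpd_update (hJ : ∀ i, IsOpenInterval (J i)) (hg : SepDiagSystem J S g)
    (ho : o ∈ S) (hj : j ∈ S) (hoj : o ≠ j) (hx : x ∈ box J) (ht : t ∈ J j) :
    logpd g o o (update x j t) - logpd g j o (update x j t) = logpd g o o x - logpd g j o x := by
  have hdiff := (hg.contDiffOn_logpd hJ ho o).sub (hg.contDiffOn_logpd hJ hj o)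
  refine update_eq_of_pd_eq_zero hJ (hdiff.differentiableOn (by simp)) (fun z hz => ?_) hx ht
  obtain ⟨hos, ho0⟩ := hg.isOrthMetricOn o ho
  rw [pd_sub j (hg.differentiableAt_logpd hJ ho o hz) (hg.differentiableAt_logpd hJ hj o hz),
    pd_logpd_comm (isOpen_box hJ) hos ho0 hz, hg.pd_logpd o ho j hj hoj z hz,
    hg.pd_logpd j hj o ho hoj.symm z hz]
  ring

lemma contDiffOn_liouvilleFactor (hg : SepDiagSystem J S g) (ho : o ∈ S) (hj : j ∈ S)
    (hs : s ∈ J j) : ContDiffOn ℝ ∞ (liouvilleFactor g o j s) (box J) := by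
  obtain ⟨hos, ho0⟩ := hg.isOrthMetricOn o ho
  exact hos.mul (contDiffOn_comp_update_left ((hg.isOrthMetricOn j hj).1.div hos ho0) hs)

lemma liouvilleFactor_eq (hg : SepDiagSystem J S g) (ho : o ∈ S) (hx : x ∈ box J)
    (hxs : x j = s) : liouvilleFactor g o j s x = g j x := by
  rw [liouvilleFactor, ← hxs, update_eq_self, mul_div_cancel₀ _ ((hg.isOrthMetricOn o ho).2 x hx)]

lemma pd_liouvilleFactor (hJ : ∀ i, IsOpenInterval (J i)) (hg : SepDiagSystem J S g) (ho : o ∈ S)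
    (hj : j ∈ S) (hs : s ∈ J j) (hx : x ∈ box J) :
    pd j (liouvilleFactor g o j s) x = logpd g o j x * liouvilleFactor g o j s x := by
  obtain ⟨hos, ho0⟩ := hg.isOrthMetricOn o ho
  have hquot : ContDiffOn ℝ ∞ (fun x => g j x / g o x) (box J) :=
    (hg.isOrthMetricOn j hj).1.div hos ho0
  unfold liouvilleFactor
  rw [pd_mul j (hg.differentiableAt hJ ho hx) (differentiableAt_of_contDiffOn (isOpen_box hJ)
      (contDiffOn_comp_update_left hquot hs) hx),
    pd_comp_update_left_self hJ hquot hs hx, pd_eq_logpd_mul (ho0 x hx) j]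
  ring

lemma pd_liouvilleFactor_pivot (hJ : ∀ i, IsOpenInterval (J i)) (hg : SepDiagSystem J S g)
    (ho : o ∈ S) (hj : j ∈ S) (hoj : o ≠ j) (hs : s ∈ J j) (hx : x ∈ box J) :
    pd o (liouvilleFactor g o j s) x = logpd g j o x * liouvilleFactor g o j s x := by
  obtain ⟨hos, ho0⟩ := hg.isOrthMetricOn o ho
  obtain ⟨hjs, hj0⟩ := hg.isOrthMetricOn j hj
  have hquot : ContDiffOn ℝ ∞ (fun x => g j x / g o x) (box J) := hjs.div hos ho0
  have hx' := update_mem_box hx hs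
  have ho0' := ho0 _ hx'
  have hpd : pd o (fun x => g j x / g o x) (update x j s) =
      (logpd g j o x - logpd g o o x) * (g j (update x j s) / g o (update x j s)) := by
    rw [pd_div o (hg.differentiableAt hJ hj hx') (hg.differentiableAt hJ ho hx') ho0',
      pd_eq_logpd_mul (hj0 _ hx') o, pd_eq_logpd_mul ho0' o, ← neg_sub (logpd g o o x),
      ← hg.logpd_self_sub_logpd_update hJ ho hj hoj hx hs]
    field_simp
    ring
  unfold liouvilleFactor
  rw [pd_mul o (hg.differentiableAt hJ ho hx) (differentiableAt_of_contDiffOn (isOpen_box hJ)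
      (contDiffOn_comp_update_left hquot hs) hx),
    pd_comp_update_left_of_ne hJ hquot hs hx hoj, hpd, pd_eq_logpd_mul (ho0 x hx) o]
  ring

lemma pd_pd_liouvilleFactor (hJ : ∀ i, IsOpenInterval (J i)) (hg : SepDiagSystem J S g)
    (ho : o ∈ S) (hj : j ∈ S) (hoj : o ≠ j) (hs : s ∈ J j) (hx : x ∈ box J) :
    pd j (pd o (liouvilleFactor g o j s)) x = 0 := by
  have hU := isOpen_box hJ
  rw [pd_congr_of_eqOn hU hx fun z hz => hg.pd_liouvilleFactor_pivot hJ ho hj hoj hs hz,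
    pd_mul j (hg.differentiableAt_logpd hJ hj o hx)
      (differentiableAt_of_contDiffOn hU (hg.contDiffOn_liouvilleFactor ho hj hs) hx),
    hg.pd_logpd j hj o ho hoj.symm x hx, hg.pd_liouvilleFactor hJ ho hj hs hx]
  ring

lemma logpd_mul_liouvilleFactor (hJ : ∀ i, IsOpenInterval (J i)) (hg : SepDiagSystem J S g)
    (ho : o ∈ S) (hj : j ∈ S) (hoj : o ≠ j) (hs : s ∈ J j) (hx : x ∈ box J) :
    logpd g j o x * liouvilleFactor g o j s x = pd o (g j) (update x j s) := by
  have hx' := update_mem_box hx hs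
  rw [← hg.pd_liouvilleFactor_pivot hJ ho hj hoj hs hx, ← update_eq_of_pd_eq_zero hJ
    ((contDiffOn_pd (isOpen_box hJ) (hg.contDiffOn_liouvilleFactor ho hj hs) o).differentiableOn
      (by simp)) (fun z hz => hg.pd_pd_liouvilleFactor hJ ho hj hoj hs hz) hx hs,
    hg.pd_liouvilleFactor_pivot hJ ho hj hoj hs hx',
    hg.liouvilleFactor_eq ho hx' (update_self ..),
    pd_eq_logpd_mul ((hg.isOrthMetricOn j hj).2 _ hx') o]

lemma hasDerivAt_pivotEigenvalue (hJ : ∀ i, IsOpenInterval (J i)) (hg : SepDiagSystem J S g)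
    (hb : b ∈ box J) (hj : j ∈ S) (ht : t ∈ J o) :
    HasDerivAt (pivotEigenvalue g o b j) (pd o (g j) (update b o t) / pd o (g j) b) t :=
  ((hasDerivAt_comp_update' o (hg.differentiableAt hJ hj (update_mem_box hb ht))).sub_const
    _).div_const _

lemma contDiffOn_pivotEigenvalue (hg : SepDiagSystem J S g) (hb : b ∈ box J) (hj : j ∈ S) :
    ContDiffOn ℝ ∞ (pivotEigenvalue g o b j) (J o) :=
  ((contDiffOn_comp_update (hg.isOrthMetricOn j hj).1 hb o).sub contDiffOn_const).div_const _

section Slice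

variable (hJ : ∀ i, IsOpenInterval (J i)) (hg : SepDiagSystem J S g) (ho : o ∈ S) (hb : b ∈ box J)
include hJ hg ho hb

lemma logpd_mul_sliceEigenvalue (hk : k ∈ S) (hko : k ≠ o) (hne : logpd g k o b ≠ 0)
    (hx : x ∈ box J) (hxo : x o = b o) : logpd g k o x * sliceEigenvalue g o b k (x k) = -1 := by
  rw [sliceEigenvalue, ← hg.logpd_congr hk ho hko hx (update_mem_box hb (mem_box.1 hx k))
    (by simp) (by simp [hko.symm, hxo]), mul_neg,
    mul_inv_cancel₀ (hg.logpd_ne_zero hJ hk ho hko hb hx hxo.symm hne)]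

lemma logpd_update_ne_zero (hk : k ∈ S) (hko : k ≠ o) (hne : logpd g k o b ≠ 0) (ht : t ∈ J k) :
    logpd g k o (update b k t) ≠ 0 :=
  hg.logpd_ne_zero hJ hk ho hko hb (update_mem_box hb ht) (by simp [hko.symm]) hne

lemma contDiffOn_sliceEigenvalue (hk : k ∈ S) (hko : k ≠ o) (hne : logpd g k o b ≠ 0) :
    ContDiffOn ℝ ∞ (sliceEigenvalue g o b k) (J k) :=
  ((contDiffOn_comp_update (hg.contDiffOn_logpd hJ hk o) hb k).inv fun _ ht =>
    hg.logpd_update_ne_zero hJ ho hb hk hko hne ht).neg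

lemma logpd_pivot_mul_sliceEigenvalue (hk : k ∈ S) (hko : k ≠ o) (hne : logpd g k o b ≠ 0)
    (hx : x ∈ box J) (hxo : x o = b o) :
    logpd g o k x * sliceEigenvalue g o b k (x k) = deriv (sliceEigenvalue g o b k) (x k) := by
  have hxk := mem_box.1 hx k
  have hz := update_mem_box hb hxk
  have hz0 := hg.logpd_update_ne_zero hJ ho hb hk hko hne hxk
  have hderiv := ((hasDerivAt_comp_update' (x := b) k
    (hg.differentiableAt_logpd hJ hk o hz)).fun_inv hz0).fun_neg.deriv
  rw [show sliceEigenvalue g o b k = fun t => -(logpd g k o (update b k t))⁻¹ from rfl, hderiv,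
    hg.pd_logpd k hk o ho hko _ hz,
    hg.logpd_congr ho hk hko.symm hx hz (by simp [hko.symm, hxo]) (by simp)]
  field_simp

lemma logpd_mul_sliceEigenvalue_sub (hi : i ∈ S) (hio : i ≠ o) (hi_ne : logpd g i o b ≠ 0)
    (hk : k ∈ S) (hko : k ≠ o) (hk_ne : logpd g k o b ≠ 0) (hik : i ≠ k) (hx : x ∈ box J) :
    logpd g i k x * (sliceEigenvalue g o b i (x i) - sliceEigenvalue g o b k (x k)) =
      -deriv (sliceEigenvalue g o b k) (x k) := by
  set z := update x o (b o)
  have hz : z ∈ box J := update_mem_box hx (mem_box.1 hb o)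
  have hzo : z o = b o := by simp [z]
  have hzi : z i = x i := by simp [z, hio]
  have hzk : z k = x k := by simp [z, hko]
  have hmul := hg.logpd_mul_logpd i hi o ho k hk hio hik hko.symm z hz
  have hσi := hg.logpd_mul_sliceEigenvalue hJ ho hb hi hio hi_ne hz hzo
  have hσk := hg.logpd_mul_sliceEigenvalue hJ ho hb hk hko hk_ne hz hzo
  have hσk' := hg.logpd_pivot_mul_sliceEigenvalue hJ ho hb hk hko hk_ne hz hzo
  rw [hzi] at hσi
  rw [hzk] at hσk hσk'
  rw [hg.logpd_congr hi hk hik hx hz hzi.symm hzk.symm]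
  set σi := sliceEigenvalue g o b i (x i)
  set σk := sliceEigenvalue g o b k (x k)
  linear_combination (σi * σk) * hmul - hσk' - (logpd g i k z * σk - logpd g o k z * σk) * hσi
    + (logpd g i k z * σi) * hσk

lemma logpd_mul_pivotEigenvalue_sub (hj : j ∈ S) (hjo : j ≠ o) (hne : logpd g j o b ≠ 0)
    (hx : x ∈ box J) :
    logpd g j o x * (pivotEigenvalue g o b j (x o) - sliceEigenvalue g o b j (x j)) =
      deriv (pivotEigenvalue g o b j) (x o) := by
  have hbj := mem_box.1 hb j
  set c := pd o (g j) b with hc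
  have hc0 : c ≠ 0 := by
    rw [hc, pd_eq_logpd_mul ((hg.isOrthMetricOn j hj).2 b hb) o]
    exact mul_ne_zero hne ((hg.isOrthMetricOn j hj).2 b hb)
  set G := liouvilleFactor g o j (b j)
  have hGs := hg.contDiffOn_liouvilleFactor ho hj hbj
  have hG0 := fun z hz => hg.pd_pd_liouvilleFactor hJ ho hj hjo.symm hbj (x := z) hz
  set y := update b j (x j)
  set z := update y o (x o)
  have hy : y ∈ box J := update_mem_box hb (mem_box.1 hx j)
  have hz : z ∈ box J := update_mem_box hy (mem_box.1 hx o)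
  have hyb : update y j (b j) = b := by simp [y]
  have hzb : update z j (b j) = update b o (x o) := by rw [update_comm hjo.symm, hyb]
  have hGy : G y = -(c * sliceEigenvalue g o b j (x j)) := by
    have hσ := hg.logpd_mul_sliceEigenvalue hJ ho hb hj hjo hne hy (by simp [y, hjo.symm])
    rw [show y j = x j from update_self ..] at hσ
    have h := hg.logpd_mul_liouvilleFactor hJ ho hj hjo.symm hbj hy
    rw [hyb] at h
    refine mul_left_cancel₀ (left_ne_zero_of_mul (hσ.trans_ne (by norm_num))) ?_
    linear_combination h + c * hσ
  have hGz : G z = c * (pivotEigenvalue g o b j (x o) - sliceEigenvalue g o b j (x j)) := by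
    have h := sub_comp_update_eq_of_pd_pd_eq_zero hJ hGs hjo.symm hG0 hy hbj (mem_box.1 hx o)
    rw [hzb, hyb, hg.liouvilleFactor_eq ho hb rfl, hg.liouvilleFactor_eq ho
      (update_mem_box hb (mem_box.1 hx o)) (update_of_ne hjo ..)] at h
    rw [mul_sub, pivotEigenvalue, mul_div_cancel₀ _ hc0]
    linear_combination h + hGy
  have hpdGz : _ * G z = _ := hg.logpd_mul_liouvilleFactor hJ ho hj hjo.symm hbj hz
  rw [hzb, hGz] at hpdGz
  rw [(hg.hasDerivAt_pivotEigenvalue hJ hb hj (mem_box.1 hx o)).deriv,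
    hg.logpd_congr hj ho hjo hx hz (by simp [z, y, hjo]) (by simp [z]), eq_div_iff hc0, ← hpdGz]
  ring

lemma logpd_pivot_mul_sub (hk : k ∈ S) (hko : k ≠ o) (hne : logpd g k o b ≠ 0) {φ : ℝ → ℝ}
    (hφ : ContDiffOn ℝ ∞ φ (J o)) (hφ0 : φ (b o) = 0)
    (hcol : ∀ z ∈ box J,
      logpd g k o z * (φ (z o) - sliceEigenvalue g o b k (z k)) = deriv φ (z o))
    (hx : x ∈ box J) :
    logpd g o k x * (φ (x o) - sliceEigenvalue g o b k (x k)) =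
      -deriv (sliceEigenvalue g o b k) (x k) := by
  have hbo := mem_box.1 hb o
  have hσ := hg.contDiffOn_sliceEigenvalue hJ ho hb hk hko hne
  have hφx := contDiffOn_comp_eval (ι := ι) hφ
  have hσx := contDiffOn_comp_eval (ι := ι) hσ
  have hline := update_eq_of_pd_eq_zero hJ (j := o)
    (((hg.contDiffOn_logpd hJ ho k).mul (hφx.sub hσx)).differentiableOn (by simp))
    (fun z hz => ?_) hx hbo
  · have h := hg.logpd_pivot_mul_sliceEigenvalue hJ ho hb hk hko hne (update_mem_box hx hbo)
      (by simp)
    simp only [update_self, update_of_ne hko, hφ0] at h hline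
    linear_combination -hline - h
  · have hφd := differentiableAt_of_contDiffOn (hJ o).1 hφ (mem_box.1 hz o)
    have hσd := differentiableAt_of_contDiffOn (hJ k).1 hσ (mem_box.1 hz k)
    rw [pd_mul o (hg.differentiableAt_logpd hJ ho k hz)
        ((differentiableAt_comp_eval hφd).fun_sub (differentiableAt_comp_eval hσd)),
      pd_sub o (differentiableAt_comp_eval hφd) (differentiableAt_comp_eval hσd),
      pd_comp_eval_self o hφd, pd_comp_eval_of_ne hko.symm hσd, hg.pd_logpd o ho k hk hko.symm z hz]
    linear_combination (-logpd g o k z) * hcol z hz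

lemma logpd_pivot_mul_pivotEigenvalue_sub (hj : j ∈ S) (hjo : j ≠ o) (hne : logpd g j o b ≠ 0)
    (hx : x ∈ box J) :
    logpd g o j x * (pivotEigenvalue g o b j (x o) - sliceEigenvalue g o b j (x j)) =
      -deriv (sliceEigenvalue g o b j) (x j) :=
  hg.logpd_pivot_mul_sub hJ ho hb hj hjo hne (hg.contDiffOn_pivotEigenvalue hb hj)
    (by simp [pivotEigenvalue])
    (fun _ hz => hg.logpd_mul_pivotEigenvalue_sub hJ ho hb hj hjo hne hz) hx

-- At a point where `∂ⱼ log |gᵢ| ≠ 0`, the relation for `(i, o)` follows from those for `(i, j)`,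
-- `(j, o)` and `(o, j)`.
lemma logpd_mul_pivotEigenvalue_sub_of_involves (hi : i ∈ S) (hio : i ≠ o)
    (hi_ne : logpd g i o b ≠ 0) (hj : j ∈ S) (hjo : j ≠ o) (hj_ne : logpd g j o b ≠ 0)
    (hij : Involves J g i j) (hx : x ∈ box J) :
    logpd g i o x * (pivotEigenvalue g o b j (x o) - sliceEigenvalue g o b i (x i)) =
      deriv (pivotEigenvalue g o b j) (x o) := by
  obtain ⟨hij, y, hy, hyne⟩ := hij
  set z := update x j (y j)
  have hz : z ∈ box J := update_mem_box hx (mem_box.1 hy j)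
  have hzi : z i = x i := update_of_ne hij ..
  have hzo : z o = x o := update_of_ne hjo.symm ..
  have hmul := hg.logpd_mul_logpd i hi o ho j hj hio hij hjo.symm z hz
  have hσij := hg.logpd_mul_sliceEigenvalue_sub hJ ho hb hi hio hi_ne hj hjo hj_ne hij hz
  have hσjo := hg.logpd_mul_pivotEigenvalue_sub hJ ho hb hj hjo hj_ne hz
  have hσoj := hg.logpd_pivot_mul_pivotEigenvalue_sub hJ ho hb hj hjo hj_ne hz
  rw [hg.logpd_congr hi ho hio hx hz hzi.symm hzo.symm, ← hzo, ← hzi]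
  refine mul_left_cancel₀ (hg.logpd_ne_zero hJ hi hj hij hy hz (by simp [z]) hyne) ?_
  linear_combination (pivotEigenvalue g o b j (z o) - sliceEigenvalue g o b j (z j)) * hmul
    + logpd g i o z * hσoj + logpd g i j z * hσjo - logpd g i o z * hσij

end Slice

lemma nonconstOn_pivotEigenvalue (hJ : ∀ i, IsOpenInterval (J i)) (hg : SepDiagSystem J S g)
    (hb : b ∈ box J) (hj : j ∈ S) (hne : logpd g j o b ≠ 0) :
    NonconstOn (pivotEigenvalue g o b j) (J o) := by
  by_contra hconst
  have h0 := deriv_eq_zero_of_not_nonconstOn (hJ o).1 (mem_box.1 hb o) hconst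
  have hpd : pd o (g j) b ≠ 0 := by
    rw [pd_eq_logpd_mul ((hg.isOrthMetricOn j hj).2 b hb) o]
    exact mul_ne_zero hne ((hg.isOrthMetricOn j hj).2 b hb)
  rw [(hg.hasDerivAt_pivotEigenvalue hJ hb hj (mem_box.1 hb o)).deriv, update_eq_self] at h0
  exact div_ne_zero hpd hpd h0

theorem exists_isConcircularSpectrum (hJ : ∀ i, IsOpenInterval (J i)) (hg : SepDiagSystem J S g)
    (ho : o ∈ S) (hj : j ∈ S) (hall : ∀ i ∈ S, i ≠ o → Involves J g i o)
    (hoj : Involves J g o j) :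
    ∃ σ, IsConcircularSpectrum J S g σ ∧ NonconstOn (σ o) (J o) := by
  have hjo := hoj.1.symm
  obtain ⟨-, b, hb, hb_ne⟩ := hall j hj hjo
  have hij {i : ι} (hi : i ∈ S) (hio : i ≠ o) (hij : i ≠ j) : Involves J g i j :=
    hg.involves_trans hJ hi ho hj hij (hall i hi hio) hoj
  have hne {i : ι} (hi : i ∈ S) (hio : i ≠ o) : logpd g i o b ≠ 0 := by
    obtain rfl | hne := eq_or_ne i j
    · exact hb_ne
    · exact hg.logpd_ne_zero_of_involves hJ hi hj ho hio hjo (hij hi hio hne) hb hb_ne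
  set φ := pivotEigenvalue g o b j
  have hφ : ContDiffOn ℝ ∞ φ (J o) := hg.contDiffOn_pivotEigenvalue hb hj
  have hcol {i : ι} (hi : i ∈ S) (hio : i ≠ o) {x : ι → ℝ} (hx : x ∈ box J) :
      logpd g i o x * (φ (x o) - sliceEigenvalue g o b i (x i)) = deriv φ (x o) := by
    obtain rfl | hne' := eq_or_ne i j
    · exact hg.logpd_mul_pivotEigenvalue_sub hJ ho hb hi hio (hne hi hio) hx
    · exact hg.logpd_mul_pivotEigenvalue_sub_of_involves hJ ho hb hi hio (hne hi hio) hj hjo hb_ne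
        (hij hi hio hne') hx
  refine ⟨update (sliceEigenvalue g o b) o φ, ⟨fun i hi => ?_, fun i hi k hk hik x hx => ?_⟩, ?_⟩
  · obtain rfl | hio := eq_or_ne i o
    · rwa [update_self]
    · rw [update_of_ne hio]
      exact hg.contDiffOn_sliceEigenvalue hJ ho hb hi hio (hne hi hio)
  · obtain rfl | hio := eq_or_ne i o
    · rw [update_self, update_of_ne hik.symm]
      exact hg.logpd_pivot_mul_sub hJ ho hb hk hik.symm (hne hk hik.symm) hφ
        (by simp [φ, pivotEigenvalue]) (fun _ hz => hcol hk hik.symm hz) hx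
    obtain rfl | hko := eq_or_ne k o
    · rw [update_self, update_of_ne hio, ← hcol hi hio hx]
      ring
    · rw [update_of_ne hio, update_of_ne hko]
      exact hg.logpd_mul_sliceEigenvalue_sub hJ ho hb hi hio (hne hi hio) hk hko (hne hk hko) hik hx
  · rw [update_self]
    exact hg.nonconstOn_pivotEigenvalue hJ hb hj hb_ne

end SepDiagSystem

end Eigenvalues

/-! ### Concircular forms -/

section ConcircularForm

variable {ι : Type*} [Fintype ι] [DecidableEq ι] {J : ι → Set ℝ} {S M I : Finset ι}
  {g : ι → (ι → ℝ) → ℝ} {σ : ι → ℝ → ℝ} {x : ι → ℝ} {i k o : ι}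

/-- The factor `∏_{c ∈ M, c ≠ i} (σᵢ - σ_c)` of `gᵢ` in a concircular-tensor form, for `i ∈ M` as
well as for `i` in one of the blocks, where `σᵢ` is the constant of the block. -/
def eigenvalueProd (σ : ι → ℝ → ℝ) (M : Finset ι) (i : ι) (x : ι → ℝ) : ℝ :=
  ∏ c ∈ M.erase i, (σ i (x i) - σ c (x c))

namespace IsConcircularSpectrum

lemma differentiableAt (hJ : ∀ i, IsOpenInterval (J i)) (hσ : IsConcircularSpectrum J S g σ)
    (hi : i ∈ S) (hx : x ∈ box J) : DifferentiableAt ℝ (σ i) (x i) :=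
  differentiableAt_of_contDiffOn (hJ i).1 (hσ.contDiffOn i hi) (mem_box.1 hx i)

lemma contDiffOn_sub (hσ : IsConcircularSpectrum J S g σ) (hi : i ∈ S) (hk : k ∈ S) :
    ContDiffOn ℝ ∞ (fun x : ι → ℝ => σ i (x i) - σ k (x k)) (box J) :=
  (contDiffOn_comp_eval (hσ.contDiffOn i hi)).sub (contDiffOn_comp_eval (hσ.contDiffOn k hk))

lemma pd_sub_self (hJ : ∀ i, IsOpenInterval (J i)) (hσ : IsConcircularSpectrum J S g σ)
    (hi : i ∈ S) (hk : k ∈ S) (hik : i ≠ k) (hx : x ∈ box J) :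
    pd k (fun x => σ i (x i) - σ k (x k)) x = logpd g i k x * (σ i (x i) - σ k (x k)) := by
  have hdi := hσ.differentiableAt hJ hi hx
  have hdk := hσ.differentiableAt hJ hk hx
  rw [pd_sub k (differentiableAt_comp_eval hdi) (differentiableAt_comp_eval hdk),
    pd_comp_eval_of_ne hik.symm hdi, pd_comp_eval_self k hdk, zero_sub,
    hσ.logpd_mul_sub i hi k hk hik x hx]

-- `(σᵢ - σₖ) / gᵢ` does not depend on `xₖ`, so a zero of `σᵢ - σₖ` makes `σₖ` constant.
lemma sub_ne_zero (hJ : ∀ i, IsOpenInterval (J i)) (hg : SepDiagSystem J S g)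
    (hσ : IsConcircularSpectrum J S g σ) (hi : i ∈ S) (hk : k ∈ S) (hik : i ≠ k)
    (hσk : NonconstOn (σ k) (J k)) (hx : x ∈ box J) : σ i (x i) - σ k (x k) ≠ 0 := by
  intro h0
  obtain ⟨his, hi0⟩ := hg.isOrthMetricOn i hi
  have hsub := hσ.contDiffOn_sub hi hk
  have hpd (z : ι → ℝ) (hz : z ∈ box J) :
      pd k (fun x => (σ i (x i) - σ k (x k)) / g i x) z = 0 := by
    rw [pd_div k (differentiableAt_of_contDiffOn (isOpen_box hJ) hsub hz)
      (hg.differentiableAt hJ hi hz) (hi0 z hz), hσ.pd_sub_self hJ hi hk hik hz,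
      pd_eq_logpd_mul (hi0 z hz) k]
    ring
  have hval (t : ℝ) (ht : t ∈ J k) : σ k t = σ i (x i) := by
    have hline := update_eq_of_pd_eq_zero hJ ((hsub.div his hi0).differentiableOn (by simp)) hpd
      hx ht
    simp only [Pi.div_apply, update_self, update_of_ne hik, h0, zero_div] at hline
    have h0' := (div_eq_zero_iff.1 hline).resolve_right (hi0 _ (update_mem_box hx ht))
    exact (sub_eq_zero.1 h0').symm
  obtain ⟨t, ht, t', ht', hne⟩ := hσk
  exact hne ((hval t ht).trans (hval t' ht').symm)

lemma logpd_eq_zero (hJ : ∀ i, IsOpenInterval (J i)) (hσ : IsConcircularSpectrum J S g σ)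
    (hi : i ∈ S) (hk : k ∈ S) (hik : i ≠ k) (hσk : ¬ NonconstOn (σ k) (J k)) (hx : x ∈ box J)
    (hne : σ i (x i) - σ k (x k) ≠ 0) : logpd g i k x = 0 := by
  have hmul := hσ.logpd_mul_sub i hi k hk hik x hx
  rw [deriv_eq_zero_of_not_nonconstOn (hJ k).1 (mem_box.1 hx k) hσk, neg_zero] at hmul
  exact (mul_eq_zero.1 hmul).resolve_right hne

lemma contDiffOn_eigenvalueProd (hσ : IsConcircularSpectrum J S g σ) (hMS : M ⊆ S) (hi : i ∈ S) :
    ContDiffOn ℝ ∞ (eigenvalueProd σ M i) (box J) :=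
  contDiffOn_prod fun _ hc => hσ.contDiffOn_sub hi (hMS (Finset.mem_of_mem_erase hc))

lemma eigenvalueProd_ne_zero (hJ : ∀ i, IsOpenInterval (J i)) (hg : SepDiagSystem J S g)
    (hσ : IsConcircularSpectrum J S g σ) (hMS : M ⊆ S) (hM : ∀ a ∈ M, NonconstOn (σ a) (J a))
    (hi : i ∈ S) (hx : x ∈ box J) : eigenvalueProd σ M i x ≠ 0 := by
  refine Finset.prod_ne_zero_iff.2 fun c hc => ?_
  obtain ⟨hci, hcM⟩ := Finset.mem_erase.1 hc
  exact hσ.sub_ne_zero hJ hg hi (hMS hcM) hci.symm (hM c hcM) hx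

lemma pd_eigenvalueProd (hJ : ∀ i, IsOpenInterval (J i)) (hσ : IsConcircularSpectrum J S g σ)
    (hMS : M ⊆ S) (hi : i ∈ S) (hk : k ∈ M) (hik : i ≠ k) (hx : x ∈ box J) :
    pd k (eigenvalueProd σ M i) x = logpd g i k x * eigenvalueProd σ M i x := by
  have hk' : k ∈ M.erase i := Finset.mem_erase.2 ⟨hik.symm, hk⟩
  have hd (c : ι) (hc : c ∈ S) : DifferentiableAt ℝ (fun x : ι → ℝ => σ c (x c)) x :=
    differentiableAt_comp_eval (hσ.differentiableAt hJ hc hx)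
  have hcS {c : ι} (hc : c ∈ M.erase i) : c ∈ S := hMS (Finset.mem_of_mem_erase hc)
  unfold eigenvalueProd
  rw [pd_prod _ k fun c hc => (hd i hi).fun_sub (hd c (hcS hc)),
    Finset.sum_eq_single_of_mem k hk' fun c hc hck => ?_, hσ.pd_sub_self hJ hi (hMS hk) hik hx,
    ← Finset.mul_prod_erase _ _ hk']
  · ring
  · rw [pd_sub k (hd i hi) (hd c (hcS hc)),
      pd_comp_eval_of_ne hik.symm (hσ.differentiableAt hJ hi hx),
      pd_comp_eval_of_ne hck.symm (hσ.differentiableAt hJ (hcS hc) hx), sub_zero, mul_zero]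

variable (hJ : ∀ i, IsOpenInterval (J i)) (hg : SepDiagSystem J S g)
  (hσ : IsConcircularSpectrum J S g σ) (hMS : M ⊆ S)
  (hM : ∀ i ∈ S, i ∈ M ↔ NonconstOn (σ i) (J i))
include hJ hg hσ hMS hM

lemma dependsOnCoords_div_eigenvalueProd (hi : i ∈ M) :
    DependsOnCoords J {i} fun x => g i x / eigenvalueProd σ M i x := by
  have hiS := hMS hi
  have hW := hσ.contDiffOn_eigenvalueProd hMS hiS
  have hW0 (x : ι → ℝ) (hx : x ∈ box J) : eigenvalueProd σ M i x ≠ 0 :=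
    hσ.eigenvalueProd_ne_zero hJ hg hMS (fun a ha => (hM a (hMS ha)).1 ha) hiS hx
  have hquot : ContDiffOn ℝ ∞ (fun x => g i x / eigenvalueProd σ M i x) (box J) :=
    (hg.isOrthMetricOn i hiS).1.div hW hW0
  have hWM : DependsOnCoords J M (eigenvalueProd σ M i) := fun x _ y _ hxy =>
    Finset.prod_congr rfl fun c hc => by rw [hxy i hi, hxy c (Finset.mem_of_mem_erase hc)]
  refine dependsOnCoords_of_pd_eq_zero hJ (hquot.differentiableOn (by simp)) fun k hki z hz => ?_
  have hik : i ≠ k := fun h => hki (Finset.mem_singleton.2 h.symm)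
  have hWd := differentiableAt_of_contDiffOn (isOpen_box hJ) hW hz
  have hwronskian : pd k (g i) z * eigenvalueProd σ M i z
      = g i z * pd k (eigenvalueProd σ M i) z := by
    by_cases hkM : k ∈ M
    · rw [hσ.pd_eigenvalueProd hJ hMS hiS hkM hik hz,
        pd_eq_logpd_mul ((hg.isOrthMetricOn i hiS).2 z hz) k]
      ring
    rw [hWM.pd_eq_zero hJ hWd hkM hz, mul_zero, hg.pd_eq_zero hJ hiS hz fun hkS => ?_, zero_mul]
    refine hσ.logpd_eq_zero hJ hiS hkS hik ((hM k hkS).not.1 hkM) hz fun h0 => ?_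
    exact hσ.sub_ne_zero hJ hg hkS hiS hik.symm ((hM i hiS).1 hi) hz (by linarith)
  rw [pd_div k (hg.differentiableAt hJ hiS hz) hWd (hW0 z hz), hwronskian, sub_self, zero_div]

lemma exists_eq_mul_eigenvalueProd (hi : i ∈ M) :
    ∃ Φ : ℝ → ℝ, ContDiffOn ℝ ∞ Φ (J i) ∧
      ∀ x ∈ box J, g i x = Φ (x i) * eigenvalueProd σ M i x := by
  obtain ⟨b, hb⟩ := box_nonempty hJ
  have hiS := hMS hi
  have hW0 (x : ι → ℝ) (hx : x ∈ box J) : eigenvalueProd σ M i x ≠ 0 :=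
    hσ.eigenvalueProd_ne_zero hJ hg hMS (fun a ha => (hM a (hMS ha)).1 ha) hiS hx
  refine ⟨fun t => g i (update b i t) / eigenvalueProd σ M i (update b i t),
    contDiffOn_comp_update ((hg.isOrthMetricOn i hiS).1.div
      (hσ.contDiffOn_eigenvalueProd hMS hiS) hW0) hb i, fun x hx => ?_⟩
  exact (div_eq_iff (hW0 x hx)).1 (hσ.dependsOnCoords_div_eigenvalueProd hJ hg hMS hM hi x hx _
    (update_mem_box hb (mem_box.1 hx i)) (by simp))

lemma sepDiagSystem_div_prod (hIS : I ⊆ S) (hIM : Disjoint I M) (hI : I.Nonempty) {e : ℝ}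
    (he : ∀ i ∈ I, ∀ x ∈ box J, σ i (x i) = e)
    (hout : ∀ k ∈ S, k ∉ M → k ∉ I → ∀ x ∈ box J, σ k (x k) ≠ e) :
    SepDiagSystem J I fun i x => g i x / ∏ a ∈ M, (e - σ a (x a)) := by
  have hIM' (i : ι) (hi : i ∈ I) : i ∉ M := Finset.disjoint_left.1 hIM hi
  have hprod (i : ι) (hi : i ∈ I) (x : ι → ℝ) (hx : x ∈ box J) :
      ∏ a ∈ M, (e - σ a (x a)) = eigenvalueProd σ M i x := by
    rw [eigenvalueProd, Finset.erase_eq_of_notMem (hIM' i hi), he i hi x hx]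
  refine hg.div hJ hIS hIM
    (contDiffOn_prod fun a ha =>
      contDiffOn_const.sub (contDiffOn_comp_eval (hσ.contDiffOn a (hMS ha))))
    (fun x hx => ?_) (dependsOnCoords_prod_comp_eval fun a t => e - σ a t)
    (fun i hi k hk x hx => ?_) fun i hi k hk hkM hkI x hx => ?_
  · obtain ⟨i, hi⟩ := hI
    rw [hprod i hi x hx]
    exact hσ.eigenvalueProd_ne_zero hJ hg hMS (fun a ha => (hM a (hMS ha)).1 ha) (hIS hi) hx
  · rw [pd_congr_of_eqOn (isOpen_box hJ) hx (hprod i hi), hprod i hi x hx]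
    exact hσ.pd_eigenvalueProd hJ hMS (hIS hi) hk (fun h => hIM' i hi (h ▸ hk)) hx
  · refine hσ.logpd_eq_zero hJ (hIS hi) hk (fun h => hkI (h ▸ hi)) ((hM k hk).not.1 hkM) hx ?_
    rw [he i hi x hx]
    exact _root_.sub_ne_zero.2 (hout k hk hkM hkI x hx).symm

omit hMS hM in
theorem exists_isConcircularForm (ho : o ∈ S) (hσo : NonconstOn (σ o) (J o)) :
    ∃ (M : Finset ι) (P : Finpartition (S \ M)) (h : Finset ι → ι → (ι → ℝ) → ℝ), M.Nonempty ∧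
      IsConcircularForm J S M P h g ∧ ∀ I ∈ P.parts, SepDiagSystem J I (h I) := by
  classical
  obtain ⟨b, hb⟩ := box_nonempty hJ
  set M := S.filter fun i => NonconstOn (σ i) (J i)
  have hMS : M ⊆ S := Finset.filter_subset _ _
  have hM (i : ι) (hi : i ∈ S) : i ∈ M ↔ NonconstOn (σ i) (J i) := by simp [M, hi]
  have hconst {i : ι} (hi : i ∈ S) (hiM : i ∉ M) {x : ι → ℝ} (hx : x ∈ box J) :
      σ i (x i) = σ i (b i) := by
    by_contra hne
    exact hiM ((hM i hi).2 ⟨x i, mem_box.1 hx i, b i, mem_box.1 hb i, hne⟩)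
  obtain ⟨P, hP⟩ := exists_finpartition_mem_iff_eq (S \ M) fun i => σ i (b i)
  have hvalue : ∀ I ∈ P.parts, ∃ e : ℝ, ∀ k ∈ S \ M, k ∈ I ↔ σ k (b k) = e := fun I hI =>
    let ⟨i, hi⟩ := P.nonempty_of_mem_parts hI
    ⟨σ i (b i), hP I hI i hi⟩
  choose! e he using hvalue
  have hsys (I : Finset ι) (hI : I ∈ P.parts) :
      SepDiagSystem J I fun i x => g i x / ∏ a ∈ M, (e I - σ a (x a)) := by
    refine hσ.sepDiagSystem_div_prod hJ hg hMS hM (fun _ hi => mem_of_mem_parts hI hi)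
      (Finset.disjoint_left.2 fun _ hi => notMem_of_mem_parts hI hi) (P.nonempty_of_mem_parts hI)
      (fun i hi x hx => ?_) fun k hk hkM hkI x hx => ?_
    · rw [hconst (mem_of_mem_parts hI hi) (notMem_of_mem_parts hI hi) hx]
      exact (he I hI i (P.le hI hi)).1 hi
    · rw [hconst hk hkM hx]
      exact (he I hI k (Finset.mem_sdiff.2 ⟨hk, hkM⟩)).not.1 hkI
  have hΦ (a : ι) (ha : a ∈ M) := hσ.exists_eq_mul_eigenvalueProd hJ hg hMS hM ha
  choose! Φ hΦ using hΦ
  refine ⟨M, P, _, ⟨o, (hM o ho).2 hσo⟩, ⟨hMS, Φ, σ, e, fun a ha =>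
    ⟨(hΦ a ha).1, hσ.contDiffOn a (hMS ha), (hM a (hMS ha)).1 ha⟩,
    fun I hI => (hsys I hI).dependsOnlyOn, fun x hx a ha => (hΦ a ha).2 x hx,
    fun x hx I hI i hi => ?_⟩, hsys⟩
  have hgi := ((hsys I hI).isOrthMetricOn i hi).2 x hx
  exact (mul_div_cancel₀ _ (div_ne_zero_iff.1 hgi).2).symm

end IsConcircularSpectrum

end ConcircularForm

/-! ### Classification -/

section Exceptional

variable {ι : Type*} [Fintype ι] [DecidableEq ι] {J : ι → Set ℝ} {S I : Finset ι}
  {g : ι → (ι → ℝ) → ℝ} {x b : ι → ℝ} {i k o : ι} {t : ℝ}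

namespace SepDiagSystem

section

variable (hJ : ∀ i, IsOpenInterval (J i)) (hg : SepDiagSystem J S g) (ho : o ∈ S)
  (hnone : ∀ j ∈ S, ¬ Involves J g o j) (hb : b ∈ box J)
include hJ hg ho hnone

lemma dependsOnCoords_of_not_involves : DependsOnCoords J {o} (g o) := by
  refine dependsOnCoords_of_pd_eq_zero hJ ((hg.isOrthMetricOn o ho).1.differentiableOn (by simp))
    fun k hk z hz => hg.pd_eq_zero hJ ho hz fun hkS => ?_
  have hok : o ≠ k := fun h => hk (Finset.mem_singleton.2 h.symm)
  exact (not_involves_iff hok).1 (hnone k hkS) z hz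

lemma dependsOnCoords_logpd_of_not_involves (hi : i ∈ S) (hio : i ≠ o) :
    DependsOnCoords J {o} (logpd g i o) := by
  refine dependsOnCoords_of_pd_eq_zero hJ
    ((hg.contDiffOn_logpd hJ hi o).differentiableOn (by simp)) fun k hk z hz => ?_
  have hko : k ≠ o := fun h => hk (Finset.mem_singleton.2 h)
  obtain rfl | hki := eq_or_ne k i
  · rw [hg.pd_logpd k hi o ho hio z hz, (not_involves_iff hko.symm).1 (hnone k hi) z hz, mul_zero,
      neg_zero]
  · exact (hg.dependsOnCoords_logpd i hi o ho hio).pd_eq_zero hJ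
      (hg.differentiableAt_logpd hJ hi o hz) (by simp [hki, hko]) hz

include hb

lemma logpd_eq_logpd_update (hi : i ∈ S) (hio : i ≠ o) (hx : x ∈ box J) :
    logpd g i o x = logpd g i o (update b o (x o)) :=
  hg.dependsOnCoords_logpd_of_not_involves hJ ho hnone hi hio x hx _
    (update_mem_box hb (mem_box.1 hx o)) (by simp)

lemma logpd_eq_zero_of_logpd_ne (hi : i ∈ S) (hio : i ≠ o) (hk : k ∈ S) (hko : k ≠ o)
    (hik : i ≠ k) (ht : t ∈ J o) (hne : logpd g k o (update b o t) ≠ logpd g i o (update b o t))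
    (hx : x ∈ box J) : logpd g i k x = 0 := by
  have hz := update_mem_box hx ht
  have hmul := hg.logpd_mul_logpd i hi o ho k hk hio hik hko.symm _ hz
  rw [(not_involves_iff hko.symm).1 (hnone k hk) _ hz, mul_zero, zero_add,
    hg.logpd_congr hi hk hik hz hx (by simp [hio]) (by simp [hko]),
    hg.logpd_eq_logpd_update hJ ho hnone hb hi hio hz,
    hg.logpd_eq_logpd_update hJ ho hnone hb hk hko hz, update_self, mul_comm] at hmul
  by_contra h0
  exact hne (mul_left_cancel₀ h0 hmul).symm

lemma sepDiagSystem_div_update (hIS : I ⊆ S) (hoI : o ∉ I) {r : ι} (hr : r ∈ I)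
    (hI : ∀ i ∈ I, ∀ t ∈ J o, logpd g i o (update b o t) = logpd g r o (update b o t))
    (hout : ∀ k ∈ S, k ≠ o → k ∉ I →
      ∃ t ∈ J o, logpd g k o (update b o t) ≠ logpd g r o (update b o t)) :
    SepDiagSystem J I fun i x => g i x / g r (update b o (x o)) := by
  have hio {i : ι} (hi : i ∈ I) : i ≠ o := fun h => hoI (h ▸ hi)
  obtain ⟨hrs, hr0⟩ := hg.isOrthMetricOn r (hIS hr)
  refine hg.div hJ (M := {o}) hIS (Finset.disjoint_singleton_right.2 hoI)
    (contDiffOn_comp_eval (contDiffOn_comp_update hrs hb o))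
    (fun x hx => hr0 _ (update_mem_box hb (mem_box.1 hx o)))
    (fun x _ y _ hxy => by rw [hxy o (by simp)]) (fun i hi k hk x hx => ?_)
    fun i hi k hk hko hkI x hx => ?_
  · obtain rfl := Finset.mem_singleton.1 hk
    have hxk := mem_box.1 hx k
    have hz := update_mem_box hb hxk
    have hd := hasDerivAt_comp_update' k (hg.differentiableAt hJ (hIS hr) hz)
    rw [pd_comp_eval_self (φ := fun t => g r (update b k t)) k hd.differentiableAt, hd.deriv,
      pd_eq_logpd_mul (hr0 _ hz) k, hg.logpd_eq_logpd_update hJ ho hnone hb (hIS hi) (hio hi) hx,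
      hI i hi _ hxk]
  · rw [Finset.mem_singleton] at hko
    obtain ⟨t, ht, hne⟩ := hout k hk hko hkI
    rw [← hI i hi t ht] at hne
    exact hg.logpd_eq_zero_of_logpd_ne hJ ho hnone hb (hIS hi) (hio hi) hk hko
      (fun h => hkI (h ▸ hi)) ht hne hx

end

lemma nonconstOn_comp_update (hJ : ∀ i, IsOpenInterval (J i)) (hg : SepDiagSystem J S g)
    (hi : i ∈ S) (hb : b ∈ box J) (ht : t ∈ J o) (hne : logpd g i o (update b o t) ≠ 0) :
    NonconstOn (fun t => g i (update b o t)) (J o) := by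
  by_contra hconst
  have hz := update_mem_box hb ht
  have hderiv := (hasDerivAt_comp_update' o (hg.differentiableAt hJ hi hz)).deriv
  rw [deriv_eq_zero_of_not_nonconstOn (hJ o).1 ht hconst] at hderiv
  exact hne (by rw [logpd, ← hderiv, zero_div])

theorem exists_isExceptional (hJ : ∀ i, IsOpenInterval (J i)) (hg : SepDiagSystem J S g)
    (ho : o ∈ S) (hS : (S \ {o}).Nonempty) (hall : ∀ i ∈ S, i ≠ o → Involves J g i o)
    (hnone : ∀ j ∈ S, ¬ Involves J g o j) :
    ∃ (P : Finpartition (S \ {o})) (h : Finset ι → ι → (ι → ℝ) → ℝ),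
      IsExceptional J S o P h g ∧ ∀ I ∈ P.parts, SepDiagSystem J I (h I) := by
  obtain ⟨b, hb⟩ := box_nonempty hJ
  obtain ⟨P, hP⟩ := exists_finpartition_mem_iff_eq (S \ {o})
    fun i (t : J o) => logpd g i o (update b o t)
  have : Nonempty ι := ⟨o⟩
  choose! r hr using fun I (hI : I ∈ P.parts) => P.nonempty_of_mem_parts hI
  have hIS {I : Finset ι} (hI : I ∈ P.parts) : I ⊆ S := fun _ hi => mem_of_mem_parts hI hi
  have hoI {I : Finset ι} (hI : I ∈ P.parts) : o ∉ I := fun h =>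
    notMem_of_mem_parts hI h (Finset.mem_singleton_self o)
  have hsys (I : Finset ι) (hI : I ∈ P.parts) :
      SepDiagSystem J I fun i x => g i x / g (r I) (update b o (x o)) := by
    refine hg.sepDiagSystem_div_update hJ ho hnone hb (hIS hI) (hoI hI) (hr I hI)
      (fun i hi t ht => ?_) fun k hk hko hkI => ?_
    · exact congrFun ((hP I hI (r I) (hr I hI) i (P.le hI hi)).1 hi) ⟨t, ht⟩
    · obtain ⟨⟨t, ht⟩, hne⟩ := Function.ne_iff.1
        ((hP I hI (r I) (hr I hI) k (by simp [hk, hko])).not.1 hkI)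
      exact ⟨t, ht, hne⟩
  refine ⟨P, _, ⟨ho, P.parts_nonempty hS.ne_empty, fun t => g o (update b o t),
    fun I t => g (r I) (update b o t), contDiffOn_comp_update (hg.isOrthMetricOn o ho).1 hb o,
    fun I hI => ⟨?_, ?_, (hsys I hI).dependsOnlyOn⟩, fun x hx => ?_, fun x hx I hI i hi => ?_⟩,
    hsys⟩
  · exact contDiffOn_comp_update (hg.isOrthMetricOn _ (hIS hI (hr I hI))).1 hb o
  · have hrS := hIS hI (hr I hI)
    have hro : r I ≠ o := fun h => hoI hI (h ▸ hr I hI)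
    obtain ⟨-, y, hy, hne⟩ := hall _ hrS hro
    rw [hg.logpd_eq_logpd_update hJ ho hnone hb hrS hro hy] at hne
    exact hg.nonconstOn_comp_update hJ hrS hb (mem_box.1 hy o) hne
  · exact hg.dependsOnCoords_of_not_involves hJ ho hnone x hx _
      (update_mem_box hb (mem_box.1 hx o)) (by simp)
  · have hgi := ((hsys I hI).isOrthMetricOn i hi).2 x hx
    exact (mul_div_cancel₀ _ (div_ne_zero_iff.1 hgi).2).symm

end SepDiagSystem

end Exceptional

section Classification

variable {ι : Type*} [DecidableEq ι] {J : ι → Set ℝ} {S M I : Finset ι}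
  {g : ι → (ι → ℝ) → ℝ} {i k o p q : ι}

lemma ssubset_of_mem_parts {P : Finpartition (S \ M)} (hMS : M ⊆ S) (hM : M.Nonempty)
    (hI : I ∈ P.parts) : I ⊂ S := by
  obtain ⟨a, ha⟩ := hM
  exact (Finset.ssubset_iff_of_subset fun _ hi => mem_of_mem_parts hI hi).2
    ⟨a, hMS ha, fun haI => notMem_of_mem_parts hI haI ha⟩

lemma ssubset_of_one_lt_card_parts {P : Finpartition (S \ M)} (hP : 1 < P.parts.card)
    (hI : I ∈ P.parts) : I ⊂ S := by
  obtain ⟨K, hK, hKI⟩ := Finset.exists_mem_ne hP I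
  obtain ⟨k, hk⟩ := P.nonempty_of_mem_parts hK
  exact (Finset.ssubset_iff_of_subset fun _ hi => mem_of_mem_parts hI hi).2
    ⟨k, mem_of_mem_parts hK hk, Finset.disjoint_left.1 (P.disjoint hK hI hKI) hk⟩

variable [Fintype ι]

namespace SepDiagSystem

theorem exists_isProduct (hJ : ∀ i, IsOpenInterval (J i)) (hg : SepDiagSystem J S g)
    {C : ι → Prop} (hC : ∀ i ∈ S, ∀ k ∈ S, Involves J g i k → (C i ↔ C k)) (hp : p ∈ S)
    (hCp : C p) (hq : q ∈ S) (hCq : ¬ C q) :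
    ∃ (P : Finpartition (S \ ∅)) (h : Finset ι → ι → (ι → ℝ) → ℝ),
      IsProduct J S P h g ∧ ∀ I ∈ P.parts, SepDiagSystem J I (h I) := by
  obtain ⟨P, hP⟩ := exists_finpartition_mem_iff_eq (S \ ∅) C
  have hcard : 1 < P.parts.card := by
    refine Finset.one_lt_card.2 ⟨P.part p, part_mem_parts hp (Finset.notMem_empty p), P.part q,
      part_mem_parts hq (Finset.notMem_empty q), fun hpq => hCq ?_⟩
    have hqp : q ∈ P.part p := hpq ▸ mem_part hq (Finset.notMem_empty q)
    have heq := (hP _ (part_mem_parts hp (Finset.notMem_empty p)) p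
      (mem_part hp (Finset.notMem_empty p)) q (by simpa using hq)).1 hqp
    exact heq.symm ▸ hCp
  have hsys (I : Finset ι) (hI : I ∈ P.parts) : SepDiagSystem J I g := by
    have hone : SepDiagSystem J I fun i x => g i x / 1 :=
      hg.div hJ (M := ∅) (fun _ hi => mem_of_mem_parts hI hi) (by simp) contDiffOn_const
        (fun _ _ => one_ne_zero) (fun _ _ _ _ _ => rfl) (by simp) fun i hi k hk _ hkI => by
          have hne : i ≠ k := fun h => hkI (h ▸ hi)
          refine (not_involves_iff hne).1 fun hik => hkI ?_
          exact (hP I hI i hi k (by simpa using hk)).2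
            (propext (hC i (mem_of_mem_parts hI hi) k hk hik).symm)
    simpa only [div_one] using hone
  exact ⟨P, fun _ => g, ⟨hcard, Finset.empty_subset _, 0, 0, 0, by simp,
    fun I hI => (hsys I hI).dependsOnlyOn, by simp, by simp⟩, hsys⟩

lemma involves_terminal_iff (hJ : ∀ i, IsOpenInterval (J i)) (hg : SepDiagSystem J S g)
    (ho : o ∈ S) (hterm : ∀ j ∈ S, Involves J g o j → Involves J g j o) (hi : i ∈ S) (hk : k ∈ S)
    (hik : Involves J g i k) : (i = o ∨ Involves J g i o) ↔ (k = o ∨ Involves J g k o) := by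
  obtain rfl | hio := eq_or_ne i o
  · exact iff_of_true (.inl rfl) (.inr (hterm k hk hik))
  obtain rfl | hko := eq_or_ne k o
  · exact iff_of_true (.inr hik) (.inl rfl)
  simp only [hio, hko, false_or]
  refine ⟨fun hio' => ?_, hg.involves_trans hJ hi hk ho hio hik⟩
  exact (hg.involves_or_involves hJ hi ho hk hko.symm hio' hik).elim (hterm k hk) id

lemma isIrreducible_of_card_le_one (hJ : ∀ i, IsOpenInterval (J i)) (hg : SepDiagSystem J S g)
    (hS : S.card ≤ 1) : IsIrreducible J S g := by
  obtain ⟨b, hb⟩ := box_nonempty hJ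
  have hcard {i k : ι} (hi : i ∈ S) (hk : k ∈ S) : i = k := Finset.card_le_one.1 hS i hi k hk
  refine ⟨⊥, fun _ => g, subset_rfl, fun a t => g a (update b a t), fun _ t => t, 0,
    fun a ha => ⟨contDiffOn_comp_update (hg.isOrthMetricOn a ha).1 hb a, contDiffOn_id, ?_⟩,
    by simp, fun x hx a ha => ?_, by simp⟩
  · by_contra hconst
    have hderiv := deriv_eq_zero_of_not_nonconstOn (hJ a).1 (mem_box.1 hb a) hconst
    simp at hderiv
  · have herase : S.erase a = ∅ :=
      Finset.eq_empty_of_forall_notMem fun k hk =>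
        Finset.ne_of_mem_erase hk (hcard (Finset.mem_of_mem_erase hk) ha)
    rw [herase, Finset.prod_empty, mul_one]
    exact hg.dependsOnlyOn a ha x hx _ (update_mem_box hb (mem_box.1 hx a)) fun k hk => by
      rw [hcard hk ha, update_self]

theorem isClassified (hJ : ∀ i, IsOpenInterval (J i)) (hg : SepDiagSystem J S g) :
    IsClassified J S g := by
  induction S using Finset.strongInduction generalizing g with
  | H S ih =>
  by_cases hcard : S.card ≤ 1
  · exact .irreducible (hg.isIrreducible_of_card_le_one hJ hcard)
  push Not at hcard
  obtain ⟨o, ho, hterm⟩ := hg.exists_terminal hJ (Finset.card_pos.1 (by lia))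
  by_cases hall : ∀ i ∈ S, i = o ∨ Involves J g i o
  swap
  · push Not at hall
    obtain ⟨q, hq, hqo⟩ := hall
    obtain ⟨P, h, hprod, hblocks⟩ := hg.exists_isProduct hJ
      (fun i hi k hk hik => hg.involves_terminal_iff hJ ho hterm hi hk hik) ho (.inl rfl) hq
      (not_or.2 hqo)
    exact .product P h hprod fun I hI =>
      ih I (ssubset_of_one_lt_card_parts hprod.1 hI) (hblocks I hI)
  have hall' (i : ι) (hi : i ∈ S) (hio : i ≠ o) : Involves J g i o := (hall i hi).resolve_left hio
  by_cases hex : ∃ j ∈ S, Involves J g o j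
  · obtain ⟨j, hj, hoj⟩ := hex
    obtain ⟨σ, hσ, hσo⟩ := hg.exists_isConcircularSpectrum hJ ho hj hall' hoj
    obtain ⟨M, P, h, hM, hform, hblocks⟩ := hσ.exists_isConcircularForm hJ hg ho hσo
    by_cases hMS : M = S
    · subst hMS
      exact .irreducible ⟨P, h, hform⟩
    have hP : P.parts.Nonempty := P.parts_nonempty
      fun h0 => hMS (hform.1.antisymm (Finset.sdiff_eq_empty_iff_subset.1 h0))
    exact .warped M P h ⟨hM, hP, hform⟩ fun I hI =>
      ih I (ssubset_of_mem_parts hform.1 hM hI) (hblocks I hI)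
  · push Not at hex
    obtain ⟨k, hk, hko⟩ := Finset.exists_mem_ne hcard o
    obtain ⟨P, h, hexc, hblocks⟩ := hg.exists_isExceptional hJ ho ⟨k, by simp [hk, hko]⟩ hall' hex
    exact .exceptional o P h hexc fun I hI =>
      ih I (ssubset_of_mem_parts (by simpa using ho) (by simp) hI) (hblocks I hI)

end SepDiagSystem

end Classification

section

variable {ι : Type*} [Fintype ι] [DecidableEq ι] {J : ι → Set ℝ} {S : Finset ι}
  {g : ι → (ι → ℝ) → ℝ}

theorem SepDiagSystem.blocksAreOrthSepDiag (hJ : ∀ i, IsOpenInterval (J i))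
    (hg : SepDiagSystem J S g) : BlocksAreOrthSepDiag J S g := by
  have block {M : Finset ι} {P : Finpartition (S \ M)} {h : Finset ι → ι → (ι → ℝ) → ℝ}
      (hB : ∃ w, IsBlockForm J S M P h g w) (I : Finset ι) (hI : I ∈ P.parts) :
      BlockIsOrthSepDiag J I (h I) := by
    obtain ⟨w, hB⟩ := hB
    have hsys := hB.sepDiagSystem hJ hg hI
    exact (hsys.isClassified hJ).blockIsOrthSepDiag hJ hsys.isOrthMetricOn
  exact ⟨fun _ _ hprod => block hprod.2.isBlockForm, fun _ _ _ hwarp => block hwarp.2.2.isBlockForm,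
    fun _ _ _ hexc => block hexc.isBlockForm⟩

end

end OrthSep

theorem mainTheorem3_general {ι : Type*} [Fintype ι] [DecidableEq ι] {J : ι → Set ℝ}
    (hJ : ∀ i, OrthSep.IsOpenInterval (J i)) {g : ι → (ι → ℝ) → ℝ}
    (hg : OrthSep.IsOrthMetric (OrthSep.box J) g) :
    (OrthSep.IsSeparable (OrthSep.box J) (OrthSep.diagMetric g) ∧
        OrthSep.HasDiagonalCurvature (OrthSep.box J) (OrthSep.diagMetric g) →
      OrthSep.IsClassified J Finset.univ g ∧ OrthSep.BlocksAreOrthSepDiag J Finset.univ g) ∧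
    (OrthSep.IsClassified J Finset.univ g →
      OrthSep.LeviCivitaEquations (OrthSep.box J) g ∧
        OrthSep.IsSeparable (OrthSep.box J) (OrthSep.diagMetric g) ∧
        OrthSep.HasDiagonalCurvature (OrthSep.box J) (OrthSep.diagMetric g)) := by
  refine ⟨fun hsepdiag => ?_, fun hcl => ?_⟩
  · have hsys := OrthSep.sepDiagSystem_of_isOrthSepDiag hJ ⟨hg, hsepdiag⟩
    exact ⟨hsys.isClassified hJ, hsys.blocksAreOrthSepDiag hJ⟩
  · have hg' : OrthSep.IsOrthMetricOn J Finset.univ g := fun i _ => hg i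
    obtain ⟨-, hsep, hcurv⟩ := OrthSep.isOrthSepDiag_of_hasStaeckelSystem hJ hg
      (fun x₀ hx₀ => hcl.hasStaeckelSystem hg' hx₀) hcl.hasPairFactors
    exact ⟨OrthSep.leviCivitaEquations_of_isSeparable (OrthSep.isOpen_box hJ) hg hsep, hsep, hcurv⟩

theorem mainTheorem3 (n : ℕ) (J : Fin n → Set ℝ) (hJ : ∀ i, OrthSep.IsOpenInterval (J i))
    (g : Fin n → (Fin n → ℝ) → ℝ) (hg : OrthSep.IsOrthMetric (OrthSep.box J) g) :
    (OrthSep.IsSeparable (OrthSep.box J) (OrthSep.diagMetric g) ∧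
        OrthSep.HasDiagonalCurvature (OrthSep.box J) (OrthSep.diagMetric g) →
      OrthSep.IsClassified J Finset.univ g ∧ OrthSep.BlocksAreOrthSepDiag J Finset.univ g) ∧
    (OrthSep.IsClassified J Finset.univ g →
      OrthSep.LeviCivitaEquations (OrthSep.box J) g ∧
        OrthSep.IsSeparable (OrthSep.box J) (OrthSep.diagMetric g) ∧
        OrthSep.HasDiagonalCurvature (OrthSep.box J) (OrthSep.diagMetric g)) :=
  mainTheorem3_general hJ hg
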